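/- Let $n\ge 1$ and let $c_0,\nu_0,\alpha_p,D_{\rm Th}>0$, $\beta>1/3$, $\gamma>1$. Consider the Cauchy problem on $\mathbb R^n$ $$\phi_{tt}-c_0^2\Delta\phi-(1+\beta)\nu_0\Delta\phi_t+\alpha_pc_0^2T_t=0,\qquad T_t-\gamma D_{\rm Th}\Delta T+\tfrac{\gamma-1}{\alpha_p}\Delta\phi=0\qquad(t>0),$$ $$\phi(0)=\phi_0,\quad \phi_t(0)=\phi_1,\quad T(0)=T_0,$$ with real data $\phi_0,\phi_1,T_0\in L^2\cap L^1$ and, in addition, $\phi_1\in L^{1,1}$, where $\|f\|_{L^{1,1}}=\int(1+|x|)|f(x)|\,dx$. A solution is a pair $\phi,T\in C([0,\infty);L^2)$ that satisfies the equations in the sense of tempered distributions in $x$ (with time derivatives taken after testing against Schwartz functions) and attains the initial data, that of $\phi_t$ after testing against Schwartz functions. Put $$\Gamma_0=\tfrac12\big[(1+\beta)\nu_0+(\gamma-1)D_{\rm Th}\big],\qquad \Gamma_1=\frac{-\Gamma_0^2-2D_{\rm Th}\Gamma_0+(1+\beta)\nu_0\gamma D_{\rm Th}}{2\sqrt\gamma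 c_0},$$ $P_f=\int f\,dx$, $M_f=\int x f(x)\,dx$, $\mathcal F^{-1}[m](x)=(2\pi)^{-n}\int e^{ix\cdot\xi}m(\xi)\,d\xi$, and $$\mathcal G_0=\mathcal F^{-1}\Big[\tfrac{\sin(\sqrt\gamma c_0|\xi|t)}{\sqrt\gamma c_0|\xi|}e^{-\Gamma_0|\xi|^2t}\Big],\qquad \mathcal G_1=\mathcal F^{-1}\big[\cos(\sqrt\gamma c_0|\xi|t)e^{-\Gamma_0|\xi|^2t}\big],$$ $$K=\mathcal F^{-1}\big[e^{-D_{\rm Th}|\xi|^2t}-\cos(\sqrt\gamma c_0|\xi|t)e^{-\Gamma_0|\xi|^2t}\big],\quad \mathcal G_2=\tfrac{(\gamma-1)D_{\rm Th}}{\gamma c_0^2}K,\quad \mathcal G_3=\alpha_pD_{\rm Th}K,\quad \mathcal H_0=-\tfrac{\Gamma_1}{\sqrt\gamma c_0}\,t\,\Delta\mathcal G_1,$$ $$\tilde\varphi=\mathcal G_0P_{\phi_1},\qquad \psi=-\nabla\mathcal G_0\cdot M_{\phi_1}+\mathcal G_1P_{\phi_0}+(\mathcal H_0+\mathcal G_2)P_{\phi_1}+\mathcal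 G_3P_{T_0}.$$ Then there are constants $c,C,t_0>0$ depending only on $n$ and on $c_0,\nu_0,\alpha_p,D_{\rm Th},\beta,\gamma$ such that for all such data and every solution $(\phi,T)$: (i) $\|\phi(t)-\tilde\varphi(t)\|_{L^2}\le C\,t^{-n/4}\,\|(\phi_0,\phi_1,T_0)\|_{(L^2\cap L^1)\times(L^2\cap L^{1,1})\times(L^2\cap L^1)}$ for all $t\ge t_0$; (ii) if $M_{\phi_1}\ne0$, then $\|\phi(t)-\tilde\varphi(t)\|_{L^2}\ge c\,t^{-n/4}|M_{\phi_1}|$ for all $t\ge t_1$, where $t_1$ may depend on the data; in particular $\|\phi(t)-\tilde\varphi(t)\|_{L^2}\simeq t^{-n/4}$ for large $t$; (iii) $\|\phi(t)-\tilde\varphi(t)-\psi(t)\|_{L^2}=o(t^{-n/4})$ as $t\to\infty$. -/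

import Mathlib

open MeasureTheory Filter Topology Set
open scoped SchwartzMap Laplacian

namespace Thermoviscous

/-- Physical constants of the thermoviscous acoustic system, with the ranges they have physically:
the isothermal speed of sound `c₀ = 1/√(ρ₀ κ_T)` is positive, the viscosity ratio
`β = ηᵇ/ηˢ + 1/3` exceeds `1/3`, and `γ = c_P/c_V` exceeds `1`. -/
structure Params where
  /-- isothermal speed of sound -/
  c₀ : ℝ
  /-- viscosity ratio -/
  β : ℝ
  /-- momentum diffusion constant -/
  ν₀ : ℝ
  /-- isobaric thermal expansion coefficient -/
  αp : ℝ
  /-- ratio of specific heat capacities -/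
  γ : ℝ
  /-- thermal diffusion constant -/
  Dth : ℝ
  c₀_pos : 0 < c₀
  β_gt : 1 / 3 < β
  ν₀_pos : 0 < ν₀
  αp_pos : 0 < αp
  γ_gt : 1 < γ
  Dth_pos : 0 < Dth

namespace Params

/-- The diffusivity `Γ₀ = ((1+β)ν₀ + (γ-1)D_Th)/2`. -/
noncomputable def Γ₀ (p : Params) : ℝ := ((1 + p.β) * p.ν₀ + (p.γ - 1) * p.Dth) / 2

/-- The propagation speed `√γ c₀`. -/
noncomputable def speed (p : Params) : ℝ := √p.γ * p.c₀

/-- The constant `Γ₁ = (-Γ₀² - 2 D_Th Γ₀ + (1+β) ν₀ γ D_Th)/(2 √γ c₀)`. -/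
noncomputable def Γ₁ (p : Params) : ℝ :=
  (-p.Γ₀ ^ 2 - 2 * p.Dth * p.Γ₀ + (1 + p.β) * p.ν₀ * p.γ * p.Dth) / (2 * p.speed)

end Params

/-- The space `ℝⁿ` with its Euclidean norm. -/
abbrev Sp (n : ℕ) : Type := EuclideanSpace ℝ (Fin n)

variable {n : ℕ}

/-! ### Weak solutions of the Cauchy problem -/

/-- The pairing `∫ f θ dx` of a function with a Schwartz function. -/
noncomputable def pair (f : Sp n → ℝ) (θ : 𝓢(Sp n, ℂ)) : ℂ := ∫ x, (f x : ℂ) * θ x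

/-- `(φ, T)` is a solution, with `φ, T ∈ C([0,∞); L²(ℝⁿ))`, of
```
φ_tt - c₀² Δφ - (1+β) ν₀ Δφ_t + αp c₀² T_t = 0,     t > 0,
T_t - γ D_Th ΔT + ((γ-1)/αp) Δφ = 0,                t > 0,
φ(0) = φ₀,  φ_t(0) = φ₁,  T(0) = T₀.
```
The equations hold in the sense of tempered distributions in `x`: `φt t`, `φtt t` and `Tt t` below
are the distributions `φ_t(t)`, `φ_tt(t)` and `T_t(t)`, given by their values on test functions
`θ`, and are determined by `φ` and `T`; the time derivatives are taken after
testing with `θ`, and `φ_t` attains its initial value continuously. -/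
structure IsWeakSolution (p : Params) (φ₀ φ₁ T₀ : Sp n → ℝ)
    (φ T : ℝ → Lp ℝ 2 (volume : Measure (Sp n))) : Prop where
  continuousOn_φ : ContinuousOn φ (Ici 0)
  continuousOn_T : ContinuousOn T (Ici 0)
  init_φ : φ 0 =ᵐ[volume] φ₀
  init_T : T 0 =ᵐ[volume] T₀
  equations : ∃ φt φtt Tt : ℝ → 𝓢(Sp n, ℂ) → ℂ,
    (∀ θ, ContinuousOn (fun t => φt t θ) (Ici 0)) ∧
    (∀ θ, φt 0 θ = pair φ₁ θ) ∧
    ∀ θ, ∀ t > 0,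
      HasDerivAt (fun s => pair (φ s) θ) (φt t θ) t ∧
      HasDerivAt (fun s => φt s θ) (φtt t θ) t ∧
      HasDerivAt (fun s => pair (T s) θ) (Tt t θ) t ∧
      φtt t θ - p.c₀ ^ 2 * pair (φ t) (Δ θ) - (1 + p.β) * p.ν₀ * φt t (Δ θ)
        + p.αp * p.c₀ ^ 2 * Tt t θ = 0 ∧
      Tt t θ - p.γ * p.Dth * pair (T t) (Δ θ) + (p.γ - 1) / p.αp * pair (φ t) (Δ θ) = 0

/-! ### Norms and moments of the data -/

/-- `‖f‖_{L² ∩ L¹} = ‖f‖_{L²} + ‖f‖_{L¹}`. -/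
noncomputable def normL2L1 (f : Sp n → ℝ) : ENNReal :=
  eLpNorm f 2 volume + eLpNorm f 1 volume

/-- `‖f‖_{L^{1,1}} = ∫ (1 + |x|) |f(x)| dx`. -/
noncomputable def normL11 (f : Sp n → ℝ) : ENNReal :=
  ∫⁻ x, ENNReal.ofReal ((1 + ‖x‖) * |f x|)

/-- The norm of `(φ₀, φ₁, T₀)` in `(L² ∩ L¹) × (L² ∩ L^{1,1}) × (L² ∩ L¹)`. -/
noncomputable def dataNorm (φ₀ φ₁ T₀ : Sp n → ℝ) : ENNReal :=
  normL2L1 φ₀ + (eLpNorm φ₁ 2 volume + normL11 φ₁) + normL2L1 T₀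

/-- The mean `P_f = ∫ f(x) dx`. -/
noncomputable def mean (f : Sp n → ℝ) : ℝ := ∫ x, f x

/-- The first moment `M_f = ∫ x f(x) dx ∈ ℝⁿ`. -/
noncomputable def moment (f : Sp n → ℝ) : Sp n := ∫ x, f x • x

/-! ### Asymptotic profiles -/

/-- The inverse Fourier transform of a real radial symbol, `(2π)⁻ⁿ ∫ exp(i x·ξ) m(|ξ|) dξ`;
it matches the Fourier transform `∫ exp(-i x·ξ) f(x) dx`, whose value at `0` is the mean. -/
noncomputable def radialFourierInv (n : ℕ) (m : ℝ → ℝ) (x : Sp n) : ℂ :=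
  ((2 * Real.pi : ℝ) ^ n : ℂ)⁻¹ * ∫ ξ : Sp n,
    Complex.exp (Complex.I * (inner ℝ x ξ : ℝ)) * (m ‖ξ‖ : ℂ)

/-- `𝓖₀`, with symbol `sin(√γ c₀|ξ|t)/(√γ c₀|ξ|) · exp(-Γ₀|ξ|²t)`. -/
noncomputable def G₀ (p : Params) (t : ℝ) : Sp n → ℂ :=
  radialFourierInv n fun r =>
    Real.sin (p.speed * r * t) / (p.speed * r) * Real.exp (-p.Γ₀ * r ^ 2 * t)

/-- `𝓖₁`, with symbol `cos(√γ c₀|ξ|t) exp(-Γ₀|ξ|²t)`. -/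
noncomputable def G₁ (p : Params) (t : ℝ) : Sp n → ℂ :=
  radialFourierInv n fun r => Real.cos (p.speed * r * t) * Real.exp (-p.Γ₀ * r ^ 2 * t)

/-- `𝓖₂`, with symbol
`(γ-1)D_Th/(γc₀²) · (exp(-D_Th|ξ|²t) - cos(√γ c₀|ξ|t) exp(-Γ₀|ξ|²t))`. -/
noncomputable def G₂ (p : Params) (t : ℝ) : Sp n → ℂ :=
  radialFourierInv n fun r => (p.γ - 1) * p.Dth / (p.γ * p.c₀ ^ 2) *
    (Real.exp (-p.Dth * r ^ 2 * t) - Real.cos (p.speed * r * t) * Real.exp (-p.Γ₀ * r ^ 2 * t))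

/-- `𝓖₃`, with symbol `αp D_Th (exp(-D_Th|ξ|²t) - cos(√γ c₀|ξ|t) exp(-Γ₀|ξ|²t))`. -/
noncomputable def G₃ (p : Params) (t : ℝ) : Sp n → ℂ :=
  radialFourierInv n fun r => p.αp * p.Dth *
    (Real.exp (-p.Dth * r ^ 2 * t) - Real.cos (p.speed * r * t) * Real.exp (-p.Γ₀ * r ^ 2 * t))

/-- `𝓗₀ = -(Γ₁/(√γ c₀)) t Δ𝓖₁`. -/
noncomputable def H₀ (p : Params) (t : ℝ) (x : Sp n) : ℂ :=
  -((p.Γ₁ / p.speed * t : ℝ) : ℂ) * (Δ (G₁ p t : Sp n → ℂ)) x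

/-- The diffusion wave `𝓖₀(t,x) P_{φ₁}`. -/
noncomputable def leading (p : Params) (φ₁ : Sp n → ℝ) (t : ℝ) (x : Sp n) : ℂ :=
  G₀ p t x * mean φ₁

/-- The second profile
`-∇𝓖₀ · M_{φ₁} + 𝓖₁ P_{φ₀} + (𝓗₀ + 𝓖₂) P_{φ₁} + 𝓖₃ P_{T₀}`. -/
noncomputable def second (p : Params) (φ₀ φ₁ T₀ : Sp n → ℝ) (t : ℝ) (x : Sp n) : ℂ :=
  -(fderiv ℝ (G₀ p t : Sp n → ℂ) x (moment φ₁)) + G₁ p t x * mean φ₀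
    + (H₀ p t x + G₂ p t x) * mean φ₁ + G₃ p t x * mean T₀

/-- `‖φ(t) - 𝓖₀(t) P_{φ₁}‖_{L²}`. -/
noncomputable def err (p : Params) (φ₁ : Sp n → ℝ)
    (φ : ℝ → Lp ℝ 2 (volume : Measure (Sp n))) (t : ℝ) : ENNReal :=
  eLpNorm (fun x => (φ t x : ℂ) - leading p φ₁ t x) 2 volume

/-- `‖φ(t) - 𝓖₀(t) P_{φ₁} - ψ(t)‖_{L²}`, with `ψ` the second profile. -/
noncomputable def err₂ (p : Params) (φ₀ φ₁ T₀ : Sp n → ℝ)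
    (φ : ℝ → Lp ℝ 2 (volume : Measure (Sp n))) (t : ℝ) : ENNReal :=
  eLpNorm (fun x => (φ t x : ℂ) - leading p φ₁ t x - second p φ₀ φ₁ T₀ t x) 2 volume

end Thermoviscous

open Thermoviscous

namespace Thermoviscous

/-! At a frequency of modulus `r` the system is a linear ODE for `v = φ̂`, `u = φ̂_t` and `z = αp γ
c₀² T̂ + (γ-1) φ̂_t`; this `z` is chosen because its equation does not contain `v`. For small `r`
the matrix has two acoustic eigenvalues close to `-Γ₀ r² ± i(√γ c₀ r + Γ₁ r³)` and a thermal one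
close to `-D_Th r²`. The exact eigenvalues are never needed. The approximate modes solve the ODE up
to a forcing of size `r⁴`, and a Lyapunov functional with decay rate proportional to `r²/(1+r²)`
turns this into an error `r exp(-k r² t)` in `v` (`IsModeSolution.sub_modalProfile_le`). For `r ≥ 1`
the same functional gives exponential decay in `t`. Expanding the phase shift `Γ₁ r³ t` then
produces exactly the symbols of the profiles (`IsModeSolution.sub_symbolProfile_le`).

In `L²` a Gaussian `exp(-κ r² t)` is worth `t^(-n/4)`, and each further factor `r` is worth
`t^(-1/2)`. So the transforms of the data may be replaced by their Taylor polynomials at frequency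
zero: the mean for `φ₀` and `T₀`, but mean and first moment for `φ₁`, whose symbol carries a factor
`1/r`. This gives the refined estimate; keeping only the leading wave gives the upper bound.

For the lower bound, all terms of the second profile have real symbols except the dipole `-∇𝓖₀ · M`,
whose symbol is purely imaginary. Hence nothing can cancel it (`abs_dipoleSymbol_le`), and its norm
is bounded below by rotation invariance and by averaging `sin²` over the shell `|ξ| ~ t^(-1/2)`.

A weak solution does not directly give an ODE at each frequency. Testing with `𝓕 η`, `η` of compact
support, turns `-Δ` into multiplication of `η` by `|2πξ|²`, so the tested quantities form an
infinite hierarchy with geometric growth. Iterating the integral equation proves uniqueness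
(`hierarchy_eq_zero`) and identifies the transform of `φ(t)` with the explicit matrix exponential
(`IsWeakSolution.fourierLp_ae_eq`). -/

/-! ### Energy decay at a fixed frequency -/

theorem exists_mul_sq_add_sq_le {A B : ℝ} (hA : 0 < A) (hB : 0 < B) (m : ℝ) :
    ∃ κ > 0, ∀ u z : ℝ, κ * (u ^ 2 + z ^ 2) ≤ A * (m * u - z) ^ 2 + B * u ^ 2 := by
  have h1 : 0 < 1 + 2 * m ^ 2 := by positivity
  refine ⟨min (A / 2) (B / (1 + 2 * m ^ 2)), by positivity, fun u z => ?_⟩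
  set κ := min (A / 2) (B / (1 + 2 * m ^ 2))
  have hκ1 : κ ≤ A / 2 := min_le_left _ _
  have hκ2 : κ * (1 + 2 * m ^ 2) ≤ B := (le_div_iff₀ h1).1 (min_le_right _ _)
  have hκ : 0 < κ := by positivity
  have h2 : u ^ 2 + z ^ 2 ≤ 2 * (m * u - z) ^ 2 + (1 + 2 * m ^ 2) * u ^ 2 := by
    nlinarith [sq_nonneg (2 * m * u - z)]
  calc κ * (u ^ 2 + z ^ 2) ≤ κ * (2 * (m * u - z) ^ 2 + (1 + 2 * m ^ 2) * u ^ 2) := by gcongr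
    _ = 2 * κ * (m * u - z) ^ 2 + κ * (1 + 2 * m ^ 2) * u ^ 2 := by ring
    _ ≤ _ := by gcongr; linarith

theorem two_mul_le_of_sq (η x y : ℝ) (hη : 0 < η) : x * y ≤ η * x ^ 2 + y ^ 2 / (4 * η) := by
  have : η * x ^ 2 + y ^ 2 / (4 * η) - x * y = (2 * η * x - y) ^ 2 / (4 * η) := by
    field_simp; ring
  have h : 0 ≤ (2 * η * x - y) ^ 2 / (4 * η) := by positivity
  linarith

set_option maxHeartbeats 1000000 in
/-- The dissipation inequality for the Lyapunov functional
`(u² + s q v² + K z²)/2 + ε ρ u v` at squared frequency `q`, with `ρ = q/(1+q)`. -/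
theorem lyapunov_dissipation {s b m D : ℝ} (hs : 0 < s) (hb : 0 < b) (hm : 0 < m) (hD : 0 < D) :
    ∃ K ε c₁ c₂ c₃ C : ℝ, 0 < c₁ ∧ 0 < c₂ ∧ 0 < c₃ ∧ 0 < C ∧ ∀ q ρ : ℝ, 0 < q → ρ = q / (1 + q) →
      ∀ v u z R₁ R₂ : ℝ,
        c₁ * (u ^ 2 + q * v ^ 2 + z ^ 2) ≤
          (u ^ 2 + s * q * v ^ 2 + K * z ^ 2) / 2 + ε * ρ * (u * v) ∧
        (u ^ 2 + s * q * v ^ 2 + K * z ^ 2) / 2 + ε * ρ * (u * v) ≤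
          c₂ * (u ^ 2 + q * v ^ 2 + z ^ 2) ∧
        u * (-s * q * v - (b + m * D) * q * u + D * q * z + R₁) + s * q * (v * u)
          + K * z * (-D * q * z + m * (D - b) * q * u + R₂)
          + ε * ρ * ((-s * q * v - (b + m * D) * q * u + D * q * z + R₁) * v + u * u) ≤
        -c₃ * ρ * (u ^ 2 + q * v ^ 2 + z ^ 2) + C * (R₁ ^ 2 + R₂ ^ 2) / ρ := by
  -- With `K = D/(m(D+b))`, the dissipation form `(b+mD)u² - (D + K m(D-b)) u z + K D z²` equals `A
  -- (m u - z)² + B u²` for these `A`, `B`: the square is complete and the form is positive whatever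
  -- the sizes of `D` and `b`.
  obtain ⟨κ, hκ, hQ⟩ := exists_mul_sq_add_sq_le (A := D ^ 2 / m / (D + b))
    (B := b * (D + b + m * D) / (D + b)) (by positivity) (by positivity) m
  set B := b + m * D with hB
  have hBpos : 0 < B := by positivity
  set K := D / (m * (D + b)) with hK
  have hKpos : 0 < K := by positivity
  set M := 1 + B ^ 2 / s + D ^ 2 / s with hM
  have hMpos : 0 < M := by positivity
  -- The cross term makes `v` dissipate. The bounds `1/2` and `s/2` keep the functional equivalent
  -- to the energy; `κ/(2M)` lets the dissipation of `u` and `z` pay for the terms `ε M q (u² + z²)`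
  -- that the cross term creates.
  set ε := min (min (1 / 2) (s / 2)) (κ / (2 * M)) with hε
  have hεpos : 0 < ε := by positivity
  have hε1 : ε ≤ 1 / 2 := (min_le_left _ _).trans (min_le_left _ _)
  have hε2 : ε ≤ s / 2 := (min_le_left _ _).trans (min_le_right _ _)
  have hε3 : ε * M ≤ κ / 2 := by
    have : ε ≤ κ / (2 * M) := min_le_right _ _
    calc ε * M ≤ κ / (2 * M) * M := by gcongr
      _ = κ / 2 := by field_simp
  refine ⟨K, ε, min (1 / 4) (min (s / 4) (K / 2)), 1 + s + K, min (κ / 4) (ε * s / 4),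
    1 / κ + K ^ 2 / κ + ε / s, by positivity, by positivity, by positivity, by positivity, ?_⟩
  intro q ρ hq hρ v u z R₁ R₂
  have hρpos : 0 < ρ := by rw [hρ]; positivity
  have hρ1 : ρ ≤ 1 := by rw [hρ, div_le_one (by positivity)]; linarith
  have hρq : ρ ≤ q := by rw [hρ]; exact div_le_self hq.le (by linarith)
  have hρ2 : ρ ^ 2 ≤ ρ := by nlinarith
  have hcross : |ρ * (u * v)| ≤ (u ^ 2 + q * v ^ 2) / 2 := by
    have h1 : ρ ^ 2 * v ^ 2 ≤ q * v ^ 2 := by gcongr; linarith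
    rw [abs_le]; constructor <;> nlinarith [sq_nonneg (u + ρ * v), sq_nonneg (u - ρ * v)]
  obtain ⟨hc1, hc2⟩ := abs_le.1 hcross
  have hqv : 0 ≤ q * v ^ 2 := by positivity
  refine ⟨?_, ?_, ?_⟩
  · have e1 : min (1 / 4) (min (s / 4) (K / 2)) ≤ 1 / 4 := min_le_left _ _
    have e2 : min (1 / 4) (min (s / 4) (K / 2)) ≤ s / 4 :=
      (min_le_right _ _).trans (min_le_left _ _)
    have e3 : min (1 / 4) (min (s / 4) (K / 2)) ≤ K / 2 :=
      (min_le_right _ _).trans (min_le_right _ _)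
    have f1 := mul_le_mul_of_nonneg_right e1 (sq_nonneg u)
    have f2 := mul_le_mul_of_nonneg_right e2 hqv
    have f3 := mul_le_mul_of_nonneg_right e3 (sq_nonneg z)
    have f4 := mul_le_mul_of_nonneg_left hc1 hεpos.le
    have f5 := mul_le_mul_of_nonneg_right hε1 (sq_nonneg u)
    have f6 := mul_le_mul_of_nonneg_right hε2 hqv
    nlinarith
  · have f4 := mul_le_mul_of_nonneg_left hc2 hεpos.le
    have f5 := mul_le_mul_of_nonneg_right hε1 (sq_nonneg u)
    have f6 := mul_le_mul_of_nonneg_right hε2 hqv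
    have g1 : 0 ≤ s * u ^ 2 := by positivity
    have g2 : 0 ≤ K * u ^ 2 := by positivity
    have g3 : 0 ≤ K * (q * v ^ 2) := by positivity
    have g4 : 0 ≤ s * z ^ 2 := by positivity
    have g5 : 0 ≤ K * z ^ 2 := by positivity
    have g6 : 0 ≤ s * (q * v ^ 2) := by positivity
    nlinarith [sq_nonneg u, sq_nonneg z]
  · have hquad : κ * (u ^ 2 + z ^ 2) ≤
        B * u ^ 2 - (D + K * m * (D - b)) * (u * z) + K * D * z ^ 2 := by
      refine (hQ u z).trans (le_of_eq ?_)
      rw [hK, hB]; field_simp; ring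
    have hquad' := mul_le_mul_of_nonneg_left hquad hq.le
    have hρv : ρ ^ 2 * (q * v ^ 2) ≤ ρ * (q * v ^ 2) := by gcongr
    have hu2 : ρ * u ^ 2 ≤ q * u ^ 2 := by gcongr
    have hz2 : ρ * z ^ 2 ≤ q * z ^ 2 := by gcongr
    have hs4 : 0 ≤ s / 4 := by positivity
    -- The derivative of the cross term contains `-s ρ q v²`. The Young inequalities `a1`, `a2`,
    -- `a3` each spend a quarter of it, so a quarter survives.
    have a1 : -(B * q * ρ * (u * v)) ≤ s / 4 * (ρ * (q * v ^ 2)) + B ^ 2 / s * (q * u ^ 2) := by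
      have := two_mul_le_of_sq (s / 4) (ρ * v) (-(B * u)) (by positivity)
      have h2 := mul_le_mul_of_nonneg_left this hq.le
      have h3 : q * (s / 4 * (ρ * v) ^ 2 + (-(B * u)) ^ 2 / (4 * (s / 4)))
        = s / 4 * (ρ ^ 2 * (q * v ^ 2)) + B ^ 2 / s * (q * u ^ 2) := by field_simp
      have h4 := mul_le_mul_of_nonneg_left hρv hs4
      linarith [h2]
    have a2 : D * q * ρ * (z * v) ≤ s / 4 * (ρ * (q * v ^ 2)) + D ^ 2 / s * (q * z ^ 2) := by
      have := two_mul_le_of_sq (s / 4) (ρ * v) (D * z) (by positivity)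
      have h2 := mul_le_mul_of_nonneg_left this hq.le
      have h3 : q * (s / 4 * (ρ * v) ^ 2 + (D * z) ^ 2 / (4 * (s / 4)))
        = s / 4 * (ρ ^ 2 * (q * v ^ 2)) + D ^ 2 / s * (q * z ^ 2) := by field_simp
      have h4 := mul_le_mul_of_nonneg_left hρv hs4
      linarith [h2]
    have hq' : 1 / q ≤ 1 / ρ := one_div_le_one_div_of_le hρpos hρq
    have hqs (x : ℝ) : x ^ 2 / q ≤ x ^ 2 / ρ := by
      rw [div_eq_mul_one_div, div_eq_mul_one_div (x ^ 2) ρ]; gcongr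
    have a3 : ρ * (v * R₁) ≤ s / 4 * (ρ * (q * v ^ 2)) + 1 / s * (R₁ ^ 2 / ρ) := by
      have := two_mul_le_of_sq (s / 4 * q) (ρ * v) R₁ (by positivity)
      have h3 : s / 4 * q * (ρ * v) ^ 2 + R₁ ^ 2 / (4 * (s / 4 * q))
        = s / 4 * (ρ ^ 2 * (q * v ^ 2)) + 1 / s * (R₁ ^ 2 / q) := by field_simp
      have h4 : 1 / s * (R₁ ^ 2 / q) ≤ 1 / s * (R₁ ^ 2 / ρ) := by gcongr
      have h5 := mul_le_mul_of_nonneg_left hρv hs4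
      linarith
    have a4 : u * R₁ ≤ κ / 4 * (q * u ^ 2) + 1 / κ * (R₁ ^ 2 / ρ) := by
      have := two_mul_le_of_sq (κ / 4 * q) u R₁ (by positivity)
      have h3 : κ / 4 * q * u ^ 2 + R₁ ^ 2 / (4 * (κ / 4 * q))
        = κ / 4 * (q * u ^ 2) + 1 / κ * (R₁ ^ 2 / q) := by field_simp
      have h4 : 1 / κ * (R₁ ^ 2 / q) ≤ 1 / κ * (R₁ ^ 2 / ρ) := by gcongr
      linarith
    have a5 : K * z * R₂ ≤ κ / 4 * (q * z ^ 2) + K ^ 2 / κ * (R₂ ^ 2 / ρ) := by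
      have := two_mul_le_of_sq (κ / 4 * q) z (K * R₂) (by positivity)
      have h3 : κ / 4 * q * z ^ 2 + (K * R₂) ^ 2 / (4 * (κ / 4 * q))
        = κ / 4 * (q * z ^ 2) + K ^ 2 / κ * (R₂ ^ 2 / q) := by field_simp
      have h4 : K ^ 2 / κ * (R₂ ^ 2 / q) ≤ K ^ 2 / κ * (R₂ ^ 2 / ρ) := by gcongr
      linarith
    have hX1 : 0 ≤ R₁ ^ 2 / ρ := by positivity
    have hX2 : 0 ≤ R₂ ^ 2 / ρ := by positivity
    have hqu : 0 ≤ q * u ^ 2 := by positivity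
    have hqz : 0 ≤ q * z ^ 2 := by positivity
    have hbr : ρ * u ^ 2 - s * (ρ * (q * v ^ 2)) - B * q * ρ * (u * v) + D * q * ρ * (z * v)
        + ρ * (v * R₁) ≤ M * (q * u ^ 2) + M * (q * z ^ 2) - s / 4 * (ρ * (q * v ^ 2))
          + 1 / s * (R₁ ^ 2 / ρ) := by
      have h1 : 0 ≤ B ^ 2 / s * (q * z ^ 2) := by positivity
      have h2 : 0 ≤ D ^ 2 / s * (q * u ^ 2) := by positivity
      rw [hM]; linarith
    have hbr' := mul_le_mul_of_nonneg_left hbr hεpos.le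
    have hMu := mul_le_mul_of_nonneg_right hε3 hqu
    have hMz := mul_le_mul_of_nonneg_right hε3 hqz
    set c := min (κ / 4) (ε * s / 4)
    have hcu : c * (ρ * u ^ 2) ≤ κ / 4 * (q * u ^ 2) := by
      have : c ≤ κ / 4 := min_le_left _ _
      gcongr
    have hcz : c * (ρ * z ^ 2) ≤ κ / 4 * (q * z ^ 2) := by
      have : c ≤ κ / 4 := min_le_left _ _
      gcongr
    have hcv : c * (ρ * (q * v ^ 2)) ≤ ε * s / 4 * (ρ * (q * v ^ 2)) := by
      have : c ≤ ε * s / 4 := min_le_right _ _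
      gcongr
    have hC : 1 / κ * (R₁ ^ 2 / ρ) + K ^ 2 / κ * (R₂ ^ 2 / ρ) + ε * (1 / s * (R₁ ^ 2 / ρ)) ≤
        (1 / κ + K ^ 2 / κ + ε / s) * (R₁ ^ 2 + R₂ ^ 2) / ρ := by
      have e : (1 / κ + K ^ 2 / κ + ε / s) * (R₁ ^ 2 + R₂ ^ 2) / ρ
        - (1 / κ * (R₁ ^ 2 / ρ) + K ^ 2 / κ * (R₂ ^ 2 / ρ) + ε * (1 / s * (R₁ ^ 2 / ρ)))
        = K ^ 2 / κ * (R₁ ^ 2 / ρ) + 1 / κ * (R₂ ^ 2 / ρ) + ε / s * (R₂ ^ 2 / ρ) := by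
        field_simp; ring
      have : 0 ≤ K ^ 2 / κ * (R₁ ^ 2 / ρ) + 1 / κ * (R₂ ^ 2 / ρ) + ε / s * (R₂ ^ 2 / ρ) := by
        positivity
      linarith
    linarith

/-- Gronwall's argument for the functional `L`: the forcing squared decays at the same rate, so
`exp(kρt) L` grows at most linearly, whence the term `N t / ρ`. The free bound `k₁` lets a caller
keep the decay rate below that of a given forcing. -/
theorem energy_decay_real {s b m D k₁ : ℝ} (hs : 0 < s) (hb : 0 < b) (hm : 0 < m) (hD : 0 < D)
    (hk₁ : 0 < k₁) :
    ∃ k C : ℝ, 0 < k ∧ k ≤ k₁ ∧ 0 < C ∧ ∀ q ρ N : ℝ, 0 < q → ρ = q / (1 + q) → 0 ≤ N →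
      ∀ v u z R₁ R₂ : ℝ → ℝ, (∀ t, HasDerivAt v (u t) t) →
      (∀ t, HasDerivAt u (-s * q * v t - (b + m * D) * q * u t + D * q * z t + R₁ t) t) →
      (∀ t, HasDerivAt z (-D * q * z t + m * (D - b) * q * u t + R₂ t) t) →
      (∀ t ≥ 0, R₁ t ^ 2 + R₂ t ^ 2 ≤ N * Real.exp (-(k * ρ * t))) →
      ∀ t ≥ 0, u t ^ 2 + q * v t ^ 2 + z t ^ 2 ≤
        C * Real.exp (-(k * ρ * t)) * (u 0 ^ 2 + q * v 0 ^ 2 + z 0 ^ 2 + N * t / ρ) := by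
  obtain ⟨K, ε, c₁, c₂, c₃, C, hc₁, hc₂, hc₃, hC, H⟩ := lyapunov_dissipation hs hb hm hD
  refine ⟨min k₁ (c₃ / c₂), (c₂ + C) / c₁, by positivity, min_le_left _ _, by positivity, ?_⟩
  intro q ρ N hq hρ hN v u z R₁ R₂ hv hu hz hR t ht
  set k := min k₁ (c₃ / c₂)
  have hk : k * c₂ ≤ c₃ := (le_div_iff₀ hc₂).1 (min_le_right _ _)
  have hkpos : 0 < k := by positivity
  have hρpos : 0 < ρ := by rw [hρ]; positivity
  set L : ℝ → ℝ := fun t =>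
    (u t ^ 2 + s * q * v t ^ 2 + K * z t ^ 2) / 2 + ε * ρ * (u t * v t) with hL
  set L' : ℝ → ℝ := fun t =>
    u t * (-s * q * v t - (b + m * D) * q * u t + D * q * z t + R₁ t) + s * q * (v t * u t)
      + K * z t * (-D * q * z t + m * (D - b) * q * u t + R₂ t)
      + ε * ρ * ((-s * q * v t - (b + m * D) * q * u t + D * q * z t + R₁ t) * v t + u t * u t)
  have hLd (t : ℝ) : HasDerivAt L (L' t) t := by
    refine HasDerivAt.congr_deriv (((((hu t).fun_pow 2).add (((hv t).fun_pow 2).const_mul (s * q))).add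
      (((hz t).fun_pow 2).const_mul K)).div_const 2 |>.add
      (((hu t).mul (hv t)).const_mul (ε * ρ))) ?_
    simp only [L']; push_cast; ring
  set Φ : ℝ → ℝ := fun t => Real.exp (k * ρ * t) * L t - C * N / ρ * t
  have hΦd (t : ℝ) : HasDerivAt Φ
      (Real.exp (k * ρ * t) * (k * ρ) * L t + Real.exp (k * ρ * t) * L' t - C * N / ρ) t := by
    have h1 : HasDerivAt (fun t => Real.exp (k * ρ * t)) (Real.exp (k * ρ * t) * (k * ρ)) t := by
      simpa using ((hasDerivAt_id t).const_mul (k * ρ)).exp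
    exact ((h1.fun_mul (hLd t)).fun_sub ((hasDerivAt_id' t).const_mul (C * N / ρ))).congr_deriv (by simp)
  have hanti : AntitoneOn Φ (Ici 0) := by
    refine antitoneOn_of_deriv_nonpos (convex_Ici 0)
      (fun t _ => (hΦd t).continuousAt.continuousWithinAt)
      (fun t _ => (hΦd t).differentiableAt.differentiableWithinAt) fun t ht => ?_
    rw [(hΦd t).deriv]
    have ht0 : 0 ≤ t := by simpa using (interior_subset ht)
    obtain ⟨-, h2, h3⟩ := H q ρ hq hρ (v t) (u t) (z t) (R₁ t) (R₂ t)
    change L t ≤ _ at h2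
    change L' t ≤ _ at h3
    have hE : 0 ≤ u t ^ 2 + q * v t ^ 2 + z t ^ 2 := by positivity
    have h4 : C * (R₁ t ^ 2 + R₂ t ^ 2) / ρ ≤ C * (N * Real.exp (-(k * ρ * t))) / ρ := by
      gcongr; exact hR t ht0
    have h5 : k * ρ * L t + L' t ≤ C * N / ρ * Real.exp (-(k * ρ * t)) := by
      have h6 : k * ρ * L t ≤ k * ρ * (c₂ * (u t ^ 2 + q * v t ^ 2 + z t ^ 2)) := by gcongr
      have h7 : k * c₂ * (ρ * (u t ^ 2 + q * v t ^ 2 + z t ^ 2)) ≤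
        c₃ * (ρ * (u t ^ 2 + q * v t ^ 2 + z t ^ 2)) := by gcongr
      have h8 : C * (N * Real.exp (-(k * ρ * t))) / ρ = C * N / ρ * Real.exp (-(k * ρ * t)) := by
        ring
      linarith
    have h6 := mul_le_mul_of_nonneg_left h5 (Real.exp_pos (k * ρ * t)).le
    have h7 : Real.exp (k * ρ * t) * Real.exp (-(k * ρ * t)) = 1 := by
      rw [← Real.exp_add]; simp
    have h8 : Real.exp (k * ρ * t) * (C * N / ρ * Real.exp (-(k * ρ * t))) = C * N / ρ := by
      linear_combination (C * N / ρ) * h7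
    linarith
  have h1 := hanti (self_mem_Ici) ht ht
  obtain ⟨h2, -, -⟩ := H q ρ hq hρ (v t) (u t) (z t) 0 0
  obtain ⟨-, h3, -⟩ := H q ρ hq hρ (v 0) (u 0) (z 0) 0 0
  change _ ≤ L t at h2
  change L 0 ≤ _ at h3
  simp only [Φ, mul_zero, Real.exp_zero, one_mul, sub_zero] at h1
  have h4 : Real.exp (k * ρ * t) * L t ≤ (c₂ + C) * (u 0 ^ 2 + q * v 0 ^ 2 + z 0 ^ 2 + N * t / ρ) := by
    have e1 : 0 ≤ c₂ * (N * t / ρ) := by positivity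
    have e2 : 0 ≤ C * (u 0 ^ 2 + q * v 0 ^ 2 + z 0 ^ 2) := by positivity
    have e3 : C * N / ρ * t = C * (N * t / ρ) := by ring
    linarith
  have h5 : L t ≤ Real.exp (-(k * ρ * t)) *
      ((c₂ + C) * (u 0 ^ 2 + q * v 0 ^ 2 + z 0 ^ 2 + N * t / ρ)) := by
    rw [Real.exp_neg, inv_mul_eq_div, le_div_iff₀ (Real.exp_pos _)]; linarith
  calc u t ^ 2 + q * v t ^ 2 + z t ^ 2 ≤ L t / c₁ := by rw [le_div_iff₀ hc₁]; linarith
    _ ≤ (Real.exp (-(k * ρ * t)) *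
      ((c₂ + C) * (u 0 ^ 2 + q * v 0 ^ 2 + z 0 ^ 2 + N * t / ρ))) / c₁ := by gcongr
    _ = _ := by ring

/-- Energy decay for the system obeyed by `(φ̂, φ̂_t, αγc₀² T̂ + (γ-1) φ̂_t)` at squared frequency
`q`, with forcing. -/
theorem energy_decay {s b m D k₁ : ℝ} (hs : 0 < s) (hb : 0 < b) (hm : 0 < m) (hD : 0 < D)
    (hk₁ : 0 < k₁) :
    ∃ k C : ℝ, 0 < k ∧ k ≤ k₁ ∧ 0 < C ∧ ∀ q ρ N : ℝ, 0 < q → ρ = q / (1 + q) → 0 ≤ N →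
      ∀ v u z R₁ R₂ : ℝ → ℂ, (∀ t, HasDerivAt v (u t) t) →
      (∀ t, HasDerivAt u (-s * q * v t - (b + m * D) * q * u t + D * q * z t + R₁ t) t) →
      (∀ t, HasDerivAt z (-D * q * z t + m * (D - b) * q * u t + R₂ t) t) →
      (∀ t ≥ 0, ‖R₁ t‖ ^ 2 + ‖R₂ t‖ ^ 2 ≤ N * Real.exp (-(k * ρ * t))) →
      ∀ t ≥ 0, ‖u t‖ ^ 2 + q * ‖v t‖ ^ 2 + ‖z t‖ ^ 2 ≤
        C * Real.exp (-(k * ρ * t)) * (‖u 0‖ ^ 2 + q * ‖v 0‖ ^ 2 + ‖z 0‖ ^ 2 + N * t / ρ) := by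
  obtain ⟨k, C, hk, hkk, hC, H⟩ := energy_decay_real hs hb hm hD hk₁
  refine ⟨k, 2 * C, hk, hkk, by positivity, ?_⟩
  intro q ρ N hq hρ hN v u z R₁ R₂ hv hu hz hR t ht
  have hρpos : 0 < ρ := by rw [hρ]; positivity
  have hsq (w : ℂ) : ‖w‖ ^ 2 = w.re ^ 2 + w.im ^ 2 := by
    rw [← Complex.normSq_eq_norm_sq, Complex.normSq_apply]; ring
  have hre {f : ℝ → ℂ} {f' : ℂ} {x : ℝ} (h : HasDerivAt f f' x) :
      HasDerivAt (fun y => (f y).re) f'.re x := Complex.reCLM.hasFDerivAt.comp_hasDerivAt x h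
  have him {f : ℝ → ℂ} {f' : ℂ} {x : ℝ} (h : HasDerivAt f f' x) :
      HasDerivAt (fun y => (f y).im) f'.im x := Complex.imCLM.hasFDerivAt.comp_hasDerivAt x h
  have h1 := H q ρ N hq hρ hN (fun t => (v t).re) (fun t => (u t).re) (fun t => (z t).re)
    (fun t => (R₁ t).re) (fun t => (R₂ t).re) (fun t => hre (hv t))
    (fun t => (hre (hu t)).congr_deriv (by simp)) (fun t => (hre (hz t)).congr_deriv (by simp))
    (fun t ht => (hR t ht).trans' (by rw [hsq, hsq]; nlinarith [sq_nonneg (R₁ t).im, sq_nonneg (R₂ t).im])) t ht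
  have h2 := H q ρ N hq hρ hN (fun t => (v t).im) (fun t => (u t).im) (fun t => (z t).im)
    (fun t => (R₁ t).im) (fun t => (R₂ t).im) (fun t => him (hv t))
    (fun t => (him (hu t)).congr_deriv (by simp)) (fun t => (him (hz t)).congr_deriv (by simp))
    (fun t ht => (hR t ht).trans' (by rw [hsq, hsq]; nlinarith [sq_nonneg (R₁ t).re, sq_nonneg (R₂ t).re])) t ht
  simp only [hsq]
  have h3 : 0 ≤ C * Real.exp (-(k * ρ * t)) * ((u 0).re ^ 2 + (u 0).im ^ 2 + q * ((v 0).re ^ 2 + (v 0).im ^ 2) + ((z 0).re ^ 2 + (z 0).im ^ 2)) := by positivity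
  linarith

/-! ### Approximate acoustic modes -/

/-- Third-order approximation of the acoustic root of the characteristic polynomial; `J = ±i`. -/
noncomputable def acousticRoot (s Γ Γ₁ : ℝ) (J : ℂ) (r : ℝ) : ℂ :=
  -Γ * r ^ 2 + J * (s * r + Γ₁ * r ^ 3)

/-- Thermal component of the approximate acoustic mode. -/
noncomputable def acousticHeat (s b m D : ℝ) (J : ℂ) (r : ℝ) : ℂ :=
  m * (D - b) * (r ^ 2 + J * D * r ^ 3 / s)

/-- This is the origin of the constants: in the equation for `u` the `r³` terms cancel by the choice
of `Γ` and the `r⁴` terms by the choice of `Γ₁`. -/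
theorem acousticRoot_residual {s b m D Γ Γ₁ : ℝ} (hs : 0 < s)
    (hΓ₁ : 2 * s * Γ₁ = -Γ ^ 2 - 2 * D * Γ + b * (1 + m) * D) (hΓ : 2 * Γ = b + m * D)
    {J : ℂ} (hJ : J ^ 2 = -1) (r : ℝ) :
    acousticRoot s Γ Γ₁ J r ^ 2 + s ^ 2 * r ^ 2 + (b + m * D) * r ^ 2 * acousticRoot s Γ Γ₁ J r
      - D * r ^ 2 * acousticHeat s b m D J r
      = r ^ 5 * (-Γ₁ ^ 2 * r - J * (D ^ 2 * m * (D - b) / s)) := by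
  have hs' : (s : ℂ) ≠ 0 := by exact_mod_cast hs.ne'
  have h1 : (2 * s * Γ₁ : ℂ) = -Γ ^ 2 - 2 * D * Γ + b * (1 + m) * D := by exact_mod_cast hΓ₁
  have h2 : (2 * Γ : ℂ) = b + m * D := by exact_mod_cast hΓ
  rw [← h2, acousticRoot, acousticHeat]
  have e : (b : ℂ) = 2 * Γ - m * D := by rw [h2]; ring
  rw [e] at h1 ⊢
  field_simp
  linear_combination (s * (s * r + Γ₁ * r ^ 3) ^ 2 : ℂ) * hJ - (s * r ^ 4 : ℂ) * h1

/-- With `μ` the acoustic root, the equation for `z` is solved exactly by `m(D-b) r² μ/(μ + D r²)`;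
`acousticHeat` is its expansion through order `r³`. The error of order `r⁴`, multiplied by `μ =
O(r)`, leaves `r⁵`. -/
theorem acousticHeat_residual {s b m D Γ Γ₁ : ℝ} (hs : 0 < s) {J : ℂ} (hJ : J ^ 2 = -1) (r : ℝ) :
    (acousticRoot s Γ Γ₁ J r + D * r ^ 2) * acousticHeat s b m D J r
      - m * (D - b) * r ^ 2 * acousticRoot s Γ Γ₁ J r
      = r ^ 5 * (m * (D - b) * D * (J * (D - Γ) - Γ₁ * r) / s) := by
  have hs' : (s : ℂ) ≠ 0 := by exact_mod_cast hs.ne'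
  rw [acousticRoot, acousticHeat]
  field_simp
  linear_combination (m * (D - b) * r ^ 4 * D * (s + Γ₁ * r ^ 2) : ℂ) * hJ

theorem norm_exp_acousticRoot (s Γ Γ₁ : ℝ) {J : ℂ} (hJ : J.re = 0) (r t : ℝ) :
    ‖Complex.exp (acousticRoot s Γ Γ₁ J r * t)‖ = Real.exp (-Γ * r ^ 2 * t) := by
  rw [Complex.norm_exp]
  congr 1
  have : acousticRoot s Γ Γ₁ J r = ((-Γ * r ^ 2 : ℝ) : ℂ) + J * ((s * r + Γ₁ * r ^ 3 : ℝ) : ℂ) := by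
    rw [acousticRoot]; push_cast; ring
  rw [this, Complex.re_mul_ofReal, Complex.add_re, Complex.ofReal_re, Complex.re_mul_ofReal, hJ]
  ring

theorem abs_sin_add_sub_le (a h : ℝ) :
    |Real.sin (a + h) - Real.sin a - h * Real.cos a| ≤ 3 * h ^ 2 := by
  have h1 : |Real.cos h - 1| ≤ h ^ 2 / 2 := by
    rw [abs_sub_comm, abs_of_nonneg (by linarith [Real.cos_le_one h])]
    linarith [Real.one_sub_sq_div_two_le_cos (x := h)]
  have h2 : |Real.sin h - h| ≤ 2 * h ^ 2 := by
    rcases le_or_gt |h| 1 with hh | hh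
    · have h3 := Real.sin_bound hh
      have h4 : |Real.sin h - h| ≤ |Real.sin h - (h - h ^ 3 / 6)| + |h ^ 3 / 6| := by
        have := abs_sub_abs_le_abs_sub (Real.sin h - h) (-(h ^ 3 / 6))
        rw [abs_neg] at this
        have e : Real.sin h - h - -(h ^ 3 / 6) = Real.sin h - (h - h ^ 3 / 6) := by ring
        rw [e] at this; linarith
      have h5 : |h| ^ 4 ≤ |h| ^ 2 := pow_le_pow_of_le_one (abs_nonneg _) hh (by norm_num)
      have h6 : |h| ^ 3 ≤ |h| ^ 2 := pow_le_pow_of_le_one (abs_nonneg _) hh (by norm_num)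
      rw [abs_div, abs_pow, abs_of_pos (by norm_num : (0 : ℝ) < 6)] at h4
      rw [← sq_abs h]
      nlinarith [sq_nonneg |h|]
    · have h3 : |Real.sin h - h| ≤ 1 + |h| := by
        have h4 := abs_le.1 (Real.abs_sin_le_one h)
        rw [abs_le]; constructor <;> linarith [neg_abs_le h, le_abs_self h]
      rw [← sq_abs h]
      nlinarith
  have e : Real.sin (a + h) - Real.sin a - h * Real.cos a
      = Real.sin a * (Real.cos h - 1) + Real.cos a * (Real.sin h - h) := by
    rw [Real.sin_add]; ring
  rw [e]
  calc _ ≤ |Real.sin a| * |Real.cos h - 1| + |Real.cos a| * |Real.sin h - h| := by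
        rw [← abs_mul, ← abs_mul]; exact abs_add_le _ _
    _ ≤ 1 * (h ^ 2 / 2) + 1 * (2 * h ^ 2) := by
        gcongr
        · exact Real.abs_sin_le_one a
        · exact Real.abs_cos_le_one a
    _ ≤ _ := by nlinarith [sq_nonneg h]

theorem mul_exp_neg_le {c x : ℝ} (hc : 0 < c) : x * Real.exp (-(c * x)) ≤ 1 / c := by
  have h1 : c * x ≤ Real.exp (c * x) := by linarith [Real.add_one_le_exp (c * x)]
  rw [Real.exp_neg, ← div_eq_mul_inv, div_le_div_iff₀ (Real.exp_pos _) hc]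
  linarith


/-! ### Low-frequency profiles and expansion of the phase -/

/-- The low-frequency profile at frequency modulus `r`, for data `f₀, f₁` of `φ̂, φ̂_t` and thermal
datum `z₀`. -/
noncomputable def symbolProfile (s D Γ Γ₁ r t : ℝ) (f₀ f₁ z₀ : ℂ) : ℂ :=
  (Real.sin (s * r * t) / (s * r) * Real.exp (-Γ * r ^ 2 * t) : ℝ) * f₁
    + (Real.cos (s * r * t) * Real.exp (-Γ * r ^ 2 * t) : ℝ) * f₀
    + (Γ₁ / s * t * r ^ 2 * (Real.cos (s * r * t) * Real.exp (-Γ * r ^ 2 * t)) : ℝ) * f₁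
    + (D / s ^ 2 * (Real.exp (-D * r ^ 2 * t)
        - Real.cos (s * r * t) * Real.exp (-Γ * r ^ 2 * t)) : ℝ) * z₀

/-- The sum of the approximate modes, before expansion of the phase. -/
noncomputable def modalProfile (s D Γ Γ₁ r t : ℝ) (f₀ f₁ z₀ : ℂ) : ℂ :=
  (Real.exp (-Γ * r ^ 2 * t) * Real.cos ((s * r + Γ₁ * r ^ 3) * t) : ℝ) * (f₀ - D / s ^ 2 * z₀)
    + (Real.exp (-Γ * r ^ 2 * t) * (Real.sin ((s * r + Γ₁ * r ^ 3) * t) / (s * r)) : ℝ) * f₁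
    + (Real.exp (-D * r ^ 2 * t) : ℝ) * (D / s ^ 2 * z₀)

/-- The phase shift is `Γ₁ r · (r² t)`, and powers of `r² t` are absorbed by half of the Gaussian,
so each order of expansion gains a factor `r`. The cosine needs order zero only. The sine is divided
by `r` and needs its linear term, which is the symbol `(Γ₁/s) t r² cos(s r t) exp(-Γ r² t)` of `𝓗₀`.
-/
theorem modalProfile_sub_symbolProfile_le {s D Γ : ℝ} (Γ₁ : ℝ) (hs : 0 < s) (hD : 0 < D)
    (hΓ : 0 < Γ) :
    ∃ C : ℝ, 0 < C ∧ ∀ r t : ℝ, 0 < r → 0 ≤ t → ∀ f₀ f₁ z₀ : ℂ,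
      ‖modalProfile s D Γ Γ₁ r t f₀ f₁ z₀ - symbolProfile s D Γ Γ₁ r t f₀ f₁ z₀‖ ≤
        C * r * Real.exp (-(Γ / 2 * r ^ 2 * t)) * (‖f₀‖ + ‖f₁‖ + ‖z₀‖) := by
  have key (x : ℝ) (hx : 0 ≤ x) : x * Real.exp (-Γ * x) ≤ 2 / Γ * Real.exp (-(Γ / 2 * x)) := by
    have := mul_exp_neg_le (c := Γ / 2) (x := x) (by positivity)
    have e : Real.exp (-Γ * x) = Real.exp (-(Γ / 2 * x)) * Real.exp (-(Γ / 2 * x)) := by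
      rw [← Real.exp_add]; ring_nf
    rw [e, ← mul_assoc]
    refine mul_le_mul_of_nonneg_right (this.trans (le_of_eq ?_)) (Real.exp_pos _).le
    field_simp
  have key2 (x : ℝ) (hx : 0 ≤ x) :
      x ^ 2 * Real.exp (-Γ * x) ≤ 16 / Γ ^ 2 * Real.exp (-(Γ / 2 * x)) := by
    have h1 := mul_exp_neg_le (c := Γ / 4) (x := x) (by positivity)
    have e : Real.exp (-Γ * x) = Real.exp (-(Γ / 4 * x)) ^ 2 * Real.exp (-(Γ / 2 * x)) := by
      rw [← Real.exp_nat_mul, ← Real.exp_add]; push_cast; ring_nf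
    rw [e, ← mul_assoc, ← mul_pow]
    refine mul_le_mul_of_nonneg_right ?_ (Real.exp_pos _).le
    calc (x * Real.exp (-(Γ / 4 * x))) ^ 2 ≤ (1 / (Γ / 4)) ^ 2 := by gcongr
      _ = _ := by field_simp; norm_num
  refine ⟨|Γ₁| * (2 / Γ) * (1 + D / s ^ 2) + 3 * Γ₁ ^ 2 / s * (16 / Γ ^ 2) + 1, by positivity, ?_⟩
  intro r t hr ht f₀ f₁ z₀
  set E := Real.exp (-Γ * r ^ 2 * t) with hE
  have hEx : E = Real.exp (-Γ * (r ^ 2 * t)) := by rw [hE]; ring_nf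
  have hEpos : 0 < E := Real.exp_pos _
  set A := Real.cos ((s * r + Γ₁ * r ^ 3) * t) - Real.cos (s * r * t) with hA
  set B := Real.sin ((s * r + Γ₁ * r ^ 3) * t) - Real.sin (s * r * t)
    - Γ₁ * r ^ 3 * t * Real.cos (s * r * t) with hB
  have hA1 : |A| ≤ |Γ₁| * (r * (r ^ 2 * t)) := by
    refine (Real.abs_cos_sub_cos_le _ _).trans (le_of_eq ?_)
    rw [show (s * r + Γ₁ * r ^ 3) * t - s * r * t = Γ₁ * (r * (r ^ 2 * t)) by ring, abs_mul,
      abs_of_nonneg (by positivity : 0 ≤ r * (r ^ 2 * t))]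
  have hB1 : |B| ≤ 3 * Γ₁ ^ 2 * (r ^ 2 * (r ^ 2 * t) ^ 2) := by
    have := abs_sin_add_sub_le (s * r * t) (Γ₁ * r ^ 3 * t)
    rw [show s * r * t + Γ₁ * r ^ 3 * t = (s * r + Γ₁ * r ^ 3) * t by ring] at this
    exact this.trans (le_of_eq (by ring))
  have hs' : (s : ℂ) ≠ 0 := by exact_mod_cast hs.ne'
  have hr' : (r : ℂ) ≠ 0 := by exact_mod_cast hr.ne'
  have e : modalProfile s D Γ Γ₁ r t f₀ f₁ z₀ - symbolProfile s D Γ Γ₁ r t f₀ f₁ z₀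
      = (E * A : ℝ) * (f₀ - (D / s ^ 2 : ℝ) * z₀) + (E * (B / (s * r)) : ℝ) * f₁ := by
    simp only [modalProfile, symbolProfile, hA, hB, ← hE]
    push_cast
    field_simp
    ring
  have hk1 := key (r ^ 2 * t) (by positivity)
  have hk2 := key2 (r ^ 2 * t) (by positivity)
  rw [← hEx] at hk1 hk2
  set E' := Real.exp (-(Γ / 2 * r ^ 2 * t)) with hE'
  have hEx' : Real.exp (-(Γ / 2 * (r ^ 2 * t))) = E' := by rw [hE']; ring_nf
  rw [hEx'] at hk1 hk2
  have hE'pos : 0 < E' := Real.exp_pos _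
  have h1 : |E * A| ≤ |Γ₁| * (2 / Γ) * (r * E') := by
    rw [abs_mul, abs_of_pos hEpos]
    calc E * |A| ≤ E * (|Γ₁| * (r * (r ^ 2 * t))) := by gcongr
      _ = |Γ₁| * r * (r ^ 2 * t * E) := by ring
      _ ≤ |Γ₁| * r * (2 / Γ * E') := by gcongr
      _ = _ := by ring
  have h2 : |E * (B / (s * r))| ≤ 3 * Γ₁ ^ 2 / s * (16 / Γ ^ 2) * (r * E') := by
    rw [abs_mul, abs_of_pos hEpos, abs_div, abs_of_pos (by positivity : 0 < s * r)]
    calc E * (|B| / (s * r)) ≤ E * (3 * Γ₁ ^ 2 * (r ^ 2 * (r ^ 2 * t) ^ 2) / (s * r)) := by gcongr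
      _ = 3 * Γ₁ ^ 2 / s * r * ((r ^ 2 * t) ^ 2 * E) := by field_simp
      _ ≤ 3 * Γ₁ ^ 2 / s * r * (16 / Γ ^ 2 * E') := by gcongr
      _ = _ := by ring
  rw [e]
  have h3 : ‖f₀ - (D / s ^ 2 : ℝ) * z₀‖ ≤ ‖f₀‖ + D / s ^ 2 * ‖z₀‖ := by
    refine (norm_sub_le _ _).trans (le_of_eq ?_)
    rw [norm_mul, Complex.norm_real, Real.norm_of_nonneg (by positivity)]
  calc _ ≤ |E * A| * (‖f₀‖ + D / s ^ 2 * ‖z₀‖) + |E * (B / (s * r))| * ‖f₁‖ := by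
        refine (norm_add_le _ _).trans ?_
        rw [norm_mul, norm_mul, Complex.norm_real, Complex.norm_real, Real.norm_eq_abs,
          Real.norm_eq_abs]
        gcongr
    _ ≤ |Γ₁| * (2 / Γ) * (r * E') * ((1 + D / s ^ 2) * (‖f₀‖ + ‖f₁‖ + ‖z₀‖))
        + 3 * Γ₁ ^ 2 / s * (16 / Γ ^ 2) * (r * E') * (‖f₀‖ + ‖f₁‖ + ‖z₀‖)
        + 1 * (r * E' * (‖f₀‖ + ‖f₁‖ + ‖z₀‖)) := by
        have h4 : ‖f₀‖ + D / s ^ 2 * ‖z₀‖ ≤ (1 + D / s ^ 2) * (‖f₀‖ + ‖f₁‖ + ‖z₀‖) := by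
          have g1 : 0 ≤ D / s ^ 2 * ‖f₀‖ := by positivity
          have g2 : 0 ≤ D / s ^ 2 * ‖f₁‖ := by positivity
          have := norm_nonneg f₁
          have := norm_nonneg z₀
          linarith
        have h5 : ‖f₁‖ ≤ ‖f₀‖ + ‖f₁‖ + ‖z₀‖ := by linarith [norm_nonneg f₀, norm_nonneg z₀]
        have h6 : 0 ≤ 1 * (r * E' * (‖f₀‖ + ‖f₁‖ + ‖z₀‖)) := by positivity
        have := mul_le_mul h1 h4 (by positivity) (by positivity)
        have := mul_le_mul h2 h5 (by positivity) (by positivity)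
        linarith
    _ = _ := by ring

/-! ### Comparison of exact modes with the profile -/

/-- The system obeyed at squared frequency `q` by `v = φ̂`, `u = φ̂_t` and
`z = αγc₀² T̂ + (γ-1) φ̂_t`. -/
structure IsModeSolution (s b m D q : ℝ) (v u z : ℝ → ℂ) : Prop where
  deriv_v : ∀ t, HasDerivAt v (u t) t
  deriv_u : ∀ t, HasDerivAt u (-s ^ 2 * q * v t - (b + m * D) * q * u t + D * q * z t) t
  deriv_z : ∀ t, HasDerivAt z (-D * q * z t + m * (D - b) * q * u t) t

theorem hasDerivAt_exp_mul_ofReal (c μ : ℂ) (t : ℝ) :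
    HasDerivAt (fun t : ℝ => c * Complex.exp (μ * t)) (μ * (c * Complex.exp (μ * t))) t := by
  have h : HasDerivAt (fun t : ℝ => μ * (t : ℂ)) μ t := by
    simpa using (Complex.ofRealCLM.hasDerivAt (x := t)).const_mul μ
  exact (h.cexp.const_mul c).congr_deriv (by ring)

theorem exp_acousticRoot_mul (s Γ Γ₁ : ℝ) (r t : ℝ) :
    Complex.exp (acousticRoot s Γ Γ₁ Complex.I r * t) =
      Real.exp (-Γ * r ^ 2 * t) * (Real.cos ((s * r + Γ₁ * r ^ 3) * t)
        + Real.sin ((s * r + Γ₁ * r ^ 3) * t) * Complex.I) ∧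
    Complex.exp (acousticRoot s Γ Γ₁ (-Complex.I) r * t) =
      Real.exp (-Γ * r ^ 2 * t) * (Real.cos ((s * r + Γ₁ * r ^ 3) * t)
        - Real.sin ((s * r + Γ₁ * r ^ 3) * t) * Complex.I) := by
  have h1 : acousticRoot s Γ Γ₁ Complex.I r * t = ((-Γ * r ^ 2 * t : ℝ) : ℂ)
      + (((s * r + Γ₁ * r ^ 3) * t : ℝ) : ℂ) * Complex.I := by
    rw [acousticRoot]; push_cast; ring
  have h2 : acousticRoot s Γ Γ₁ (-Complex.I) r * t = ((-Γ * r ^ 2 * t : ℝ) : ℂ)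
      + ((-((s * r + Γ₁ * r ^ 3) * t) : ℝ) : ℂ) * Complex.I := by
    rw [acousticRoot]; push_cast; ring
  constructor
  · rw [h1, Complex.exp_add, Complex.exp_mul_I, Complex.ofReal_exp, Complex.ofReal_cos,
      Complex.ofReal_sin]
  · rw [h2, Complex.exp_add, Complex.exp_mul_I, ← Complex.ofReal_cos, ← Complex.ofReal_sin,
      Real.cos_neg, Real.sin_neg, Complex.ofReal_exp]
    push_cast; ring

set_option maxHeartbeats 1000000 in
-- The difference from a sum of two acoustic modes and one thermal mode solves the forced system.
-- The acoustic amplitudes may be of size `1/r`, so a residual `r⁵` means a forcing `r⁴`; the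
-- initial defects of `u` and `z` are of size `r²`. The energy estimate bounds `r² |v|²` by a
-- multiple of `r⁴`, which leaves one power of `r` for `v`.
theorem IsModeSolution.sub_modalProfile_le {s b m D Γ Γ₁ : ℝ} (hs : 0 < s) (hb : 0 < b)
    (hm : 0 < m) (hD : 0 < D) (hΓ : 2 * Γ = b + m * D)
    (hΓ₁ : 2 * s * Γ₁ = -Γ ^ 2 - 2 * D * Γ + b * (1 + m) * D) :
    ∃ k C : ℝ, 0 < k ∧ 0 < C ∧ ∀ r : ℝ, 0 < r → r ≤ 1 → ∀ v u z : ℝ → ℂ,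
      IsModeSolution s b m D (r ^ 2) v u z → ∀ t ≥ 0,
      ‖v t - modalProfile s D Γ Γ₁ r t (v 0) (u 0) (z 0)‖ ≤
        C * r * Real.exp (-(k * r ^ 2 * t)) * (‖v 0‖ + ‖u 0‖ + ‖z 0‖) := by
  have hΓpos : 0 < Γ := by nlinarith [mul_pos hm hD]
  set κ := min Γ D with hκ
  have hκpos : 0 < κ := by positivity
  -- The `s` of `energy_decay` is the square of the wave speed. The forcing decays like `exp(-κ r²
  -- t)` and enters squared, hence `k₁ = 2κ`.
  obtain ⟨k, C, hk, hkκ, hC, H⟩ := energy_decay (s := s ^ 2) (k₁ := 2 * κ) (by positivity) hb hm hD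
    (by positivity)
  set C₀ := 1 + D / s ^ 2 + 1 / s with hC₀
  have hC₀pos : 0 < C₀ := by positivity
  set P₁ := Γ₁ ^ 2 + D ^ 2 * m * |D - b| / s with hP₁
  set P₂ := m * |D - b| * D * (|D - Γ| + |Γ₁|) / s with hP₂
  have hP₁0 : 0 ≤ P₁ := by positivity
  have hP₂0 : 0 ≤ P₂ := by positivity
  -- `κ₁ r⁴` and `κ₂ r⁴` are the residuals of the thermal mode, with `v`-component `D/s²`,
  -- `z`-component `1` and exponent `-D r²`.
  set κ₁ := (D ^ 3 - (b + m * D) * D ^ 2) / s ^ 2 with hκ₁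
  set κ₂ := m * (D - b) * D ^ 2 / s ^ 2 with hκ₂
  set Q₁ := 2 * C₀ * P₁ + |κ₁| with hQ₁
  set Q₂ := 2 * C₀ * P₂ + |κ₂| with hQ₂
  set Q₃ := Γ * (1 + D / s ^ 2) + |Γ₁| / s + D ^ 2 / s ^ 2 with hQ₃
  set Q₄ := m * |D - b| * (1 + 2 * D / s ^ 2) with hQ₄
  have hQ₁0 : 0 ≤ Q₁ := by positivity
  have hQ₂0 : 0 ≤ Q₂ := by positivity
  have hQ₃0 : 0 ≤ Q₃ := by positivity
  have hQ₄0 : 0 ≤ Q₄ := by positivity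
  set S := C * (Q₃ ^ 2 + Q₄ ^ 2 + 8 * (Q₁ ^ 2 + Q₂ ^ 2) / k) with hS
  have hS0 : 0 ≤ S := by positivity
  refine ⟨k / 8, √S + 1, by positivity, by positivity, ?_⟩
  intro r hr hr1 v u z hsol t ht
  set F := ‖v 0‖ + ‖u 0‖ + ‖z 0‖ with hF
  have hF0 : 0 ≤ F := by positivity
  have hv0 : ‖v 0‖ ≤ F := by rw [hF]; linarith [norm_nonneg (u 0), norm_nonneg (z 0)]
  have hu0 : ‖u 0‖ ≤ F := by rw [hF]; linarith [norm_nonneg (v 0), norm_nonneg (z 0)]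
  have hz0 : ‖z 0‖ ≤ F := by rw [hF]; linarith [norm_nonneg (u 0), norm_nonneg (v 0)]
  have hs' : (s : ℂ) ≠ 0 := by exact_mod_cast hs.ne'
  have hr' : (r : ℂ) ≠ 0 := by exact_mod_cast hr.ne'
  set B : ℂ := v 0 - D / s ^ 2 * z 0 with hB
  have hBn : ‖B‖ ≤ (1 + D / s ^ 2) * F := by
    have h1 : ‖(D / s ^ 2 * z 0 : ℂ)‖ = D / s ^ 2 * ‖z 0‖ := by
      rw [norm_mul]; congr 1
      rw [← Complex.ofReal_pow, ← Complex.ofReal_div, Complex.norm_real,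
        Real.norm_of_nonneg (by positivity)]
    have h2 : D / s ^ 2 * ‖z 0‖ ≤ D / s ^ 2 * F := by gcongr
    calc ‖B‖ ≤ ‖v 0‖ + ‖(D / s ^ 2 * z 0 : ℂ)‖ := norm_sub_le _ _
      _ ≤ _ := by rw [h1]; linarith
  -- Chosen so that `cp + cm = B` and `i s r (cp - cm) = u 0`: then `v` is matched exactly at time
  -- zero and `u` to leading order.
  set cp : ℂ := (B - Complex.I * (u 0 / (s * r))) / 2 with hcp
  set cm : ℂ := (B + Complex.I * (u 0 / (s * r))) / 2 with hcm
  set μp := acousticRoot s Γ Γ₁ Complex.I r with hμp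
  set μm := acousticRoot s Γ Γ₁ (-Complex.I) r with hμm
  set χp := acousticHeat s b m D Complex.I r with hχp
  set χm := acousticHeat s b m D (-Complex.I) r with hχm
  set δ : ℂ := -D * r ^ 2 with hδ
  have hI : ‖Complex.I * (u 0 / (s * r))‖ ≤ 1 / s * F / r := by
    rw [norm_mul, Complex.norm_I, one_mul, norm_div, norm_mul, Complex.norm_real, Complex.norm_real,
      Real.norm_of_nonneg hs.le, Real.norm_of_nonneg hr.le]
    rw [show 1 / s * F / r = F / (s * r) by field_simp]
    gcongr
  have hBr : ‖B‖ ≤ (1 + D / s ^ 2) * F / r := by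
    rw [le_div_iff₀ hr]
    calc ‖B‖ * r ≤ ‖B‖ * 1 := by gcongr
      _ ≤ _ := by linarith
  have hcpn : ‖cp‖ ≤ C₀ * F / r := by
    rw [hcp, norm_div, Complex.norm_ofNat]
    have := norm_sub_le B (Complex.I * (u 0 / (s * r)))
    have e : C₀ * F / r = (1 + D / s ^ 2) * F / r + 1 / s * F / r := by rw [hC₀]; ring
    have : 0 ≤ C₀ * F / r := by positivity
    linarith
  have hcmn : ‖cm‖ ≤ C₀ * F / r := by
    rw [hcm, norm_div, Complex.norm_ofNat]
    have := norm_add_le B (Complex.I * (u 0 / (s * r)))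
    have e : C₀ * F / r = (1 + D / s ^ 2) * F / r + 1 / s * F / r := by rw [hC₀]; ring
    have : 0 ≤ C₀ * F / r := by positivity
    linarith
  have hsum : cp + cm = B := by rw [hcp, hcm]; ring
  have hdiff : cp - cm = -Complex.I * (u 0 / (s * r)) := by rw [hcp, hcm]; ring
  have hJp : Complex.I ^ 2 = -1 := Complex.I_sq
  have hJm : (-Complex.I) ^ 2 = -1 := by rw [neg_sq, Complex.I_sq]
  have res1 (J : ℂ) (hJ : J ^ 2 = -1) (hJn : ‖J‖ = 1) :
      ‖acousticRoot s Γ Γ₁ J r ^ 2 + s ^ 2 * r ^ 2 + (b + m * D) * r ^ 2 * acousticRoot s Γ Γ₁ J r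
      - D * r ^ 2 * acousticHeat s b m D J r‖ ≤ P₁ * r ^ 5 := by
    rw [acousticRoot_residual hs hΓ₁ hΓ hJ, norm_mul, norm_pow, Complex.norm_real,
      Real.norm_of_nonneg hr.le, mul_comm]
    gcongr
    refine (norm_sub_le _ _).trans (add_le_add ?_ ?_)
    · rw [norm_mul, norm_neg, norm_pow, Complex.norm_real, Complex.norm_real,
        Real.norm_of_nonneg hr.le, Real.norm_eq_abs, sq_abs]
      exact mul_le_of_le_one_right (sq_nonneg _) hr1
    · rw [norm_mul, hJn, one_mul]
      rw [show (D ^ 2 * m * (D - b) / s : ℂ) = ((D ^ 2 * m * (D - b) / s : ℝ) : ℂ) by push_cast; ring,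
        Complex.norm_real, Real.norm_eq_abs, abs_div, abs_mul, abs_of_pos hs,
        abs_of_pos (by positivity : 0 < D ^ 2 * m)]
  have res2 (J : ℂ) (hJ : J ^ 2 = -1) (hJn : ‖J‖ = 1) :
      ‖(acousticRoot s Γ Γ₁ J r + D * r ^ 2) * acousticHeat s b m D J r
      - m * (D - b) * r ^ 2 * acousticRoot s Γ Γ₁ J r‖ ≤ P₂ * r ^ 5 := by
    rw [acousticHeat_residual hs hJ, norm_mul, norm_pow, Complex.norm_real,
      Real.norm_of_nonneg hr.le, mul_comm]
    gcongr
    have e : (m * (D - b) * D * (J * (D - Γ) - Γ₁ * r) / s : ℂ) =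
      ((m * (D - b) * D / s : ℝ) : ℂ) * (J * ((D - Γ : ℝ) : ℂ) - ((Γ₁ * r : ℝ) : ℂ)) := by
      push_cast; ring
    have h1 : ‖J * ((D - Γ : ℝ) : ℂ) - ((Γ₁ * r : ℝ) : ℂ)‖ ≤ |D - Γ| + |Γ₁| := by
      refine (norm_sub_le _ _).trans (add_le_add ?_ ?_)
      · rw [norm_mul, hJn, one_mul, Complex.norm_real, Real.norm_eq_abs]
      · rw [Complex.norm_real, Real.norm_eq_abs, abs_mul, abs_of_pos hr]
        exact mul_le_of_le_one_right (abs_nonneg _) hr1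
    rw [e, norm_mul, Complex.norm_real, Real.norm_eq_abs, abs_div, abs_mul, abs_mul, abs_of_pos hs,
      abs_of_pos hm, abs_of_pos hD, hP₂]
    calc _ ≤ m * |D - b| * D / s * (|D - Γ| + |Γ₁|) := by gcongr
      _ = _ := by ring
  -- the approximate solution
  set ep : ℝ → ℂ := fun t => cp * Complex.exp (μp * t) with hep
  set em : ℝ → ℂ := fun t => cm * Complex.exp (μm * t) with hem
  set eD : ℝ → ℂ := fun t => z 0 * Complex.exp (δ * t) with heD
  have dp (t : ℝ) : HasDerivAt ep (μp * ep t) t := hasDerivAt_exp_mul_ofReal _ _ t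
  have dm (t : ℝ) : HasDerivAt em (μm * em t) t := hasDerivAt_exp_mul_ofReal _ _ t
  have dD (t : ℝ) : HasDerivAt eD (δ * eD t) t := hasDerivAt_exp_mul_ofReal _ _ t
  have hepn (t : ℝ) (ht : 0 ≤ t) : ‖ep t‖ ≤ C₀ * F / r * Real.exp (-(κ * r ^ 2 * t)) := by
    rw [hep]; simp only
    rw [norm_mul, norm_exp_acousticRoot _ _ _ Complex.I_re]
    gcongr
    rw [neg_mul, neg_mul]; gcongr; exact min_le_left _ _
  have hemn (t : ℝ) (ht : 0 ≤ t) : ‖em t‖ ≤ C₀ * F / r * Real.exp (-(κ * r ^ 2 * t)) := by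
    rw [hem]; simp only
    rw [norm_mul, norm_exp_acousticRoot _ _ _ (by simp)]
    gcongr
    rw [neg_mul, neg_mul]; gcongr; exact min_le_left _ _
  have hδe (t : ℝ) : Complex.exp (δ * t) = (Real.exp (-D * r ^ 2 * t) : ℝ) := by
    rw [hδ, Complex.ofReal_exp]; push_cast; rfl
  have heDn (t : ℝ) (ht : 0 ≤ t) : ‖eD t‖ ≤ F * Real.exp (-(κ * r ^ 2 * t)) := by
    rw [heD]; simp only
    rw [norm_mul, hδe, Complex.norm_real, Real.norm_of_nonneg (Real.exp_pos _).le]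
    gcongr
    rw [neg_mul, neg_mul]; gcongr; exact min_le_right _ _
  set va : ℝ → ℂ := fun t => ep t + em t + D / s ^ 2 * eD t with hva
  set ua : ℝ → ℂ := fun t => μp * ep t + μm * em t + D / s ^ 2 * (δ * eD t) with hua
  set za : ℝ → ℂ := fun t => χp * ep t + χm * em t + eD t with hza
  set R₁ : ℝ → ℂ := fun t =>
    -((μp ^ 2 + s ^ 2 * r ^ 2 + (b + m * D) * r ^ 2 * μp - D * r ^ 2 * χp) * ep t
      + (μm ^ 2 + s ^ 2 * r ^ 2 + (b + m * D) * r ^ 2 * μm - D * r ^ 2 * χm) * em t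
      + κ₁ * r ^ 4 * eD t) with hR₁
  set R₂ : ℝ → ℂ := fun t =>
    -(((μp + D * r ^ 2) * χp - m * (D - b) * r ^ 2 * μp) * ep t
      + ((μm + D * r ^ 2) * χm - m * (D - b) * r ^ 2 * μm) * em t
      + κ₂ * r ^ 4 * eD t) with hR₂
  have hcomb {A₁ A₂ : ℂ} {κ' P : ℝ} (h1 : ‖A₁‖ ≤ P * r ^ 5) (h2 : ‖A₂‖ ≤ P * r ^ 5) (t : ℝ)
      (ht : 0 ≤ t) : ‖-(A₁ * ep t + A₂ * em t + κ' * r ^ 4 * eD t)‖ ≤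
        (2 * C₀ * P + |κ'|) * (r ^ 4 * F * Real.exp (-(κ * r ^ 2 * t))) := by
    rw [norm_neg]
    have hP : 0 ≤ P * r ^ 5 := (norm_nonneg _).trans h1
    have i1 := mul_le_mul h1 (hepn t ht) (norm_nonneg _) hP
    have i2 := mul_le_mul h2 (hemn t ht) (norm_nonneg _) hP
    have i3 : ‖(κ' * r ^ 4 * eD t : ℂ)‖ ≤ |κ'| * r ^ 4 * (F * Real.exp (-(κ * r ^ 2 * t))) := by
      rw [norm_mul, norm_mul, norm_pow, Complex.norm_real, Complex.norm_real, Real.norm_eq_abs,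
        Real.norm_of_nonneg hr.le]
      gcongr; exact heDn t ht
    have e : P * r ^ 5 * (C₀ * F / r * Real.exp (-(κ * r ^ 2 * t))) =
      C₀ * P * (r ^ 4 * F * Real.exp (-(κ * r ^ 2 * t))) := by field_simp
    rw [e, ← norm_mul] at i1 i2
    refine (norm_add₃_le).trans ?_
    linarith only [i1, i2, i3]
  set ρ := r ^ 2 / (1 + r ^ 2) with hρ
  have hρpos : 0 < ρ := by positivity
  have hρ1 : ρ ≤ r ^ 2 := div_le_self (by positivity) (by linarith only [sq_nonneg r])
  have hρ2 : r ^ 2 / 2 ≤ ρ := by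
    rw [hρ]; gcongr; linarith only [pow_le_one₀ (n := 2) hr.le hr1]
  have main := H (r ^ 2) ρ ((Q₁ ^ 2 + Q₂ ^ 2) * (r ^ 4 * F) ^ 2) (by positivity) rfl (by positivity)
    (fun t => v t - va t) (fun t => u t - ua t) (fun t => z t - za t) R₁ R₂
    (fun t => ((hsol.deriv_v t).sub (((dp t).add (dm t)).add ((dD t).const_mul _))))
    (fun t => ((hsol.deriv_u t).sub ((((dp t).const_mul μp).add ((dm t).const_mul μm)).add
      (((dD t).const_mul δ).const_mul _))).congr_deriv (by
        simp only [hva, hua, hza, hR₁, hκ₁, hδ]; push_cast; field_simp; ring))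
    (fun t => ((hsol.deriv_z t).sub ((((dp t).const_mul χp).add ((dm t).const_mul χm)).add
      (dD t))).congr_deriv (by
        simp only [hua, hza, hR₂, hκ₂, hδ]; push_cast; field_simp; ring))
    (fun t ht => by
      have i1 := hcomb (κ' := κ₁) (res1 _ hJp Complex.norm_I)
        (res1 _ hJm (by rw [norm_neg, Complex.norm_I])) t ht
      have i2 := hcomb (κ' := κ₂) (res2 _ hJp Complex.norm_I)
        (res2 _ hJm (by rw [norm_neg, Complex.norm_I])) t ht
      change ‖R₁ t‖ ≤ Q₁ * _ at i1
      change ‖R₂ t‖ ≤ Q₂ * _ at i2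
      calc ‖R₁ t‖ ^ 2 + ‖R₂ t‖ ^ 2 ≤ (Q₁ * (r ^ 4 * F * Real.exp (-(κ * r ^ 2 * t)))) ^ 2
            + (Q₂ * (r ^ 4 * F * Real.exp (-(κ * r ^ 2 * t)))) ^ 2 := by gcongr
        _ = (Q₁ ^ 2 + Q₂ ^ 2) * (r ^ 4 * F) ^ 2 * Real.exp (-(κ * r ^ 2 * t)) ^ 2 := by ring
        _ ≤ _ := by
          gcongr
          rw [← Real.exp_nat_mul]
          gcongr
          have : k * ρ * t ≤ 2 * κ * r ^ 2 * t := by gcongr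
          push_cast; linarith only [this]) t ht
  have hdv : v 0 - va 0 = 0 := by
    simp only [hva, hep, hem, heD, Complex.ofReal_zero, mul_zero, Complex.exp_zero, mul_one]
    rw [hsum, hB]; ring
  have hdu : ‖u 0 - ua 0‖ ≤ Q₃ * (r ^ 2 * F) := by
    have e : u 0 - ua 0 = (Γ * r ^ 2 : ℝ) * B - (Γ₁ / s * r ^ 2 : ℝ) * u 0
        + (D ^ 2 / s ^ 2 * r ^ 2 : ℝ) * z 0 := by
      simp only [hua, hep, hem, heD, Complex.ofReal_zero, mul_zero, Complex.exp_zero, mul_one, hμp,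
        hμm, acousticRoot, hδ]
      have e1 : (-Γ * r ^ 2 + Complex.I * (s * r + Γ₁ * r ^ 3)) * cp
          + (-Γ * r ^ 2 + -Complex.I * (s * r + Γ₁ * r ^ 3)) * cm
        = -Γ * r ^ 2 * B + (s * r + Γ₁ * r ^ 3) * (u 0 / (s * r)) := by
        linear_combination (-Γ * r ^ 2 : ℂ) * hsum + (Complex.I * (s * r + Γ₁ * r ^ 3)) * hdiff
          - ((s * r + Γ₁ * r ^ 3) * (u 0 / (s * r)) : ℂ) * hJp
      rw [e1]; push_cast; field_simp; ring
    rw [e]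
    refine (norm_add_le _ _).trans ((add_le_add_left (norm_sub_le _ _) _).trans ?_)
    rw [norm_mul, norm_mul, norm_mul, Complex.norm_real, Complex.norm_real, Complex.norm_real,
      Real.norm_of_nonneg (by positivity), Real.norm_eq_abs, abs_mul, abs_div, abs_of_pos hs,
      abs_of_pos (by positivity : 0 < r ^ 2), Real.norm_of_nonneg (by positivity)]
    calc _ ≤ Γ * r ^ 2 * ((1 + D / s ^ 2) * F) + |Γ₁| / s * r ^ 2 * F + D ^ 2 / s ^ 2 * r ^ 2 * F := by
          gcongr
      _ = _ := by ring
  have hdz : ‖z 0 - za 0‖ ≤ Q₄ * (r ^ 2 * F) := by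
    have e : z 0 - za 0 = -((m * (D - b) * r ^ 2 : ℝ) * (B + (D / s ^ 2 : ℝ) * u 0)) := by
      simp only [hza, hep, hem, heD, Complex.ofReal_zero, mul_zero, Complex.exp_zero, mul_one, hχp,
        hχm, acousticHeat]
      have e1 : (r ^ 2 + Complex.I * D * r ^ 3 / s) * cp + (r ^ 2 + -Complex.I * D * r ^ 3 / s) * cm
        = r ^ 2 * B + D * r ^ 3 / s * (u 0 / (s * r)) := by
        linear_combination (r ^ 2 : ℂ) * hsum + (Complex.I * D * r ^ 3 / s) * hdiff
          - (D * r ^ 3 / s * (u 0 / (s * r)) : ℂ) * hJp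
      have e2 : (D * r ^ 3 / s * (u 0 / (s * r)) : ℂ) = r ^ 2 * (D / s ^ 2 * u 0) := by
        field_simp
      rw [e2] at e1
      push_cast
      linear_combination (-m * (D - b) : ℂ) * e1
    rw [e, norm_neg, norm_mul, Complex.norm_real, Real.norm_eq_abs, abs_mul, abs_mul,
      abs_of_pos hm, abs_of_pos (by positivity : 0 < r ^ 2)]
    have h1 : ‖B + (D / s ^ 2 : ℝ) * u 0‖ ≤ (1 + 2 * D / s ^ 2) * F := by
      refine (norm_add_le _ _).trans ?_
      rw [norm_mul, Complex.norm_real, Real.norm_of_nonneg (by positivity)]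
      have : D / s ^ 2 * ‖u 0‖ ≤ D / s ^ 2 * F := by gcongr
      calc _ ≤ (1 + D / s ^ 2) * F + D / s ^ 2 * F := add_le_add hBn this
        _ = _ := by ring
    calc _ ≤ m * |D - b| * r ^ 2 * ((1 + 2 * D / s ^ 2) * F) := by gcongr
      _ = _ := by ring
  have hmodal : va t = modalProfile s D Γ Γ₁ r t (v 0) (u 0) (z 0) := by
    obtain ⟨h1, h2⟩ := exp_acousticRoot_mul s Γ Γ₁ r t
    simp only [hva, hep, hem, heD, hδe, hμp, hμm]
    rw [h1, h2, modalProfile, ← hB]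
    generalize Real.exp (-Γ * r ^ 2 * t) = E
    generalize Real.cos ((s * r + Γ₁ * r ^ 3) * t) = c
    generalize Real.sin ((s * r + Γ₁ * r ^ 3) * t) = σ
    push_cast
    linear_combination (E * c : ℂ) * hsum + (E * σ * Complex.I : ℂ) * hdiff
      - (E * σ * (u 0 / (s * r)) : ℂ) * hJp
  rw [← hmodal]
  simp only [hdv, norm_zero] at main
  set x := r ^ 2 * t with hx
  have hx0 : 0 ≤ x := by positivity
  -- Here `ρ ≥ r²/2` because `r ≤ 1`. One factor `G` absorbs the growth `x = r² t` of the forcing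
  -- term, the other survives, and the final square root halves its rate to `k/8`.
  have hexp : Real.exp (-(k * ρ * t)) ≤ Real.exp (-(k / 4 * x)) * Real.exp (-(k / 4 * x)) := by
    rw [← Real.exp_add]
    gcongr
    have : k * (r ^ 2 / 2) * t ≤ k * ρ * t := by gcongr
    rw [hx]; linarith only [this]
  have hNt : (Q₁ ^ 2 + Q₂ ^ 2) * (r ^ 4 * F) ^ 2 * t / ρ ≤
      2 * (Q₁ ^ 2 + Q₂ ^ 2) * ((r ^ 2 * F) ^ 2) * x := by
    calc _ ≤ (Q₁ ^ 2 + Q₂ ^ 2) * (r ^ 4 * F) ^ 2 * t / (r ^ 2 / 2) := by gcongr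
      _ = 2 * (Q₁ ^ 2 + Q₂ ^ 2) * ((r ^ 2 * F) ^ 2) * x := by rw [hx]; field_simp
  set G := Real.exp (-(k / 4 * x)) with hG
  have hGpos : 0 < G := Real.exp_pos _
  have hG1 : G ≤ 1 := by rw [hG, Real.exp_le_one_iff]; simp; positivity
  have hxG : x * G ≤ 4 / k := by
    refine (mul_exp_neg_le (by positivity)).trans (le_of_eq ?_); field_simp
  have hsq : r ^ 2 * ‖v t - va t‖ ^ 2 ≤ r ^ 2 * (S * (r * F) ^ 2 * G) := by
    have h1 : ‖u 0 - ua 0‖ ^ 2 ≤ (Q₃ * (r ^ 2 * F)) ^ 2 := by gcongr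
    have h2 : ‖z 0 - za 0‖ ^ 2 ≤ (Q₄ * (r ^ 2 * F)) ^ 2 := by gcongr
    calc r ^ 2 * ‖v t - va t‖ ^ 2 ≤ ‖u t - ua t‖ ^ 2 + r ^ 2 * ‖v t - va t‖ ^ 2 + ‖z t - za t‖ ^ 2 := by
          linarith only [sq_nonneg ‖u t - ua t‖, sq_nonneg ‖z t - za t‖]
      _ ≤ _ := main
      _ ≤ C * (G * G) * ((Q₃ * (r ^ 2 * F)) ^ 2 + r ^ 2 * 0 ^ 2 + (Q₄ * (r ^ 2 * F)) ^ 2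
          + 2 * (Q₁ ^ 2 + Q₂ ^ 2) * ((r ^ 2 * F) ^ 2) * x) := by gcongr
      _ = C * (r ^ 2 * F) ^ 2 * G * ((Q₃ ^ 2 + Q₄ ^ 2) * G + 2 * (Q₁ ^ 2 + Q₂ ^ 2) * (x * G)) := by ring
      _ ≤ C * (r ^ 2 * F) ^ 2 * G * ((Q₃ ^ 2 + Q₄ ^ 2) * 1 + 2 * (Q₁ ^ 2 + Q₂ ^ 2) * (4 / k)) := by
          gcongr
      _ = _ := by rw [hS]; ring
  have hsq2 : ‖v t - va t‖ ^ 2 ≤ (√S * (r * F) * Real.exp (-(k / 8 * r ^ 2 * t))) ^ 2 := by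
    rw [mul_pow, mul_pow, Real.sq_sqrt hS0, ← Real.exp_nat_mul]
    have : Real.exp ((2 : ℕ) * -(k / 8 * r ^ 2 * t)) = G := by
      rw [hG, hx]; congr 1; push_cast; ring
    rw [this]
    exact le_of_mul_le_mul_left hsq (by positivity)
  have hfin := abs_le_of_sq_le_sq hsq2 (by positivity)
  refine ((le_abs_self _).trans hfin).trans ?_
  have : 0 ≤ r * F * Real.exp (-(k / 8 * r ^ 2 * t)) := by positivity
  linarith only [this]

/-- Only the sine term carries `1/r`. In the others the sole unbounded factor is `r² t`, which half
of the Gaussian absorbs, so they are bounded uniformly in `r`. -/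
theorem symbolProfile_sub_wave_le {s D Γ : ℝ} (Γ₁ : ℝ) (hs : 0 < s) (hD : 0 < D) (hΓ : 0 < Γ) :
    ∃ C : ℝ, 0 < C ∧ ∀ r t : ℝ, 0 ≤ t → ∀ f₀ f₁ z₀ : ℂ,
      ‖symbolProfile s D Γ Γ₁ r t f₀ f₁ z₀
        - (Real.sin (s * r * t) / (s * r) * Real.exp (-Γ * r ^ 2 * t) : ℝ) * f₁‖ ≤
        C * Real.exp (-(min (Γ / 2) D * r ^ 2 * t)) * (‖f₀‖ + ‖f₁‖ + ‖z₀‖) := by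
  refine ⟨1 + |Γ₁| / s * (2 / Γ) + 2 * D / s ^ 2, by positivity, ?_⟩
  intro r t ht f₀ f₁ z₀
  have hx : 0 ≤ r ^ 2 * t := by positivity
  set E' := Real.exp (-(min (Γ / 2) D * r ^ 2 * t)) with hE'
  have hE'pos : 0 < E' := Real.exp_pos _
  have hE1 : Real.exp (-Γ * r ^ 2 * t) ≤ Real.exp (-(Γ / 2 * (r ^ 2 * t))) * E' := by
    rw [hE', ← Real.exp_add]; gcongr
    have : min (Γ / 2) D * (r ^ 2 * t) ≤ Γ / 2 * (r ^ 2 * t) := by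
      gcongr; exact min_le_left _ _
    linarith
  have hE2 : Real.exp (-D * r ^ 2 * t) ≤ E' := by
    rw [hE']; gcongr
    have : min (Γ / 2) D * (r ^ 2 * t) ≤ D * (r ^ 2 * t) := by
      gcongr; exact min_le_right _ _
    linarith
  have hE3 : Real.exp (-Γ * r ^ 2 * t) ≤ E' := by
    refine hE1.trans (mul_le_of_le_one_left hE'pos.le ?_)
    rw [Real.exp_le_one_iff]; linarith [mul_nonneg (half_pos hΓ).le hx]
  have hc : |Real.cos (s * r * t) * Real.exp (-Γ * r ^ 2 * t)| ≤ E' := by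
    rw [abs_mul, abs_of_pos (Real.exp_pos _)]
    exact (mul_le_of_le_one_left (Real.exp_pos _).le (Real.abs_cos_le_one _)).trans hE3
  have h1 : |Γ₁ / s * t * r ^ 2 * (Real.cos (s * r * t) * Real.exp (-Γ * r ^ 2 * t))| ≤
      |Γ₁| / s * (2 / Γ) * E' := by
    have h2 : r ^ 2 * t * Real.exp (-(Γ / 2 * (r ^ 2 * t))) ≤ 2 / Γ := by
      refine (mul_exp_neg_le (by positivity)).trans (le_of_eq ?_); field_simp
    rw [show Γ₁ / s * t * r ^ 2 * (Real.cos (s * r * t) * Real.exp (-Γ * r ^ 2 * t)) =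
      Γ₁ / s * (r ^ 2 * t) * Real.exp (-Γ * r ^ 2 * t) * Real.cos (s * r * t) by ring, abs_mul]
    refine (mul_le_of_le_one_right (abs_nonneg _) (Real.abs_cos_le_one _)).trans ?_
    rw [abs_mul, abs_mul, abs_div, abs_of_pos hs, abs_of_nonneg hx, abs_of_pos (Real.exp_pos _)]
    calc |Γ₁| / s * (r ^ 2 * t) * Real.exp (-Γ * r ^ 2 * t)
        ≤ |Γ₁| / s * (r ^ 2 * t) * (Real.exp (-(Γ / 2 * (r ^ 2 * t))) * E') := by gcongr
      _ = |Γ₁| / s * (r ^ 2 * t * Real.exp (-(Γ / 2 * (r ^ 2 * t)))) * E' := by ring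
      _ ≤ _ := by gcongr
  have h3 : |D / s ^ 2 * (Real.exp (-D * r ^ 2 * t)
        - Real.cos (s * r * t) * Real.exp (-Γ * r ^ 2 * t))| ≤ 2 * D / s ^ 2 * E' := by
    rw [abs_mul, abs_of_pos (by positivity : 0 < D / s ^ 2)]
    have h4 := abs_le.1 hc
    have h5 : |Real.exp (-D * r ^ 2 * t)
        - Real.cos (s * r * t) * Real.exp (-Γ * r ^ 2 * t)| ≤ 2 * E' := by
      rw [abs_le]
      constructor <;> linarith [Real.exp_pos (-D * r ^ 2 * t)]
    calc _ ≤ D / s ^ 2 * (2 * E') := by gcongr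
      _ = _ := by ring
  have e : symbolProfile s D Γ Γ₁ r t f₀ f₁ z₀
        - (Real.sin (s * r * t) / (s * r) * Real.exp (-Γ * r ^ 2 * t) : ℝ) * f₁
      = (Real.cos (s * r * t) * Real.exp (-Γ * r ^ 2 * t) : ℝ) * f₀
    + (Γ₁ / s * t * r ^ 2 * (Real.cos (s * r * t) * Real.exp (-Γ * r ^ 2 * t)) : ℝ) * f₁
    + (D / s ^ 2 * (Real.exp (-D * r ^ 2 * t)
        - Real.cos (s * r * t) * Real.exp (-Γ * r ^ 2 * t)) : ℝ) * z₀ := by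
    rw [symbolProfile]; ring
  rw [e]
  refine norm_add₃_le.trans ?_
  rw [norm_mul, norm_mul, norm_mul, Complex.norm_real, Complex.norm_real, Complex.norm_real,
    Real.norm_eq_abs, Real.norm_eq_abs, Real.norm_eq_abs]
  have i1 := mul_le_mul_of_nonneg_right hc (norm_nonneg f₀)
  have i2 := mul_le_mul_of_nonneg_right h1 (norm_nonneg f₁)
  have i3 := mul_le_mul_of_nonneg_right h3 (norm_nonneg z₀)
  have j1 : 0 ≤ E' * ‖f₁‖ := by positivity
  have j2 : 0 ≤ E' * ‖z₀‖ := by positivity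
  have j3 : 0 ≤ |Γ₁| / s * (2 / Γ) * E' * (‖f₀‖ + ‖z₀‖) := by positivity
  have j4 : 0 ≤ 2 * D / s ^ 2 * E' * (‖f₀‖ + ‖f₁‖) := by positivity
  linarith only [i1, i2, i3, j1, j2, j3, j4]

theorem abs_wave_le {s Γ r t : ℝ} (hs : 0 < s) (hr : 0 < r) :
    |Real.sin (s * r * t) / (s * r) * Real.exp (-Γ * r ^ 2 * t)| ≤
      1 / (s * r) * Real.exp (-(Γ * r ^ 2 * t)) := by
  rw [abs_mul, abs_of_pos (Real.exp_pos _), abs_div, abs_of_pos (mul_pos hs hr), neg_mul, neg_mul]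
  gcongr
  exact Real.abs_sin_le_one _

/-- For `r ≥ 1` the rate factor `r²/(1+r²)` is at least `1/2`, and dividing the energy inequality by
`r²` leaves constants independent of `r`. -/
theorem IsModeSolution.norm_le_of_one_le {s b m D : ℝ} (hs : 0 < s) (hb : 0 < b)
    (hm : 0 < m) (hD : 0 < D) :
    ∃ k C : ℝ, 0 < k ∧ 0 < C ∧ ∀ r : ℝ, 1 ≤ r → ∀ v u z : ℝ → ℂ,
      IsModeSolution s b m D (r ^ 2) v u z → ∀ t ≥ 0,
      ‖v t‖ ≤ C * Real.exp (-(k * t)) * (‖v 0‖ + ‖u 0‖ + ‖z 0‖) := by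
  obtain ⟨k, C, hk, -, hC, H⟩ := energy_decay (s := s ^ 2) (k₁ := 1) (by positivity) hb hm hD
    (by positivity)
  refine ⟨k / 4, √C, by positivity, by positivity, ?_⟩
  intro r hr v u z hsol t ht
  have hr2 : 1 ≤ r ^ 2 := one_le_pow₀ hr
  have hr0 : 0 < r ^ 2 := by positivity
  have hρ : 1 / 2 ≤ r ^ 2 / (1 + r ^ 2) := by
    rw [div_le_div_iff₀ (by norm_num) (by positivity)]; linarith
  have main := H (r ^ 2) _ 0 hr0 rfl le_rfl v u z (fun _ => 0) (fun _ => 0) hsol.deriv_v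
    (fun t => (hsol.deriv_u t).congr_deriv (by push_cast; ring))
    (fun t => (hsol.deriv_z t).congr_deriv (by push_cast; ring)) (by simp) t ht
  rw [zero_mul, zero_div, add_zero] at main
  set F := ‖v 0‖ + ‖u 0‖ + ‖z 0‖
  have hF : ‖u 0‖ ^ 2 + r ^ 2 * ‖v 0‖ ^ 2 + ‖z 0‖ ^ 2 ≤ r ^ 2 * F ^ 2 := by
    have h1 : ‖u 0‖ ^ 2 + ‖v 0‖ ^ 2 + ‖z 0‖ ^ 2 ≤ F ^ 2 := by
      have g1 : 0 ≤ ‖u 0‖ * ‖v 0‖ := by positivity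
      have g2 : 0 ≤ ‖u 0‖ * ‖z 0‖ := by positivity
      have g3 : 0 ≤ ‖z 0‖ * ‖v 0‖ := by positivity
      simp only [F]; nlinarith
    have h2 : ‖u 0‖ ^ 2 ≤ r ^ 2 * ‖u 0‖ ^ 2 := le_mul_of_one_le_left (by positivity) hr2
    have h3 : ‖z 0‖ ^ 2 ≤ r ^ 2 * ‖z 0‖ ^ 2 := le_mul_of_one_le_left (by positivity) hr2
    have h4 := mul_le_mul_of_nonneg_left h1 hr0.le
    linarith
  have hexp : Real.exp (-(k * (r ^ 2 / (1 + r ^ 2)) * t)) ≤ Real.exp (-(k / 4 * t)) ^ 2 := by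
    rw [← Real.exp_nat_mul]; gcongr
    have : k * (1 / 2) * t ≤ k * (r ^ 2 / (1 + r ^ 2)) * t := by gcongr
    push_cast; linarith
  have hsq : r ^ 2 * ‖v t‖ ^ 2 ≤ r ^ 2 * (√C * Real.exp (-(k / 4 * t)) * F) ^ 2 := by
    calc r ^ 2 * ‖v t‖ ^ 2 ≤ ‖u t‖ ^ 2 + r ^ 2 * ‖v t‖ ^ 2 + ‖z t‖ ^ 2 := by
          linarith only [sq_nonneg ‖u t‖, sq_nonneg ‖z t‖]
      _ ≤ _ := main
      _ ≤ C * Real.exp (-(k / 4 * t)) ^ 2 * (r ^ 2 * F ^ 2) := by gcongr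
      _ = _ := by rw [mul_pow, mul_pow, Real.sq_sqrt hC.le]; ring
  exact abs_le_of_sq_le_sq' (le_of_mul_le_mul_left hsq hr0) (by positivity) |>.2

/-- Mode solutions are approximated by the low-frequency profile, uniformly in the frequency, up to
one power of the frequency and an exponentially decaying remainder. -/
theorem IsModeSolution.sub_symbolProfile_le {s b m D Γ Γ₁ : ℝ} (hs : 0 < s) (hb : 0 < b)
    (hm : 0 < m) (hD : 0 < D) (hΓ : 2 * Γ = b + m * D)
    (hΓ₁ : 2 * s * Γ₁ = -Γ ^ 2 - 2 * D * Γ + b * (1 + m) * D) :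
    ∃ k C : ℝ, 0 < k ∧ 0 < C ∧ ∀ r : ℝ, 0 < r → ∀ v u z : ℝ → ℂ,
      IsModeSolution s b m D (r ^ 2) v u z → ∀ t ≥ 0,
      ‖v t - symbolProfile s D Γ Γ₁ r t (v 0) (u 0) (z 0)‖ ≤
        C * (r * Real.exp (-(k * r ^ 2 * t)) + Real.exp (-(k * t)))
          * (‖v 0‖ + ‖u 0‖ + ‖z 0‖) := by
  have hΓpos : 0 < Γ := by nlinarith [mul_pos hm hD]
  obtain ⟨k₁, C₁, hk₁, hC₁, H₁⟩ := IsModeSolution.sub_modalProfile_le hs hb hm hD hΓ hΓ₁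
  obtain ⟨k₂, C₂, hk₂, hC₂, H₂⟩ := IsModeSolution.norm_le_of_one_le hs hb hm hD
  obtain ⟨C₃, hC₃, H₃⟩ := modalProfile_sub_symbolProfile_le Γ₁ hs hD hΓpos
  obtain ⟨C₄, hC₄, H₄⟩ := symbolProfile_sub_wave_le Γ₁ hs hD hΓpos
  set k := min (min k₁ k₂) (min (Γ / 2) D) with hk
  have hk0 : 0 < k := by positivity
  have kk₁ : k ≤ k₁ := (min_le_left _ _).trans (min_le_left _ _)
  have kk₂ : k ≤ k₂ := (min_le_left _ _).trans (min_le_right _ _)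
  have kk₃ : k ≤ min (Γ / 2) D := min_le_right _ _
  have kk₄ : k ≤ Γ / 2 := kk₃.trans (min_le_left _ _)
  refine ⟨k, C₁ + C₂ + C₃ + C₄ + 1 / s, hk0, by positivity, ?_⟩
  intro r hr v u z hsol t ht
  set F := ‖v 0‖ + ‖u 0‖ + ‖z 0‖ with hF
  have hF0 : 0 ≤ F := by positivity
  set X := r * Real.exp (-(k * r ^ 2 * t)) with hX
  set Y := Real.exp (-(k * t)) with hY
  have hX0 : 0 ≤ X := by positivity
  have hY0 : 0 ≤ Y := by positivity
  have hXY : 0 ≤ (X + Y) * F := by positivity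
  -- Above `r = 1` solution and profile need not be compared: the first decays exponentially, the
  -- second is Gaussian, and the factor `r ≥ 1` in the bound is free.
  rcases le_total r 1 with hr1 | hr1
  · have h1 := H₁ r hr hr1 v u z hsol t ht
    have h2 := H₃ r t hr ht (v 0) (u 0) (z 0)
    have g1 : r * Real.exp (-(k₁ * r ^ 2 * t)) ≤ X := by rw [hX]; gcongr
    have g2 : r * Real.exp (-(Γ / 2 * r ^ 2 * t)) ≤ X := by rw [hX]; gcongr
    have g3 : C₁ * r * Real.exp (-(k₁ * r ^ 2 * t)) * F ≤ C₁ * X * F := by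
      rw [mul_assoc C₁]; gcongr
    have g4 : C₃ * r * Real.exp (-(Γ / 2 * r ^ 2 * t)) * F ≤ C₃ * X * F := by
      rw [mul_assoc C₃]; gcongr
    calc _ ≤ _ := norm_sub_le_norm_sub_add_norm_sub _ (modalProfile s D Γ Γ₁ r t (v 0) (u 0) (z 0)) _
      _ ≤ C₁ * X * F + C₃ * X * F := add_le_add (h1.trans g3) (h2.trans g4)
      _ ≤ (C₁ + C₃) * ((X + Y) * F) := by
        have : 0 ≤ (C₁ + C₃) * (Y * F) := by positivity
        linarith only [this]
      _ ≤ (C₁ + C₂ + C₃ + C₄ + 1 / s) * ((X + Y) * F) := by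
        refine mul_le_mul_of_nonneg_right ?_ hXY
        have : 0 ≤ 1 / s := by positivity
        linarith only [this, hC₂, hC₄]
      _ = _ := by ring
  · have h1 := H₂ r hr1 v u z hsol t ht
    have h2 := H₄ r t ht (v 0) (u 0) (z 0)
    have g1 : C₂ * Real.exp (-(k₂ * t)) * F ≤ C₂ * Y * F := by rw [hY]; gcongr
    have g2 : C₄ * Real.exp (-(min (Γ / 2) D * r ^ 2 * t)) * F ≤ C₄ * X * F := by
      have : Real.exp (-(min (Γ / 2) D * r ^ 2 * t)) ≤ X := by
        rw [hX]
        refine le_trans ?_ (le_mul_of_one_le_left (Real.exp_pos _).le hr1)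
        gcongr
      gcongr
    have g3 : ‖((Real.sin (s * r * t) / (s * r) * Real.exp (-Γ * r ^ 2 * t) : ℝ) : ℂ) * u 0‖ ≤
        1 / s * X * F := by
      rw [norm_mul, Complex.norm_real, Real.norm_eq_abs]
      have g4 : 1 / (s * r) * Real.exp (-(Γ * r ^ 2 * t)) ≤ 1 / s * X := by
        rw [hX]
        have : Real.exp (-(Γ * r ^ 2 * t)) ≤ r * Real.exp (-(k * r ^ 2 * t)) := by
          refine le_trans ?_ (le_mul_of_one_le_left (Real.exp_pos _).le hr1)
          gcongr; linarith
        gcongr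
        exact le_mul_of_one_le_right hs.le hr1
      refine mul_le_mul ((abs_wave_le hs hr).trans g4) ?_ (norm_nonneg _) (by positivity)
      rw [hF]; linarith only [norm_nonneg (v 0), norm_nonneg (z 0)]
    calc _ ≤ ‖v t‖ + ‖symbolProfile s D Γ Γ₁ r t (v 0) (u 0) (z 0)‖ := norm_sub_le _ _
      _ ≤ C₂ * Y * F + (C₄ * X * F + 1 / s * X * F) := by
        refine add_le_add (h1.trans g1) ?_
        refine le_trans ?_ (add_le_add (h2.trans g2) g3)
        exact norm_le_norm_sub_add _ _
      _ ≤ (C₂ + C₄ + 1 / s) * ((X + Y) * F) := by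
        have g5 : 0 ≤ C₂ * (X * F) := by positivity
        have g6 : 0 ≤ (C₄ + 1 / s) * (Y * F) := by positivity
        linarith only [g5, g6]
      _ ≤ (C₁ + C₂ + C₃ + C₄ + 1 / s) * ((X + Y) * F) := by
        refine mul_le_mul_of_nonneg_right ?_ hXY
        linarith only [hC₁, hC₃]
      _ = _ := by ring

/-! ### The Fourier transform on `L²` and on Schwartz functions -/

open FourierTransform

section Multiplier

variable {V : Type*} [NormedAddCommGroup V] [InnerProductSpace ℝ V]

/-- Multiplication of Schwartz functions by `(2π‖ξ‖)²`, the symbol of `-Δ`. -/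
noncomputable def mulNormSq (η : 𝓢(V, ℂ)) : 𝓢(V, ℂ) :=
  ((2 * Real.pi) ^ 2 : ℝ) • SchwartzMap.smulLeftCLM ℂ (fun x : V => ‖x‖ ^ 2) η

theorem mulNormSq_apply (η : 𝓢(V, ℂ)) (ξ : V) :
    mulNormSq η ξ = ((2 * Real.pi * ‖ξ‖) ^ 2 : ℝ) * η ξ := by
  have : (fun x : V => ‖x‖ ^ 2).HasTemperateGrowth := by fun_prop
  simp only [mulNormSq, smul_apply, SchwartzMap.smulLeftCLM_apply_apply this,
    Complex.real_smul]
  push_cast; ring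

end Multiplier

section Fourier

variable {V : Type*} [NormedAddCommGroup V] [InnerProductSpace ℝ V] [FiniteDimensional ℝ V]
  [MeasurableSpace V] [BorelSpace V]

theorem integral_fourier_Lp_mul (f : Lp ℂ 2 (volume : Measure V)) (η : 𝓢(V, ℂ)) :
    ∫ x, η x * (𝓕 f : Lp ℂ 2 (volume : Measure V)) x = ∫ x, (𝓕 η) x * f x := by
  have h := congrArg (fun T : 𝓢'(V, ℂ) => T η) (Lp.fourier_toTemperedDistribution_eq f)
  simpa [TemperedDistribution.fourier_apply, Lp.toTemperedDistribution_apply] using h.symm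

theorem integral_fourierInv_Lp_mul (f : Lp ℂ 2 (volume : Measure V)) (η : 𝓢(V, ℂ)) :
    ∫ x, η x * (𝓕⁻ f : Lp ℂ 2 (volume : Measure V)) x = ∫ x, (𝓕⁻ η) x * f x := by
  have h := congrArg (fun T : 𝓢'(V, ℂ) => T η) (Lp.fourierInv_toTemperedDistribution_eq f)
  simpa [TemperedDistribution.fourierInv_apply, Lp.toTemperedDistribution_apply] using h.symm

theorem integral_mul_fourier {f g : V → ℂ} (hf : Integrable f) (hg : Integrable g) :
    ∫ x, g x * 𝓕 f x = ∫ x, 𝓕 g x * f x := by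
  have h := VectorFourier.integral_fourierIntegral_smul_eq_flip (e := Real.fourierChar)
    (μ := volume) (ν := volume) (L := innerₗ V) Real.continuous_fourierChar continuous_inner hg hf
  rw [flip_innerₗ] at h
  exact h.symm

theorem integral_mul_fourierInv {f g : V → ℂ} (hf : Integrable f) (hg : Integrable g) :
    ∫ x, g x * 𝓕⁻ f x = ∫ x, 𝓕⁻ g x * f x := by
  have h := integral_mul_fourier hf hg.comp_neg
  calc ∫ x, g x * 𝓕⁻ f x = ∫ x, g (-x) * 𝓕⁻ f (-x) :=
        (integral_neg_eq_self (fun x => g x * 𝓕⁻ f x) volume).symm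
    _ = ∫ x, g (-x) * 𝓕 f x := by simp [Real.fourierInv_eq_fourier_neg]
    _ = _ := by rw [h, Real.fourierInv_eq_fourier_comp_neg]

theorem continuous_fourier_of_integrable {f : V → ℂ} (hf : Integrable f) : Continuous (𝓕 f) :=
  VectorFourier.fourierIntegral_continuous Real.continuous_fourierChar
    (L := innerₗ V) continuous_inner hf

theorem ae_eq_of_integral_schwartz_mul_eq {f g : V → ℂ} (hf : LocallyIntegrable f volume)
    (hg : LocallyIntegrable g volume)
    (h : ∀ η : 𝓢(V, ℂ), HasCompactSupport η → ∫ x, η x * f x = ∫ x, η x * g x) : f =ᵐ[volume] g := by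
  refine ae_eq_of_integral_contDiff_smul_eq hf hg fun θ hθ hc => ?_
  have hc' : HasCompactSupport (fun x => (θ x : ℂ)) := hc.comp_left (g := Complex.ofReal) rfl
  have := h (hc'.toSchwartzMap (Complex.ofRealCLM.contDiff.comp hθ)) hc'
  simp only [Complex.real_smul]
  exact this

/-- The transform on `L²` and the integral formula are both transposes of the transform on Schwartz
functions, so they agree against every test function. -/
theorem fourier_toLp_ae_eq {f : V → ℂ} (hf : Integrable f) (hf2 : MemLp f 2 volume) :
    (𝓕 (hf2.toLp f) : Lp ℂ 2 (volume : Measure V)) =ᵐ[volume] 𝓕 f := by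
  refine ae_eq_of_integral_schwartz_mul_eq
    ((Lp.memLp _).locallyIntegrable (by norm_num))
    (continuous_fourier_of_integrable hf).locallyIntegrable fun η _ => ?_
  rw [integral_fourier_Lp_mul, integral_mul_fourier hf η.integrable, SchwartzMap.fourier_coe]
  refine integral_congr_ae ?_
  filter_upwards [hf2.coeFn_toLp] with x hx
  rw [hx]

theorem fourierInv_toLp_ae_eq {f : V → ℂ} (hf : Integrable f) (hf2 : MemLp f 2 volume) :
    (𝓕⁻ (hf2.toLp f) : Lp ℂ 2 (volume : Measure V)) =ᵐ[volume] 𝓕⁻ f := by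
  have hcont : Continuous (𝓕⁻ f) := by
    rw [Real.fourierInv_eq_fourier_comp_neg]
    exact continuous_fourier_of_integrable hf.comp_neg
  refine ae_eq_of_integral_schwartz_mul_eq
    ((Lp.memLp _).locallyIntegrable (by norm_num)) hcont.locallyIntegrable fun η _ => ?_
  rw [integral_fourierInv_Lp_mul, integral_mul_fourierInv hf η.integrable,
    SchwartzMap.fourierInv_coe]
  refine integral_congr_ae ?_
  filter_upwards [hf2.coeFn_toLp] with x hx
  rw [hx]

/-- Plancherel in the mixed form needed later: the solution is transformed in `L²`, while the
profiles are given by integrals. -/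
theorem eLpNorm_sub_fourierInv (f : Lp ℂ 2 (volume : Measure V)) {m : V → ℂ} (hm : Integrable m)
    (hm2 : MemLp m 2 volume) :
    eLpNorm (fun x => f x - 𝓕⁻ m x) 2 volume =
      eLpNorm (fun ξ => (𝓕 f : Lp ℂ 2 (volume : Measure V)) ξ - m ξ) 2 volume := by
  have h1 : eLpNorm (fun x => f x - 𝓕⁻ m x) 2 volume
      = eLpNorm (f - 𝓕⁻ (hm2.toLp m) : Lp ℂ 2 (volume : Measure V)) 2 volume := by
    refine eLpNorm_congr_ae ?_
    filter_upwards [Lp.coeFn_sub f (𝓕⁻ (hm2.toLp m)), fourierInv_toLp_ae_eq hm hm2] with x h1 h2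
    rw [h1, Pi.sub_apply, h2]
  have h2 : eLpNorm (fun ξ => (𝓕 f : Lp ℂ 2 (volume : Measure V)) ξ - m ξ) 2 volume
      = eLpNorm (𝓕 f - hm2.toLp m : Lp ℂ 2 (volume : Measure V)) 2 volume := by
    refine eLpNorm_congr_ae ?_
    filter_upwards [Lp.coeFn_sub (𝓕 f) (hm2.toLp m), hm2.coeFn_toLp] with x h1 h2
    rw [h1, Pi.sub_apply, h2]
  have h3 : ‖f - 𝓕⁻ (hm2.toLp m)‖ = ‖𝓕 f - hm2.toLp m‖ := by
    rw [← Lp.norm_fourier_eq, sub_eq_add_neg, FourierAdd.fourier_add]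
    congr 1
    rw [← neg_one_smul ℂ, FourierSMul.fourier_smul, fourier_fourierInv_eq, neg_one_smul,
      ← sub_eq_add_neg]
  rw [h1, h2, ← Lp.enorm_def, ← Lp.enorm_def, ← ofReal_norm, ← ofReal_norm, h3]

theorem eLpNorm_fourier_toLp {f : V → ℂ} (hf : Integrable f) (hf2 : MemLp f 2 volume) :
    eLpNorm (𝓕 f) 2 volume = eLpNorm f 2 volume := by
  rw [← eLpNorm_congr_ae (fourier_toLp_ae_eq hf hf2), ← eLpNorm_congr_ae hf2.coeFn_toLp,
    ← Lp.enorm_def, ← Lp.enorm_def, ← ofReal_norm, ← ofReal_norm, Lp.norm_fourier_eq]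

/-- Each derivative of `𝓕 η` multiplies `η` by `-2πi` times a coordinate; the squares sum over an
orthonormal basis. Test functions of the form `𝓕 η` are therefore stable under `Δ`. -/
theorem laplacian_fourier_eq (η : 𝓢(V, ℂ)) : Δ (𝓕 η) = -𝓕 (mulNormSq η) := by
  set b := stdOrthonormalBasis ℝ V
  have hg (v : V) : (inner ℝ · v).HasTemperateGrowth :=
    ((innerSL ℝ).flip v).hasTemperateGrowth
  rw [SchwartzMap.laplacian_eq_sum b]
  simp_rw [SchwartzMap.lineDerivOp_fourier_eq]
  have hsum : -mulNormSq η = ∑ i, (-(2 * Real.pi * Complex.I) •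
      SchwartzMap.smulLeftCLM ℂ (inner ℝ · (b i)) (-(2 * Real.pi * Complex.I) •
        SchwartzMap.smulLeftCLM ℂ (inner ℝ · (b i)) η)) := by
    ext ξ
    simp only [neg_apply, mulNormSq_apply, sum_apply,
      smul_apply, SchwartzMap.smulLeftCLM_apply_apply (hg _), Complex.real_smul,
      smul_eq_mul]
    have h := b.sum_sq_inner_left ξ
    have e : ∀ i, -(2 * Real.pi * Complex.I) * ((inner ℝ ξ (b i) : ℝ) * (-(2 * Real.pi * Complex.I) *
        ((inner ℝ ξ (b i) : ℝ) * η ξ))) = -((2 * Real.pi) ^ 2 * η ξ) * ((inner ℝ ξ (b i) : ℝ) ^ 2 : ℝ) := by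
      intro i; push_cast
      linear_combination (2 * Real.pi * (inner ℝ ξ (b i) : ℝ)) ^ 2 * η ξ * Complex.I_sq
    simp_rw [e]
    rw [← Finset.mul_sum, ← Complex.ofReal_sum, h]
    push_cast; ring
  have h2 := congrArg (FourierTransform.fourierCLM ℂ 𝓢(V, ℂ)) hsum
  rw [map_neg, map_sum] at h2
  exact h2.symm

end Fourier

/-! ### Uniqueness for linear hierarchies -/

/-- Uniqueness for an infinite hierarchy of linear equations `d_k' = A₀ d_k + A₁ d_{k+1}` with
vanishing initial values and geometric growth in `k`. -/
theorem hierarchy_eq_zero {E : Type*} [NormedAddCommGroup E] [NormedSpace ℝ E] [CompleteSpace E]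
    (A₀ A₁ : E →L[ℝ] E) {τ K Λ : ℝ} (hΛ : 0 ≤ Λ) (d : ℕ → ℝ → E)
    (hcont : ∀ k, ContinuousOn (d k) (Icc 0 τ))
    (hderiv : ∀ k, ∀ t ∈ Ioo 0 τ, HasDerivAt (d k) (A₀ (d k t) + A₁ (d (k + 1) t)) t)
    (h0 : ∀ k, d k 0 = 0) (hbound : ∀ k, ∀ t ∈ Icc 0 τ, ‖d k t‖ ≤ K * Λ ^ k) :
    ∀ k, ∀ t ∈ Icc 0 τ, d k t = 0 := by
  -- `A₁` is weighted by `Λ` because the bound for level `k + 1` is `Λ` times that for level `k`.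
  -- With this weight each integration of the equation gains `C t / (j + 1)` uniformly in `k`, and
  -- the factorial wins.
  set C := ‖A₀‖ + ‖A₁‖ * Λ with hC
  have hC0 : 0 ≤ C := by positivity
  have key : ∀ j : ℕ, ∀ k, ∀ t ∈ Icc 0 τ,
      ‖d k t‖ ≤ K * Λ ^ k * ((C * t) ^ j / j.factorial) := by
    intro j
    induction j with
    | zero => intro k t ht; simpa using hbound k t ht
    | succ j ih =>
      intro k t ht
      have hsub : Icc 0 t ⊆ Icc 0 τ := Icc_subset_Icc_right ht.2
      have hcd : ContinuousOn (fun x => A₀ (d k x) + A₁ (d (k + 1) x)) (Icc 0 t) :=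
        ((A₀.continuous.comp_continuousOn (hcont k)).add
          (A₁.continuous.comp_continuousOn (hcont (k + 1)))).mono hsub
      have hint : IntervalIntegrable (fun x => A₀ (d k x) + A₁ (d (k + 1) x)) volume 0 t :=
        ContinuousOn.intervalIntegrable (by rwa [uIcc_of_le ht.1])
      have hftc := intervalIntegral.integral_eq_sub_of_hasDerivAt_of_le ht.1
        ((hcont k).mono hsub) (fun x hx => hderiv k x ⟨hx.1, hx.2.trans_le ht.2⟩) hint
      rw [h0, sub_zero] at hftc
      rw [← hftc]
      have hprim (x : ℝ) : HasDerivAt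
          (fun x => K * Λ ^ k * ((C * x) ^ (j + 1) / (j + 1).factorial))
          (K * Λ ^ k * C * ((C * x) ^ j / j.factorial)) x := by
        have h1 : HasDerivAt (fun x : ℝ => C * x) C x := by
          simpa using (hasDerivAt_id x).const_mul C
        refine (((h1.fun_pow (j + 1)).div_const _).const_mul _).congr_deriv ?_
        rw [Nat.factorial_succ]
        push_cast
        field_simp
      have hcb : Continuous fun x => K * Λ ^ k * C * ((C * x) ^ j / j.factorial) := by fun_prop
      calc ‖∫ x in (0 : ℝ)..t, A₀ (d k x) + A₁ (d (k + 1) x)‖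
          ≤ ∫ x in (0 : ℝ)..t, K * Λ ^ k * C * ((C * x) ^ j / j.factorial) := by
            refine intervalIntegral.norm_integral_le_of_norm_le ht.1 (ae_of_all _ fun x hx => ?_)
              (hcb.intervalIntegrable _ _)
            have hx' : x ∈ Icc 0 τ := ⟨hx.1.le, hx.2.trans ht.2⟩
            calc _ ≤ ‖A₀‖ * ‖d k x‖ + ‖A₁‖ * ‖d (k + 1) x‖ :=
                  (norm_add_le _ _).trans (add_le_add (A₀.le_opNorm _) (A₁.le_opNorm _))
              _ ≤ ‖A₀‖ * (K * Λ ^ k * ((C * x) ^ j / j.factorial))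
                  + ‖A₁‖ * (K * Λ ^ (k + 1) * ((C * x) ^ j / j.factorial)) := by
                  gcongr
                  · exact ih k x hx'
                  · exact ih (k + 1) x hx'
              _ = _ := by rw [hC]; ring
        _ = _ := by
            rw [intervalIntegral.integral_eq_sub_of_hasDerivAt (fun x _ => hprim x)
              (hcb.intervalIntegrable _ _)]
            simp
  intro k t ht
  have hlim : Tendsto (fun j : ℕ => K * Λ ^ k * ((C * t) ^ j / j.factorial)) atTop (𝓝 0) := by
    simpa using (FloorSemiring.tendsto_pow_div_factorial_atTop (C * t)).const_mul (K * Λ ^ k)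
  have := ge_of_tendsto' hlim fun j => key j k t ht
  simpa using this

/-! ### The propagator of the mode system -/

/-- State space of the mode system, for `(φ̂, φ̂_t, αγc₀² T̂ + (γ-1) φ̂_t)`. -/
abbrev ModeState : Type := ℂ × ℂ × ℂ

/-- The frequency-independent part of the mode system. -/
noncomputable def modeA₀ : ModeState →L[ℂ] ModeState :=
  ((ContinuousLinearMap.fst ℂ ℂ ℂ).comp (ContinuousLinearMap.snd ℂ ℂ (ℂ × ℂ))).prod 0

/-- The coefficient of the squared frequency in the mode system. -/
noncomputable def modeA₁ (s b m D : ℝ) : ModeState →L[ℂ] ModeState :=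
  let v := ContinuousLinearMap.fst ℂ ℂ (ℂ × ℂ)
  let u := (ContinuousLinearMap.fst ℂ ℂ ℂ).comp (ContinuousLinearMap.snd ℂ ℂ (ℂ × ℂ))
  let z := (ContinuousLinearMap.snd ℂ ℂ ℂ).comp (ContinuousLinearMap.snd ℂ ℂ (ℂ × ℂ))
  ContinuousLinearMap.prod 0
    ((-(s : ℂ) ^ 2 • v - ((b : ℂ) + m * D) • u + (D : ℂ) • z).prod
      (-(D : ℂ) • z + ((m : ℂ) * (D - b)) • u))

theorem modeA₀_apply (x : ModeState) : modeA₀ x = (x.2.1, 0, 0) := rfl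

theorem modeA₁_apply (s b m D : ℝ) (x : ModeState) : modeA₁ s b m D x =
    (0, -s ^ 2 * x.1 - (b + m * D) * x.2.1 + D * x.2.2, -D * x.2.2 + m * (D - b) * x.2.1) := by
  simp [modeA₁]

/-- The propagator of the mode system at squared frequency `q`. -/
noncomputable def modeFlow (s b m D q t : ℝ) : ModeState →L[ℂ] ModeState :=
  NormedSpace.exp (t • (modeA₀ + q • modeA₁ s b m D))

theorem modeFlow_zero (s b m D q : ℝ) : modeFlow s b m D q 0 = 1 := by
  have h : (0 : ℝ) • (modeA₀ + q • modeA₁ s b m D) = 0 := by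
    ext <;> simp
  rw [modeFlow, h, NormedSpace.exp_zero]

theorem hasDerivAt_modeFlow (s b m D q t : ℝ) (x : ModeState) :
    HasDerivAt (fun t => modeFlow s b m D q t x)
      (modeA₀ (modeFlow s b m D q t x) + q • modeA₁ s b m D (modeFlow s b m D q t x)) t := by
  have h := hasDerivAt_exp_smul_const' (𝕂 := ℝ) (modeA₀ + q • modeA₁ s b m D) t
  have h2 := ((ContinuousLinearMap.apply ℂ ModeState x).restrictScalars ℝ).hasFDerivAt.comp_hasDerivAt t h
  exact h2

theorem norm_exp_le_exp_norm {𝔸 : Type*} [NormedRing 𝔸] [NormedAlgebra ℝ 𝔸] [CompleteSpace 𝔸]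
    [NormOneClass 𝔸] (x : 𝔸) : ‖NormedSpace.exp x‖ ≤ Real.exp ‖x‖ := by
  have h1 := NormedSpace.exp_series_hasSum_exp' (𝕂 := ℝ) x
  have h2 := NormedSpace.exp_series_hasSum_exp' (𝕂 := ℝ) ‖x‖
  rw [← h1.tsum_eq, Real.exp_eq_exp_ℝ]
  refine tsum_of_norm_bounded h2 fun n => ?_
  rw [norm_smul, smul_eq_mul, Real.norm_of_nonneg (by positivity)]
  gcongr
  exact norm_pow_le x n

theorem norm_modeFlow_le (s b m D q : ℝ) {t τ : ℝ} (ht : |t| ≤ τ) :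
    ‖modeFlow s b m D q t‖ ≤ Real.exp (τ * (‖modeA₀‖ + |q| * ‖modeA₁ s b m D‖)) := by
  refine (norm_exp_le_exp_norm _).trans (Real.exp_le_exp.2 ?_)
  rw [norm_smul, Real.norm_eq_abs]
  have : 0 ≤ τ := (abs_nonneg t).trans ht
  gcongr
  refine (norm_add_le _ _).trans ?_
  rw [norm_smul, Real.norm_eq_abs]

theorem continuous_modeFlow (s b m D t : ℝ) : Continuous fun q => modeFlow s b m D q t := by
  let _ := NormedAlgebra.restrictScalars ℚ ℂ (ModeState →L[ℂ] ModeState)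
  unfold modeFlow
  exact NormedSpace.exp_continuous.comp (by fun_prop)

theorem isModeSolution_modeFlow (s b m D q : ℝ) (x : ModeState) :
    IsModeSolution s b m D q (fun t => (modeFlow s b m D q t x).1)
      (fun t => (modeFlow s b m D q t x).2.1) (fun t => (modeFlow s b m D q t x).2.2) := by
  have h := fun t => hasDerivAt_modeFlow s b m D q t x
  refine ⟨fun t => ?_, fun t => ?_, fun t => ?_⟩
  · have h1 := (ContinuousLinearMap.fst ℝ ℂ (ℂ × ℂ)).hasFDerivAt.comp_hasDerivAt t (h t)
    exact h1.congr_deriv (by simp [modeA₀_apply, modeA₁_apply])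
  · have h1 := ((ContinuousLinearMap.fst ℝ ℂ ℂ).comp
      (ContinuousLinearMap.snd ℝ ℂ (ℂ × ℂ))).hasFDerivAt.comp_hasDerivAt t (h t)
    exact h1.congr_deriv (by simp [modeA₀_apply, modeA₁_apply]; ring)
  · have h1 := ((ContinuousLinearMap.snd ℝ ℂ ℂ).comp
      (ContinuousLinearMap.snd ℝ ℂ (ℂ × ℂ))).hasFDerivAt.comp_hasDerivAt t (h t)
    exact h1.congr_deriv (by simp [modeA₀_apply, modeA₁_apply]; ring)

/-! ### Testing the propagator against compactly supported functions -/

section Multiplier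

variable {V : Type*} [NormedAddCommGroup V] [InnerProductSpace ℝ V]

theorem iterate_mulNormSq_apply (η : 𝓢(V, ℂ)) (k : ℕ) (ξ : V) :
    mulNormSq^[k] η ξ = (((2 * Real.pi * ‖ξ‖) ^ 2) ^ k : ℝ) * η ξ := by
  induction k with
  | zero => simp
  | succ k ih => rw [Function.iterate_succ_apply', mulNormSq_apply, ih]; push_cast; ring

theorem hasCompactSupport_iterate_mulNormSq {η : 𝓢(V, ℂ)} (hη : HasCompactSupport η) (k : ℕ) :
    HasCompactSupport (mulNormSq^[k] η) := by
  have : (mulNormSq^[k] η : V → ℂ) = fun ξ => (((2 * Real.pi * ‖ξ‖) ^ 2) ^ k : ℝ) * η ξ :=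
    funext (iterate_mulNormSq_apply η k)
  rw [this]
  exact hη.mul_left

/-- On the support of `η` the multiplier is at most `(2πR)²`. This is what compact support is for:
it supplies the geometric growth required by `hierarchy_eq_zero`. -/
theorem exists_norm_iterate_mulNormSq_le {η : 𝓢(V, ℂ)} (hη : HasCompactSupport η) :
    ∃ Λ : ℝ, 0 ≤ Λ ∧ ∀ k ξ, ‖mulNormSq^[k] η ξ‖ ≤ Λ ^ k * ‖η ξ‖ := by
  obtain ⟨R, hR⟩ := hη.isCompact.isBounded.subset_closedBall 0
  refine ⟨(2 * Real.pi * R) ^ 2, by positivity, fun k ξ => ?_⟩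
  rw [iterate_mulNormSq_apply, norm_mul, Complex.norm_real, Real.norm_of_nonneg (by positivity)]
  by_cases h : η ξ = 0
  · simp [h]
  · have h1 : ‖ξ‖ ≤ R := by simpa using hR (subset_tsupport _ h)
    gcongr

variable {s b m D : ℝ} {x₀ : V → ModeState}

theorem continuous_mul_modeFlow (hx₀ : Continuous x₀) (η : 𝓢(V, ℂ)) (t : ℝ) :
    Continuous fun ξ => η ξ • modeFlow s b m D ((2 * Real.pi * ‖ξ‖) ^ 2) t (x₀ ξ) := by
  refine η.continuous.smul (((continuous_modeFlow s b m D t).comp ?_).clm_apply hx₀)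
  fun_prop

end Multiplier

section Pairing

variable {V : Type*} [NormedAddCommGroup V] [InnerProductSpace ℝ V] [FiniteDimensional ℝ V]
  [MeasurableSpace V] [BorelSpace V]

/-- The pairing with a Schwartz function as a bounded functional on `L²`. -/
noncomputable def schwartzPairing (η : 𝓢(V, ℂ)) : Lp ℂ 2 (volume : Measure V) →L[ℂ] ℂ :=
  innerSL ℂ (star (η.toLp 2 volume))

theorem schwartzPairing_apply (η : 𝓢(V, ℂ)) (f : Lp ℂ 2 (volume : Measure V)) :
    schwartzPairing η f = ∫ x, η x * f x := by
  rw [schwartzPairing, innerSL_apply_apply, L2.inner_def]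
  refine integral_congr_ae ?_
  filter_upwards [Lp.coeFn_star (η.toLp 2 volume), η.coeFn_toLp 2 volume] with x h1 h2
  rw [h1, Pi.star_apply, h2]
  simp [mul_comm]

theorem norm_schwartzPairing_le (η : 𝓢(V, ℂ)) (f : Lp ℂ 2 (volume : Measure V)) :
    ‖schwartzPairing η f‖ ≤ ‖η.toLp 2 volume‖ * ‖f‖ := by
  rw [schwartzPairing, innerSL_apply_apply]
  refine (norm_inner_le_norm _ _).trans ?_
  have h : ‖star (η.toLp 2 volume)‖ = ‖η.toLp 2 volume‖ := by
    refine le_antisymm (Lp.norm_le_norm_of_ae_le ?_) (Lp.norm_le_norm_of_ae_le ?_) <;>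
    · filter_upwards [Lp.coeFn_star (η.toLp 2 volume)] with x hx
      rw [hx, Pi.star_apply, norm_star]
  rw [h]

theorem norm_toLp_iterate_mulNormSq_le {η : 𝓢(V, ℂ)} {Λ : ℝ}
    (h : ∀ k ξ, ‖mulNormSq^[k] η ξ‖ ≤ Λ ^ k * ‖η ξ‖) (k : ℕ) :
    ‖(mulNormSq^[k] η).toLp 2 volume‖ ≤ Λ ^ k * ‖η.toLp 2 volume‖ := by
  refine Lp.norm_le_mul_norm_of_ae_le_mul ?_
  filter_upwards [(mulNormSq^[k] η).coeFn_toLp 2 volume, η.coeFn_toLp 2 volume] with x h1 h2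
  rw [h1, h2]; exact h k x

variable {s b m D : ℝ} {x₀ : V → ModeState}

theorem integrable_mul_modeFlow (hx₀ : Continuous x₀) {η : 𝓢(V, ℂ)} (hη : HasCompactSupport η)
    (t : ℝ) :
    Integrable fun ξ => η ξ • modeFlow s b m D ((2 * Real.pi * ‖ξ‖) ^ 2) t (x₀ ξ) :=
  (continuous_mul_modeFlow hx₀ η t).integrable_of_hasCompactSupport hη.smul_right

/-- The factor `q` of the mode system is moved onto the test function, so the explicit flow obeys
the same hierarchy as the weak solution. Compact support of `η` provides the dominating function. -/
theorem hasDerivAt_integral_mul_modeFlow (hx₀ : Continuous x₀) {η : 𝓢(V, ℂ)}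
    (hη : HasCompactSupport η) (t : ℝ) :
    HasDerivAt (fun t => ∫ ξ, η ξ • modeFlow s b m D ((2 * Real.pi * ‖ξ‖) ^ 2) t (x₀ ξ))
      (modeA₀ (∫ ξ, η ξ • modeFlow s b m D ((2 * Real.pi * ‖ξ‖) ^ 2) t (x₀ ξ))
        + modeA₁ s b m D
          (∫ ξ, mulNormSq η ξ • modeFlow s b m D ((2 * Real.pi * ‖ξ‖) ^ 2) t (x₀ ξ))) t := by
  have hη' : HasCompactSupport (mulNormSq η) := hasCompactSupport_iterate_mulNormSq hη 1
  set X : ℝ → V → ModeState := fun t ξ => modeFlow s b m D ((2 * Real.pi * ‖ξ‖) ^ 2) t (x₀ ξ) with hX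
  set F' : ℝ → V → ModeState := fun t ξ =>
    modeA₀ (η ξ • X t ξ) + modeA₁ s b m D (mulNormSq η ξ • X t ξ) with hF'
  have hF'c (t : ℝ) : Continuous (F' t) :=
    (modeA₀.continuous.comp (continuous_mul_modeFlow hx₀ η t)).add
      ((modeA₁ s b m D).continuous.comp (continuous_mul_modeFlow hx₀ (mulNormSq η) t))
  set N : V → ℝ := fun ξ => ‖modeA₀‖ + |(2 * Real.pi * ‖ξ‖) ^ 2| * ‖modeA₁ s b m D‖ with hN
  have hNc : Continuous N := by fun_prop
  set bound : V → ℝ := fun ξ => ‖η ξ‖ * (N ξ * (Real.exp ((|t| + 1) * N ξ) * ‖x₀ ξ‖)) with hbound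
  have hbc : Continuous bound := by
    have := η.continuous
    fun_prop
  have hbi : Integrable bound :=
    hbc.integrable_of_hasCompactSupport (hη.norm.mul_right)
  have key := hasDerivAt_integral_of_dominated_loc_of_deriv_le (μ := (volume : Measure V))
    (F := fun t ξ => η ξ • X t ξ) (F' := F') (x₀ := t) (s := Metric.ball t 1) (bound := bound)
    (Metric.ball_mem_nhds t one_pos)
    (Eventually.of_forall fun t => (continuous_mul_modeFlow hx₀ η t).aestronglyMeasurable)
    (integrable_mul_modeFlow hx₀ hη t) (hF'c t).aestronglyMeasurable
    (ae_of_all _ fun ξ y hy => ?_) hbi (ae_of_all _ fun ξ y _ => ?_)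
  · refine key.2.congr_deriv ?_
    simp only [hF']
    rw [integral_add (modeA₀.integrable_comp (integrable_mul_modeFlow hx₀ hη t))
      ((modeA₁ s b m D).integrable_comp (integrable_mul_modeFlow hx₀ hη' t)),
      modeA₀.integral_comp_comm (integrable_mul_modeFlow hx₀ hη t),
      (modeA₁ s b m D).integral_comp_comm (integrable_mul_modeFlow hx₀ hη' t)]
  · have hy' : |y| ≤ |t| + 1 := by
      have h1 : |y - t| < 1 := by simpa [Real.dist_eq] using hy
      have h2 := abs_sub_abs_le_abs_sub y t
      linarith
    have hXn : ‖X y ξ‖ ≤ Real.exp ((|t| + 1) * N ξ) * ‖x₀ ξ‖ :=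
      ((modeFlow s b m D _ y).le_opNorm _).trans (by gcongr; exact norm_modeFlow_le _ _ _ _ _ hy')
    have h1 : ‖F' y ξ‖ ≤ ‖modeA₀‖ * (‖η ξ‖ * ‖X y ξ‖)
        + ‖modeA₁ s b m D‖ * (|(2 * Real.pi * ‖ξ‖) ^ 2| * ‖η ξ‖ * ‖X y ξ‖) := by
      refine (norm_add_le _ _).trans (add_le_add ?_ ?_)
      · exact (modeA₀.le_opNorm _).trans (by rw [norm_smul])
      · refine ((modeA₁ s b m D).le_opNorm _).trans ?_
        rw [norm_smul, mulNormSq_apply, norm_mul, Complex.norm_real, Real.norm_eq_abs]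
    calc ‖F' y ξ‖ ≤ _ := h1
      _ = ‖η ξ‖ * (N ξ * ‖X y ξ‖) := by rw [hN]; ring
      _ ≤ bound ξ := by simp only [hbound]; gcongr
  · have h1 := (hasDerivAt_modeFlow s b m D ((2 * Real.pi * ‖ξ‖) ^ 2) y (x₀ ξ)).const_smul (η ξ)
    refine h1.congr_deriv ?_
    simp only [hF', hX, map_smul, mulNormSq_apply, smul_add, mul_smul, Complex.coe_smul]
    rw [ContinuousLinearMap.map_smul_of_tower, map_smul, smul_comm]

theorem exists_norm_integral_mul_modeFlow_le (hx₀ : Continuous x₀) {η : 𝓢(V, ℂ)}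
    (hη : HasCompactSupport η) {Λ : ℝ} (hΛ : ∀ k ξ, ‖mulNormSq^[k] η ξ‖ ≤ Λ ^ k * ‖η ξ‖) (τ : ℝ) :
    ∃ K : ℝ, ∀ k, ∀ t ∈ Icc 0 τ,
      ‖∫ ξ, mulNormSq^[k] η ξ • modeFlow s b m D ((2 * Real.pi * ‖ξ‖) ^ 2) t (x₀ ξ)‖ ≤
        K * Λ ^ k := by
  set N : V → ℝ := fun ξ => ‖modeA₀‖ + |(2 * Real.pi * ‖ξ‖) ^ 2| * ‖modeA₁ s b m D‖ with hN
  have hNc : Continuous N := by fun_prop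
  set g : V → ℝ := fun ξ => ‖η ξ‖ * (Real.exp (τ * N ξ) * ‖x₀ ξ‖) with hg
  have hgc : Continuous g := by
    have := η.continuous
    fun_prop
  have hgi : Integrable g := hgc.integrable_of_hasCompactSupport (hη.norm.mul_right)
  refine ⟨∫ ξ, g ξ, fun k t ht => ?_⟩
  rw [mul_comm _ (Λ ^ k), ← integral_const_mul]
  refine norm_integral_le_of_norm_le (hgi.const_mul _) (ae_of_all _ fun ξ => ?_)
  have hXn : ‖modeFlow s b m D ((2 * Real.pi * ‖ξ‖) ^ 2) t (x₀ ξ)‖ ≤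
      Real.exp (τ * N ξ) * ‖x₀ ξ‖ :=
    ((modeFlow s b m D _ t).le_opNorm _).trans (by
      gcongr; exact norm_modeFlow_le _ _ _ _ _ (by rw [abs_of_nonneg ht.1]; exact ht.2))
  rw [norm_smul]
  calc _ ≤ Λ ^ k * ‖η ξ‖ * (Real.exp (τ * N ξ) * ‖x₀ ξ‖) :=
        mul_le_mul (hΛ k ξ) hXn (norm_nonneg _) ((norm_nonneg _).trans (hΛ k ξ))
    _ = _ := by rw [hg]; ring

end Pairing

/-! ### The Fourier transform of a weak solution -/

variable {n : ℕ}

/-- The Fourier transform of the complexification of a real `L²` function. -/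
noncomputable def fourierLp (f : Lp ℝ 2 (volume : Measure (Sp n))) :
    Lp ℂ 2 (volume : Measure (Sp n)) :=
  𝓕 (Complex.ofRealCLM.compLpL 2 volume f)

theorem continuous_fourierLp : Continuous (fourierLp (n := n)) :=
  ContinuousFourier.continuous_fourier.comp
    (Complex.ofRealCLM.compLpL 2 (volume : Measure (Sp n))).continuous

/-- The Fourier transform of a real function. -/
noncomputable def realFourier (f : Sp n → ℝ) : Sp n → ℂ := 𝓕 fun x => (f x : ℂ)

theorem continuous_realFourier {f : Sp n → ℝ} (hf : Integrable f) : Continuous (realFourier f) :=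
  continuous_fourier_of_integrable hf.ofReal

theorem pair_fourier_Lp (f : Lp ℝ 2 (volume : Measure (Sp n))) (η : 𝓢(Sp n, ℂ)) :
    pair f (𝓕 η) = schwartzPairing η (fourierLp f) := by
  rw [schwartzPairing_apply, fourierLp, integral_fourier_Lp_mul, pair]
  refine integral_congr_ae ?_
  filter_upwards [Complex.ofRealCLM.coeFn_compLpL (p := 2) f] with x hx
  rw [hx, mul_comm]; rfl

theorem pair_fourier {f : Sp n → ℝ} (hf : Integrable f) (η : 𝓢(Sp n, ℂ)) :
    pair f (𝓕 η) = ∫ ξ, η ξ * realFourier f ξ := by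
  rw [realFourier, integral_mul_fourier (f := fun x => (f x : ℂ)) hf.ofReal η.integrable, pair]
  simp_rw [mul_comm, SchwartzMap.fourier_coe]

theorem pair_neg (f : Sp n → ℝ) (θ : 𝓢(Sp n, ℂ)) : pair f (-θ) = -pair f θ := by
  simp [pair, integral_neg]

/-- Initial state of the mode system. -/
noncomputable def initState (p : Params) (φ₀ φ₁ T₀ : Sp n → ℝ) (ξ : Sp n) : ModeState :=
  (realFourier φ₀ ξ, realFourier φ₁ ξ,
    (p.αp * p.speed ^ 2 : ℝ) * realFourier T₀ ξ + (p.γ - 1 : ℝ) * realFourier φ₁ ξ)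

/-- The state of the Fourier mode `ξ` at time `t`. -/
noncomputable def modeState (p : Params) (φ₀ φ₁ T₀ : Sp n → ℝ) (t : ℝ) (ξ : Sp n) : ModeState :=
  modeFlow p.speed ((1 + p.β) * p.ν₀) (p.γ - 1) p.Dth ((2 * Real.pi * ‖ξ‖) ^ 2) t
    (initState p φ₀ φ₁ T₀ ξ)

theorem Params.speed_pos (p : Params) : 0 < p.speed :=
  mul_pos (Real.sqrt_pos.2 (one_pos.trans p.γ_gt)) p.c₀_pos

theorem Params.speed_sq (p : Params) : p.speed ^ 2 = p.γ * p.c₀ ^ 2 := by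
  rw [Params.speed, mul_pow, Real.sq_sqrt (one_pos.trans p.γ_gt).le]

theorem continuous_initState (p : Params) {φ₀ φ₁ T₀ : Sp n → ℝ} (h₀ : Integrable φ₀)
    (h₁ : Integrable φ₁) (hT : Integrable T₀) : Continuous (initState p φ₀ φ₁ T₀) := by
  have := continuous_realFourier h₀
  have := continuous_realFourier h₁
  have := continuous_realFourier hT
  unfold initState
  fun_prop

section WeakSolution

variable {p : Params} {φ₀ φ₁ T₀ : Sp n → ℝ} {φ T : ℝ → Lp ℝ 2 (volume : Measure (Sp n))}

theorem continuousOn_pair_fourier {f : ℝ → Lp ℝ 2 (volume : Measure (Sp n))} {s : Set ℝ}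
    (hf : ContinuousOn f s) (η : 𝓢(Sp n, ℂ)) : ContinuousOn (fun t => pair (f t) (𝓕 η)) s := by
  simp_rw [pair_fourier_Lp]
  exact ((schwartzPairing η).continuous.comp continuous_fourierLp).comp_continuousOn hf

theorem exists_norm_pair_fourier_le {f : ℝ → Lp ℝ 2 (volume : Measure (Sp n))} {τ : ℝ}
    (hf : ContinuousOn f (Icc 0 τ)) {η : 𝓢(Sp n, ℂ)} {Λ : ℝ}
    (hΛ0 : 0 ≤ Λ) (hΛ : ∀ k ξ, ‖mulNormSq^[k] η ξ‖ ≤ Λ ^ k * ‖η ξ‖) :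
    ∃ K : ℝ, 0 ≤ K ∧ ∀ k, ∀ t ∈ Icc 0 τ, ‖pair (f t) (𝓕 (mulNormSq^[k] η))‖ ≤ K * Λ ^ k := by
  obtain ⟨B, hB⟩ := isCompact_Icc.exists_bound_of_continuousOn
    (continuous_fourierLp.comp_continuousOn hf)
  refine ⟨‖η.toLp 2 volume‖ * max B 0, by positivity, fun k t ht => ?_⟩
  rw [pair_fourier_Lp]
  have h1 : ‖fourierLp (f t)‖ ≤ max B 0 := (hB t ht).trans (le_max_left _ _)
  calc _ ≤ _ := norm_schwartzPairing_le _ _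
    _ ≤ Λ ^ k * ‖η.toLp 2 volume‖ * max B 0 := by
        gcongr
        exact norm_toLp_iterate_mulNormSq_le hΛ k
    _ = _ := by ring

theorem exists_norm_integral_mul_fourier_le {f : Sp n → ℝ} (hf : Integrable f) {η : 𝓢(Sp n, ℂ)}
    (hη : HasCompactSupport η) {Λ : ℝ} (hΛ : ∀ k ξ, ‖mulNormSq^[k] η ξ‖ ≤ Λ ^ k * ‖η ξ‖) :
    ∃ K : ℝ, 0 ≤ K ∧ ∀ k, ‖pair f (𝓕 (mulNormSq^[k] η))‖ ≤ K * Λ ^ k := by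
  have hc : Continuous fun ξ => ‖η ξ‖ * ‖realFourier f ξ‖ :=
    η.continuous.norm.mul (continuous_realFourier hf).norm
  refine ⟨∫ ξ, ‖η ξ‖ * ‖realFourier f ξ‖, by positivity, fun k => ?_⟩
  rw [pair_fourier hf, mul_comm _ (Λ ^ k), ← integral_const_mul]
  refine norm_integral_le_of_norm_le
    ((hc.integrable_of_hasCompactSupport hη.norm.mul_right).const_mul _) (ae_of_all _ fun ξ => ?_)
  rw [norm_mul, ← mul_assoc]
  gcongr
  exact hΛ k ξ

theorem integral_mul_initState (p : Params) (h₀ : Integrable φ₀)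
    (h₁ : Integrable φ₁) (hT : Integrable T₀) {η : 𝓢(Sp n, ℂ)} (hη : HasCompactSupport η) :
    ∫ ξ, η ξ • initState p φ₀ φ₁ T₀ ξ = (pair φ₀ (𝓕 η), pair φ₁ (𝓕 η),
      (p.αp * p.speed ^ 2 : ℝ) * pair T₀ (𝓕 η) + (p.γ - 1 : ℝ) * pair φ₁ (𝓕 η)) := by
  have hint {f : Sp n → ℝ} (hf : Integrable f) : Integrable fun ξ => η ξ * realFourier f ξ :=
    (η.continuous.mul (continuous_realFourier hf)).integrable_of_hasCompactSupport hη.mul_right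
  have hx : Integrable fun ξ => η ξ • initState p φ₀ φ₁ T₀ ξ :=
    (η.continuous.smul (continuous_initState p h₀ h₁ hT)).integrable_of_hasCompactSupport
      hη.smul_right
  rw [pair_fourier h₀, pair_fourier h₁, pair_fourier hT]
  refine Prod.ext ?_ (Prod.ext ?_ ?_)
  · rw [fst_integral hx]; rfl
  · rw [snd_integral hx, fst_integral hx.snd]; rfl
  · rw [snd_integral hx, snd_integral hx.snd]
    simp only [initState, Prod.smul_snd, smul_eq_mul]
    rw [← integral_const_mul, ← integral_const_mul,
      ← integral_add ((hint hT).const_mul _) ((hint h₁).const_mul _)]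
    congr 1 with ξ
    ring

/-- The Fourier transform of a weak solution solves the mode system at almost every frequency. -/
theorem IsWeakSolution.pair_fourier_eq (h : IsWeakSolution p φ₀ φ₁ T₀ φ T) (h₀ : Integrable φ₀)
    (h₁ : Integrable φ₁) (hT : Integrable T₀) {η : 𝓢(Sp n, ℂ)} (hη : HasCompactSupport η)
    {τ : ℝ} (hτ : 0 ≤ τ) :
    pair (φ τ) (𝓕 η) = ∫ ξ, η ξ * (modeState p φ₀ φ₁ T₀ τ ξ).1 := by
  obtain ⟨φt, φtt, Tt, hc, hi, heq⟩ := h.equations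
  have hx₀ := continuous_initState p h₀ h₁ hT
  set b := (1 + p.β) * p.ν₀ with hb
  set m := p.γ - 1 with hm
  set θ : ℕ → 𝓢(Sp n, ℂ) := fun k => 𝓕 (mulNormSq^[k] η) with hθ
  have hΔ (k : ℕ) : Δ (θ k) = -θ (k + 1) := by
    simp only [hθ]; rw [laplacian_fourier_eq, Function.iterate_succ_apply']
  -- Linearity of `φt` in the test function is not part of the definition; oddness is recovered by
  -- uniqueness of the derivative of the linear pairing.
  have hφtneg (t : ℝ) (ht : 0 < t) (k : ℕ) : φt t (-θ k) = -φt t (θ k) := by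
    have e1 := (heq (-θ k) t ht).1
    simp_rw [pair_neg] at e1
    exact e1.unique (heq (θ k) t ht).1.neg
  have hα : (p.αp : ℂ) ≠ 0 := by exact_mod_cast p.αp_pos.ne'
  have hs : (p.speed : ℂ) ^ 2 = p.γ * p.c₀ ^ 2 := by exact_mod_cast p.speed_sq
  -- The third entry is `z` after testing; its weights make the pairing of `φ` drop out of its
  -- derivative.
  set W : ℕ → ℝ → ModeState := fun k t => (pair (φ t) (θ k), φt t (θ k),
    (p.αp * p.speed ^ 2 : ℝ) * pair (T t) (θ k) + (m : ℝ) * φt t (θ k)) with hW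
  set Y : ℕ → ℝ → ModeState := fun k t =>
    ∫ ξ, mulNormSq^[k] η ξ • modeState p φ₀ φ₁ T₀ t ξ with hY
  have hWd (k : ℕ) (t : ℝ) (ht : 0 < t) : HasDerivAt (W k)
      (modeA₀ (W k t) + modeA₁ p.speed b m p.Dth (W (k + 1) t)) t := by
    obtain ⟨e1, e2, e3, e4, e5⟩ := heq (θ k) t ht
    rw [hΔ, hφtneg t ht, pair_neg] at e4
    rw [hΔ, pair_neg, pair_neg] at e5
    refine (e1.prodMk (e2.prodMk ((e3.const_mul _).add (e2.const_mul _)))).congr_deriv ?_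
    have f5 : Tt t (θ k) = -(p.γ * p.Dth * pair (T t) (θ (k + 1)))
        + m / p.αp * pair (φ t) (θ (k + 1)) := by
      rw [hm]; push_cast; linear_combination e5
    have f4 : φtt t (θ k) = -p.speed ^ 2 * pair (φ t) (θ (k + 1)) - b * φt t (θ (k + 1))
        + p.Dth * (p.αp * p.speed ^ 2) * pair (T t) (θ (k + 1)) := by
      rw [f5, hm] at e4
      rw [hs, hb]; push_cast at e4 ⊢
      field_simp at e4
      linear_combination e4
    rw [modeA₀_apply, modeA₁_apply]
    refine Prod.ext ?_ (Prod.ext ?_ ?_)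
    · simp [hW]
    · simp only [hW, Prod.snd_add, Prod.fst_add]
      rw [f4]; push_cast; ring
    · simp only [hW, Prod.snd_add]
      rw [f4, f5]
      have hγ : (p.γ : ℂ) = m + 1 := by rw [hm]; push_cast; ring
      rw [hγ]; push_cast
      field_simp
      ring
  have hYd (k : ℕ) (t : ℝ) : HasDerivAt (Y k)
      (modeA₀ (Y k t) + modeA₁ p.speed b m p.Dth (Y (k + 1) t)) t := by
    have := hasDerivAt_integral_mul_modeFlow (s := p.speed) (b := b) (m := m) (D := p.Dth) hx₀
      (hasCompactSupport_iterate_mulNormSq hη k) t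
    rw [← Function.iterate_succ_apply' (f := mulNormSq)] at this
    exact this
  have hcφ (k : ℕ) : ContinuousOn (fun t => pair (φ t) (θ k)) (Ici 0) :=
    continuousOn_pair_fourier h.continuousOn_φ _
  have hcT (k : ℕ) : ContinuousOn (fun t => pair (T t) (θ k)) (Ici 0) :=
    continuousOn_pair_fourier h.continuousOn_T _
  have hWc (k : ℕ) : ContinuousOn (W k) (Ici 0) :=
    (hcφ k).prodMk ((hc _).prodMk ((continuousOn_const.mul (hcT k)).add
      (continuousOn_const.mul (hc _))))
  have hφ00 (k : ℕ) : pair (φ 0) (θ k) = pair φ₀ (θ k) := by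
    refine integral_congr_ae ?_
    filter_upwards [h.init_φ] with x hx
    rw [hx]
  have hT00 (k : ℕ) : pair (T 0) (θ k) = pair T₀ (θ k) := by
    refine integral_congr_ae ?_
    filter_upwards [h.init_T] with x hx
    rw [hx]
  have hWY0 (k : ℕ) : W k 0 = Y k 0 := by
    simp only [hW, hY, modeState, modeFlow_zero, one_apply_eq_self]
    rw [integral_mul_initState p h₀ h₁ hT (hasCompactSupport_iterate_mulNormSq hη k), hφ00, hT00, hi]
  obtain ⟨Λ, hΛ0, hΛ⟩ := exists_norm_iterate_mulNormSq_le hη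
  have hsub : Icc 0 τ ⊆ Ici 0 := Icc_subset_Ici_self
  obtain ⟨K₁, hK₁0, hK₁⟩ := exists_norm_pair_fourier_le (h.continuousOn_φ.mono hsub) hΛ0 hΛ
  obtain ⟨K₂, hK₂0, hK₂⟩ := exists_norm_pair_fourier_le (h.continuousOn_T.mono hsub) hΛ0 hΛ
  obtain ⟨K₃, hK₃0, hK₃⟩ := exists_norm_integral_mul_fourier_le h₁ hη hΛ
  obtain ⟨K₄, hK₄⟩ := exists_norm_integral_mul_modeFlow_le (s := p.speed) (b := b) (m := m)
    (D := p.Dth) hx₀ hη hΛ τ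
  change ∀ k, ∀ t ∈ Icc 0 τ, ‖pair (φ t) (θ k)‖ ≤ K₁ * Λ ^ k at hK₁
  change ∀ k, ∀ t ∈ Icc 0 τ, ‖pair (T t) (θ k)‖ ≤ K₂ * Λ ^ k at hK₂
  change ∀ k, ‖pair φ₁ (θ k)‖ ≤ K₃ * Λ ^ k at hK₃
  change ∀ k, ∀ t ∈ Icc 0 τ, ‖Y k t‖ ≤ K₄ * Λ ^ k at hK₄
  set κ := |b| * Λ * K₁ + p.αp * p.c₀ ^ 2 * K₂ with hκ
  set K₅ := K₃ + 2 * κ + p.c₀ ^ 2 * Λ * K₁ * τ with hK₅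
  have hαp := p.αp_pos
  have hφtb (k : ℕ) (t : ℝ) (ht : t ∈ Icc 0 τ) : ‖φt t (θ k)‖ ≤ K₅ * Λ ^ k := by
    -- No bound on `φt` in terms of the test function is given a priori. By the first equation `φt +
    -- L` has derivative `-c₀² ⟨φ, θ (k+1)⟩`; both `L` and this derivative involve only `φ` and `T`,
    -- which are bounded in `L²` on `[0, τ]`. Integration from zero bounds `φt`.
    set L : ℝ → ℂ := fun t => b * pair (φ t) (θ (k + 1)) + p.αp * p.c₀ ^ 2 * pair (T t) (θ k) with hL
    have hLb (t : ℝ) (ht : t ∈ Icc 0 τ) : ‖L t‖ ≤ κ * Λ ^ k := by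
      refine (norm_add_le _ _).trans ?_
      rw [norm_mul, norm_mul, norm_mul, norm_pow, Complex.norm_real, Complex.norm_real,
        Complex.norm_real, Real.norm_eq_abs, Real.norm_of_nonneg hαp.le,
        Real.norm_of_nonneg p.c₀_pos.le]
      calc _ ≤ |b| * (K₁ * Λ ^ (k + 1)) + p.αp * p.c₀ ^ 2 * (K₂ * Λ ^ k) := by
            gcongr
            · exact hK₁ _ t ht
            · exact hK₂ _ t ht
        _ = _ := by rw [hκ]; ring
    have hsubt : Icc 0 t ⊆ Ici 0 := Icc_subset_Ici_self
    have hLc : ContinuousOn L (Ici 0) := (continuousOn_const.mul (hcφ (k + 1))).add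
      (continuousOn_const.mul (hcT k))
    have hftc := intervalIntegral.integral_eq_sub_of_hasDerivAt_of_le ht.1
      (f := fun t => φt t (θ k) + L t) (f' := fun t => -p.c₀ ^ 2 * pair (φ t) (θ (k + 1)))
      (((hc _).add hLc).mono hsubt) (fun x hx => by
        obtain ⟨e1, e2, e3, e4, e5⟩ := heq (θ k) x hx.1
        rw [hΔ, hφtneg x hx.1, pair_neg] at e4
        refine (e2.add (((heq (θ (k + 1)) x hx.1).1.const_mul _).add
          (e3.const_mul _))).congr_deriv ?_
        rw [hb]; push_cast
        linear_combination e4)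
      (((continuousOn_const.mul (hcφ (k + 1))).mono (by
        rw [uIcc_of_le ht.1]; exact hsubt)).intervalIntegrable)
    have hInt : ‖∫ x in (0 : ℝ)..t, -p.c₀ ^ 2 * pair (φ x) (θ (k + 1))‖ ≤
        p.c₀ ^ 2 * (K₁ * Λ ^ (k + 1)) * |t - 0| := by
      refine intervalIntegral.norm_integral_le_of_norm_le_const fun x hx => ?_
      rw [uIoc_of_le ht.1] at hx
      rw [norm_mul, norm_neg, norm_pow, Complex.norm_real, Real.norm_of_nonneg p.c₀_pos.le]
      gcongr
      exact hK₁ _ x ⟨hx.1.le, hx.2.trans ht.2⟩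
    rw [hftc, sub_zero, abs_of_nonneg ht.1] at hInt
    have e : φt t (θ k) = (φt t (θ k) + L t - (φt 0 (θ k) + L 0)) + (pair φ₁ (θ k) + L 0 - L t) := by
      rw [hi]; ring
    rw [e]
    have i1 := hLb t ht
    have i2 := hLb 0 ⟨le_rfl, hτ⟩
    have i3 := hK₃ k
    calc _ ≤ p.c₀ ^ 2 * (K₁ * Λ ^ (k + 1)) * t + (K₃ * Λ ^ k + κ * Λ ^ k + κ * Λ ^ k) := by
          refine (norm_add_le _ _).trans (add_le_add hInt ?_)
          exact (norm_sub_le _ _).trans (add_le_add ((norm_add_le _ _).trans (add_le_add i3 i2)) i1)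
      _ ≤ p.c₀ ^ 2 * (K₁ * Λ ^ (k + 1)) * τ + (K₃ * Λ ^ k + κ * Λ ^ k + κ * Λ ^ k) := by
          gcongr; exact ht.2
      _ = _ := by rw [hK₅]; ring
  set K₆ := p.αp * p.speed ^ 2 * K₂ + |m| * K₅ with hK₆
  have hK₅0 : 0 ≤ K₅ := by positivity
  have hWb (k : ℕ) (t : ℝ) (ht : t ∈ Icc 0 τ) : ‖W k t‖ ≤ (K₁ + K₅ + K₆) * Λ ^ k := by
    have j1 := hK₁ k t ht
    have j2 := hφtb k t ht
    have j3 : ‖(p.αp * p.speed ^ 2 : ℝ) * pair (T t) (θ k) + (m : ℝ) * φt t (θ k)‖ ≤ K₆ * Λ ^ k := by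
      refine (norm_add_le _ _).trans ?_
      rw [norm_mul, norm_mul, Complex.norm_real, Complex.norm_real, Real.norm_of_nonneg (by positivity),
        Real.norm_eq_abs]
      calc _ ≤ p.αp * p.speed ^ 2 * (K₂ * Λ ^ k) + |m| * (K₅ * Λ ^ k) := by
            gcongr
            exact hK₂ k t ht
        _ = _ := by rw [hK₆]; ring
    have hK₆0 : 0 ≤ K₆ := by positivity
    have hp1 : 0 ≤ K₁ * Λ ^ k := by positivity
    have hp2 : 0 ≤ K₅ * Λ ^ k := by positivity
    have hp3 : 0 ≤ K₆ * Λ ^ k := by positivity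
    refine max_le ?_ (max_le ?_ ?_)
    · linarith only [j1, hp2, hp3]
    · linarith only [j2, hp1, hp3]
    · linarith only [j3, hp1, hp2]
  have hzero := hierarchy_eq_zero (modeA₀.restrictScalars ℝ)
    ((modeA₁ p.speed b m p.Dth).restrictScalars ℝ) hΛ0 (K := K₁ + K₅ + K₆ + K₄) (τ := τ)
    (fun k t => W k t - Y k t)
    (fun k => ((hWc k).mono hsub).sub (fun t _ => (hYd k t).continuousAt.continuousWithinAt))
    (fun k t ht => ((hWd k t ht.1).sub (hYd k t)).congr_deriv (by
      simp only [ContinuousLinearMap.coe_restrictScalars', map_sub]; abel))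
    (fun k => sub_eq_zero.2 (hWY0 k))
    (fun k t ht => by
      refine (norm_sub_le _ _).trans ((add_le_add (hWb k t ht) (hK₄ k t ht)).trans (le_of_eq ?_))
      ring)
    0 τ ⟨hτ, le_rfl⟩
  have h1 := congrArg Prod.fst (sub_eq_zero.1 hzero)
  have hint : Integrable fun ξ => η ξ • modeState p φ₀ φ₁ T₀ τ ξ :=
    integrable_mul_modeFlow hx₀ hη τ
  calc pair (φ τ) (𝓕 η) = (∫ ξ, η ξ • modeState p φ₀ φ₁ T₀ τ ξ).1 := h1
    _ = _ := by rw [fst_integral hint]; rfl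

/-- This reduces all assertions on `φ` to estimates on an explicit flow; in particular `φ` is
determined by the data. -/
theorem IsWeakSolution.fourierLp_ae_eq (h : IsWeakSolution p φ₀ φ₁ T₀ φ T) (h₀ : Integrable φ₀)
    (h₁ : Integrable φ₁) (hT : Integrable T₀) {t : ℝ} (ht : 0 ≤ t) :
    fourierLp (φ t) =ᵐ[volume] fun ξ => (modeState p φ₀ φ₁ T₀ t ξ).1 := by
  have hcont : Continuous fun ξ => (modeState p φ₀ φ₁ T₀ t ξ).1 := by
    refine continuous_fst.comp (((continuous_modeFlow _ _ _ _ t).comp ?_).clm_apply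
      (continuous_initState p h₀ h₁ hT))
    fun_prop
  refine ae_eq_of_integral_schwartz_mul_eq ((Lp.memLp _).locallyIntegrable (by norm_num))
    hcont.locallyIntegrable fun η hη => ?_
  rw [← schwartzPairing_apply, ← pair_fourier_Lp, h.pair_fourier_eq h₀ h₁ hT hη ht]

end WeakSolution

/-! ### Radial symbols of Gaussian decay and their kernels -/

/-- Measurable radial symbols of Gaussian decay. -/
def GaussianDecay (m : ℝ → ℝ) : Prop :=
  Measurable m ∧ ∃ C c : ℝ, 0 < c ∧ ∀ r, 0 ≤ r → |m r| ≤ C * Real.exp (-(c * r ^ 2))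

namespace GaussianDecay

theorem exp {c : ℝ} (hc : 0 < c) : GaussianDecay fun r => Real.exp (-(c * r ^ 2)) :=
  ⟨by fun_prop, 1, c, hc, fun r _ => by rw [abs_of_pos (Real.exp_pos _), one_mul]⟩

theorem bounded_mul {m g : ℝ → ℝ} (hm : GaussianDecay m) (hg : Measurable g) {B : ℝ}
    (hB : ∀ r, 0 ≤ r → |g r| ≤ B) : GaussianDecay fun r => g r * m r := by
  obtain ⟨h1, C, c, hc, h2⟩ := hm
  refine ⟨hg.mul h1, B * C, c, hc, fun r hr => ?_⟩
  rw [abs_mul, mul_assoc]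
  exact mul_le_mul (hB r hr) (h2 r hr) (abs_nonneg _) ((abs_nonneg _).trans (hB r hr))

theorem const_mul {m : ℝ → ℝ} (hm : GaussianDecay m) (a : ℝ) : GaussianDecay fun r => a * m r :=
  hm.bounded_mul measurable_const fun _ _ => le_rfl

theorem sub {m₁ m₂ : ℝ → ℝ} (h₁ : GaussianDecay m₁) (h₂ : GaussianDecay m₂) :
    GaussianDecay fun r => m₁ r - m₂ r := by
  obtain ⟨a1, C₁, c₁, hc₁, b1⟩ := h₁
  obtain ⟨a2, C₂, c₂, hc₂, b2⟩ := h₂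
  refine ⟨a1.sub a2, |C₁| + |C₂|, min c₁ c₂, lt_min hc₁ hc₂, fun r hr => ?_⟩
  have i1 : Real.exp (-(c₁ * r ^ 2)) ≤ Real.exp (-(min c₁ c₂ * r ^ 2)) := by
    gcongr; exact min_le_left _ _
  have i2 : Real.exp (-(c₂ * r ^ 2)) ≤ Real.exp (-(min c₁ c₂ * r ^ 2)) := by
    gcongr; exact min_le_right _ _
  calc |m₁ r - m₂ r| ≤ |m₁ r| + |m₂ r| := by
        simpa [Real.norm_eq_abs] using norm_sub_le (m₁ r) (m₂ r)
    _ ≤ |C₁| * Real.exp (-(min c₁ c₂ * r ^ 2)) + |C₂| * Real.exp (-(min c₁ c₂ * r ^ 2)) := by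
        refine add_le_add ((b1 r hr).trans ?_) ((b2 r hr).trans ?_)
        · exact mul_le_mul (le_abs_self _) i1 (Real.exp_pos _).le (abs_nonneg _)
        · exact mul_le_mul (le_abs_self _) i2 (Real.exp_pos _).le (abs_nonneg _)
    _ = _ := by ring

theorem id_mul {m : ℝ → ℝ} (hm : GaussianDecay m) : GaussianDecay fun r => r * m r := by
  obtain ⟨a, C, c, hc, b⟩ := hm
  refine ⟨measurable_id.mul a, |C| * (1 + 2 / c), c / 2, by positivity, fun r hr => ?_⟩
  rw [abs_mul, abs_of_nonneg hr]
  have h1 := mul_exp_neg_le (c := c / 2) (x := r ^ 2) (by positivity)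
  have h2 : r ≤ 1 + r ^ 2 := by nlinarith [sq_nonneg (r - 1)]
  have h3 : Real.exp (-(c * r ^ 2)) = Real.exp (-(c / 2 * r ^ 2)) * Real.exp (-(c / 2 * r ^ 2)) := by
    rw [← Real.exp_add]; ring_nf
  have h4 : Real.exp (-(c / 2 * r ^ 2)) ≤ 1 := by
    rw [Real.exp_le_one_iff]; simp; positivity
  calc r * |m r| ≤ (1 + r ^ 2) * (|C| * Real.exp (-(c * r ^ 2))) := by
        gcongr
        exact (b r hr).trans (by gcongr; exact le_abs_self _)
    _ = |C| * (Real.exp (-(c / 2 * r ^ 2)) + r ^ 2 * Real.exp (-(c / 2 * r ^ 2)))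
          * Real.exp (-(c / 2 * r ^ 2)) := by rw [h3]; ring
    _ ≤ |C| * (1 + 2 / c) * Real.exp (-(c / 2 * r ^ 2)) := by
        gcongr
        refine h1.trans (le_of_eq ?_); field_simp

end GaussianDecay

theorem integrable_exp_neg_mul_sq_norm {c : ℝ} (hc : 0 < c) :
    Integrable fun ξ : Sp n => Real.exp (-(c * ‖ξ‖ ^ 2)) := by
  have h := GaussianFourier.integral_rexp_neg_mul_sq_norm (V := Sp n) hc
  simp_rw [neg_mul] at h
  -- A non-integrable function has integral `0` by convention, which contradicts the positive value
  -- of the Gaussian integral.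
  by_contra hcon
  rw [integral_undef hcon] at h
  exact (by positivity : (Real.pi / c) ^ (Module.finrank ℝ (Sp n) / 2 : ℝ) ≠ 0) h.symm

/-- The multiplier on `ℝⁿ` with radial symbol `m`, in Mathlib's normalization. -/
noncomputable def radialMultiplier (n : ℕ) (m : ℝ → ℝ) (ξ : Sp n) : ℂ := (m (2 * Real.pi * ‖ξ‖) : ℝ)

theorem GaussianDecay.memLp {m : ℝ → ℝ} (hm : GaussianDecay m) :
    Integrable (radialMultiplier n m) ∧ MemLp (radialMultiplier n m) 2 volume := by
  obtain ⟨a, C, c, hc, b⟩ := hm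
  have hmeas : AEStronglyMeasurable (radialMultiplier n m) volume := by
    unfold radialMultiplier
    exact (Complex.measurable_ofReal.comp (a.comp (by fun_prop))).aestronglyMeasurable
  have hbd (ξ : Sp n) : ‖radialMultiplier n m ξ‖ ≤
      |C| * Real.exp (-(c * (2 * Real.pi) ^ 2 * ‖ξ‖ ^ 2)) := by
    rw [radialMultiplier, Complex.norm_real, Real.norm_eq_abs]
    refine (b _ (by positivity)).trans ?_
    rw [mul_pow, ← mul_assoc]
    gcongr
    exact le_abs_self _
  refine ⟨?_, ?_⟩
  · refine ((integrable_exp_neg_mul_sq_norm (n := n) (c := c * (2 * Real.pi) ^ 2)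
      (by positivity)).const_mul |C|).mono' hmeas (ae_of_all _ hbd)
  · refine (memLp_two_iff_integrable_sq_norm hmeas).2 ?_
    refine ((integrable_exp_neg_mul_sq_norm (n := n) (c := 2 * (c * (2 * Real.pi) ^ 2))
      (by positivity)).const_mul (|C| ^ 2)).mono' (hmeas.norm.pow 2) (ae_of_all _ fun ξ => ?_)
    rw [Real.norm_of_nonneg (by positivity)]
    calc ‖radialMultiplier n m ξ‖ ^ 2 ≤ (|C| * Real.exp (-(c * (2 * Real.pi) ^ 2 * ‖ξ‖ ^ 2))) ^ 2 := by
          gcongr; exact hbd ξ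
      _ = _ := by
          rw [mul_pow, ← Real.exp_nat_mul]; push_cast; ring_nf

/-- The substitution `ξ ↦ 2πξ` passes from angular frequency to the normalization with `2π` in the
exponent; its Jacobian is the prefactor `(2π)⁻ⁿ`. Hence `2π‖ξ‖` is the modulus `r` everywhere below.
-/
theorem radialFourierInv_eq (m : ℝ → ℝ) :
    radialFourierInv n m = 𝓕⁻ (radialMultiplier n m) := by
  ext x
  rw [Real.fourierInv_eq']
  set g : Sp n → ℂ := fun ξ => Complex.exp (Complex.I * (inner ℝ x ξ : ℝ)) * (m ‖ξ‖ : ℂ) with hg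
  have h := Measure.integral_comp_smul (volume : Measure (Sp n)) g (2 * Real.pi)
  have hpi : 0 < (2 * Real.pi) ^ n := by positivity
  rw [finrank_euclideanSpace_fin, abs_of_pos (by positivity)] at h
  rw [radialFourierInv]
  have e : ((2 * Real.pi : ℝ) ^ n : ℂ)⁻¹ * ∫ ξ, g ξ = ((2 * Real.pi) ^ n)⁻¹ • ∫ ξ, g ξ := by
    rw [Complex.real_smul]; push_cast; rfl
  rw [e, ← h]
  refine integral_congr_ae (ae_of_all _ fun ξ => ?_)
  simp only [hg, radialMultiplier, smul_eq_mul, inner_smul_right, norm_smul]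
  rw [Real.norm_of_nonneg (by positivity), real_inner_comm, mul_comm Complex.I]

theorem radialMultiplier_neg (m : ℝ → ℝ) (ξ : Sp n) :
    radialMultiplier n m (-ξ) = radialMultiplier n m ξ := by
  simp [radialMultiplier]

theorem fourierInv_radialMultiplier (m : ℝ → ℝ) :
    𝓕⁻ (radialMultiplier n m) = 𝓕 (radialMultiplier n m) := by
  rw [Real.fourierInv_eq_fourier_comp_neg]
  simp_rw [radialMultiplier_neg]

theorem GaussianDecay.integrable_norm_pow_mul {m : ℝ → ℝ} (hm : GaussianDecay m) (k : ℕ) :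
    Integrable fun ξ : Sp n => ‖ξ‖ ^ k * ‖radialMultiplier n m ξ‖ := by
  have key : ∀ k : ℕ, GaussianDecay fun r => r ^ k * m r := by
    intro k
    induction k with
    | zero => simpa using hm
    | succ k ih =>
      have := ih.id_mul
      simp_rw [← mul_assoc, ← pow_succ'] at this
      exact this
  have h1 := ((key k).memLp (n := n)).1.norm.const_mul (((2 * Real.pi) ^ k)⁻¹)
  refine h1.congr (ae_of_all _ fun ξ => ?_)
  simp only [radialMultiplier, Complex.norm_real, norm_mul, norm_pow, Real.norm_eq_abs,
    abs_of_pos Real.pi_pos, abs_two, abs_norm]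
  field_simp
  rw [mul_pow, mul_pow]
  ring

theorem fderiv_radialFourierInv {m : ℝ → ℝ} (hm : GaussianDecay m) (x w : Sp n) :
    fderiv ℝ (radialFourierInv n m) x w =
      𝓕⁻ (fun ξ => 2 * Real.pi * Complex.I * (inner ℝ ξ w : ℝ) * radialMultiplier n m ξ) x := by
  have h1 : Integrable fun ξ : Sp n => ‖ξ‖ * ‖radialMultiplier n m ξ‖ := by
    simpa using hm.integrable_norm_pow_mul (n := n) 1
  have hm1 := (hm.memLp (n := n)).1
  have h2 : Integrable (VectorFourier.fourierSMulRight (innerSL ℝ) (radialMultiplier n m)) := by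
    refine (h1.const_mul (2 * Real.pi * ‖innerSL ℝ (E := Sp n)‖)).mono'
      (hm1.aestronglyMeasurable.fourierSMulRight) (ae_of_all _ fun ξ => ?_)
    refine (VectorFourier.norm_fourierSMulRight_le _ _ _).trans (le_of_eq (by ring))
  rw [radialFourierInv_eq, fourierInv_radialMultiplier, Real.fderiv_fourier hm1 h1,
    Real.fourier_continuousLinearMap_apply h2, Real.fourierInv_eq_fourier_comp_neg]
  refine congrFun (congrArg _ (funext fun ξ => ?_)) x
  rw [VectorFourier.fourierSMulRight_apply, radialMultiplier_neg]
  change -(2 * Real.pi * Complex.I) • ((inner ℝ ξ w : ℝ) • radialMultiplier n m ξ) = _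
  simp
  ring

theorem laplacian_radialFourierInv {m : ℝ → ℝ} (hm : GaussianDecay m) (x : Sp n) :
    (Δ (radialFourierInv n m : Sp n → ℂ)) x =
      -radialFourierInv n (fun r => r ^ 2 * m r) x := by
  have hint (k : ℕ) (hk : (k : ℕ∞) ≤ 2) :
      Integrable fun ξ : Sp n => ‖ξ‖ ^ k * ‖radialMultiplier n m ξ‖ :=
    hm.integrable_norm_pow_mul k
  have hm1 := (hm.memLp (n := n)).1
  have hpow : Integrable (fun ξ => VectorFourier.fourierPowSMulRight (innerSL ℝ)
      (radialMultiplier n m) ξ 2) :=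
    VectorFourier.integrable_fourierPowSMulRight _ (hm.integrable_norm_pow_mul 2)
      hm1.aestronglyMeasurable
  set b := EuclideanSpace.basisFun (Fin n) ℝ
  rw [InnerProductSpace.laplacian_eq_iteratedFDeriv_orthonormalBasis _ b]
  simp_rw [radialFourierInv_eq, fourierInv_radialMultiplier]
  rw [Real.iteratedFDeriv_fourier (N := 2) hint hm1.aestronglyMeasurable le_rfl]
  have h1 (i : Fin n) : Integrable fun ξ : Sp n =>
      VectorFourier.fourierPowSMulRight (innerSL ℝ) (radialMultiplier n m) ξ 2 ![b i, b i] := by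
    have := (ContinuousMultilinearMap.apply ℝ (fun _ : Fin 2 => Sp n) ℂ ![b i, b i]).integrable_comp hpow
    exact this
  simp_rw [Real.fourier_continuousMultilinearMap_apply hpow]
  simp_rw [Real.fourier_eq]
  rw [← integral_finsetSum _ fun i _ => ?_, ← integral_neg]
  · refine integral_congr_ae (ae_of_all _ fun ξ => ?_)
    simp only
    rw [← Finset.smul_sum, ← smul_neg]
    congr 1
    have e : ∀ i, VectorFourier.fourierPowSMulRight (innerSL ℝ) (radialMultiplier n m) ξ 2 ![b i, b i]
        = -((2 * Real.pi) ^ 2 * radialMultiplier n m ξ) * ((inner ℝ ξ (b i) : ℝ) ^ 2 : ℝ) := by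
      intro i
      rw [VectorFourier.fourierPowSMulRight_apply]
      rw [Fin.prod_univ_two]
      change (-(2 * Real.pi * Complex.I)) ^ 2 •
        (((inner ℝ ξ (b i) : ℝ) * (inner ℝ ξ (b i) : ℝ)) • radialMultiplier n m ξ) = _
      simp
      linear_combination ((2 * Real.pi) ^ 2 * (inner ℝ ξ (b i) : ℝ) ^ 2 * radialMultiplier n m ξ : ℂ) * Complex.I_sq
    simp_rw [e]
    rw [← Finset.mul_sum, ← Complex.ofReal_sum, b.sum_sq_inner_left]
    simp only [radialMultiplier]
    push_cast; ring
  · have := (Real.fourierIntegral_convergent_iff x).2 (h1 i)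
    exact this

theorem fourierInv_add_apply {f g : Sp n → ℂ} (hf : Integrable f) (hg : Integrable g) (x : Sp n) :
    𝓕⁻ (fun ξ => f ξ + g ξ) x = 𝓕⁻ f x + 𝓕⁻ g x := by
  simp_rw [Real.fourierInv_eq, smul_add]
  refine integral_add ?_ ?_
  · have := (Real.fourierIntegral_convergent_iff (-x)).2 hf
    simpa using this
  · have := (Real.fourierIntegral_convergent_iff (-x)).2 hg
    simpa using this

theorem fourierInv_mul_const_apply (f : Sp n → ℂ) (a : ℂ) (x : Sp n) :
    𝓕⁻ (fun ξ => f ξ * a) x = 𝓕⁻ f x * a := by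
  simp_rw [Real.fourierInv_eq]
  rw [← integral_mul_const]
  simp_rw [smul_mul_assoc]

/-! ### Symbols of the asymptotic profiles -/

/-- The symbol of `G₀`. -/
noncomputable def waveProfile (p : Params) (t r : ℝ) : ℝ :=
  Real.sin (p.speed * r * t) / (p.speed * r) * Real.exp (-p.Γ₀ * r ^ 2 * t)

/-- The symbol of `G₁`. -/
noncomputable def cosProfile (p : Params) (t r : ℝ) : ℝ :=
  Real.cos (p.speed * r * t) * Real.exp (-p.Γ₀ * r ^ 2 * t)

/-- The symbol of `K`, a difference of a heat kernel and a diffusion wave. -/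
noncomputable def heatProfile (p : Params) (t r : ℝ) : ℝ :=
  Real.exp (-p.Dth * r ^ 2 * t) - Real.cos (p.speed * r * t) * Real.exp (-p.Γ₀ * r ^ 2 * t)

theorem Params.Γ₀_pos (p : Params) : 0 < p.Γ₀ := by
  have h1 := p.β_gt; have h2 := p.ν₀_pos; have h3 := p.γ_gt; have h4 := p.Dth_pos
  have : 0 < (1 + p.β) * p.ν₀ := mul_pos (by linarith) h2
  have : 0 < (p.γ - 1) * p.Dth := mul_pos (by linarith) h4
  unfold Params.Γ₀; linarith

theorem gaussianDecay_cosProfile (p : Params) {t : ℝ} (ht : 0 < t) :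
    GaussianDecay (cosProfile p t) := by
  have h := (GaussianDecay.exp (mul_pos p.Γ₀_pos ht)).bounded_mul
    (g := fun r => Real.cos (p.speed * r * t)) (by fun_prop) (B := 1)
    fun r _ => Real.abs_cos_le_one _
  convert h using 2 with r
  rw [cosProfile]; congr 2; ring

theorem gaussianDecay_heatProfile (p : Params) {t : ℝ} (ht : 0 < t) :
    GaussianDecay (heatProfile p t) := by
  have h := (GaussianDecay.exp (mul_pos p.Dth_pos ht)).sub (gaussianDecay_cosProfile p ht)
  convert h using 2 with r
  rw [heatProfile, cosProfile]; congr 2; ring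

theorem abs_sin_mul_div_le {s r t : ℝ} (ht : 0 ≤ t) :
    |Real.sin (s * r * t) / (s * r)| ≤ t := by
  -- At zero frequency the quotient is `0` by convention, not the limit `t`; the bound covers both.
  rcases eq_or_ne (s * r) 0 with h | h
  · simpa [h] using ht
  rw [abs_div, div_le_iff₀ (abs_pos.2 h)]
  calc _ ≤ |s * r * t| := Real.abs_sin_le_abs
    _ = t * |s * r| := by rw [abs_mul, abs_of_nonneg ht, mul_comm]

theorem gaussianDecay_waveProfile (p : Params) {t : ℝ} (ht : 0 < t) :
    GaussianDecay (waveProfile p t) := by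
  have h := (GaussianDecay.exp (mul_pos p.Γ₀_pos ht)).bounded_mul
    (g := fun r => Real.sin (p.speed * r * t) / (p.speed * r)) (by fun_prop) (B := t)
    fun r _ => abs_sin_mul_div_le ht.le
  convert h using 2 with r
  rw [waveProfile]; congr 2; ring

/-- The Fourier transform of `leading`. -/
noncomputable def leadingSymbol (p : Params) (φ₁ : Sp n → ℝ) (t : ℝ) (ξ : Sp n) : ℂ :=
  radialMultiplier n (waveProfile p t) ξ * (mean φ₁ : ℝ)

/-- The Fourier transform of `leading + second`. -/
noncomputable def fullSymbol (p : Params) (φ₀ φ₁ T₀ : Sp n → ℝ) (t : ℝ) (ξ : Sp n) : ℂ :=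
  symbolProfile p.speed p.Dth p.Γ₀ p.Γ₁ (2 * Real.pi * ‖ξ‖) t (mean φ₀ : ℝ) (mean φ₁ : ℝ)
      ((p.αp * p.speed ^ 2 * mean T₀ + (p.γ - 1) * mean φ₁ : ℝ) : ℂ)
    - (waveProfile p t (2 * Real.pi * ‖ξ‖) * (2 * Real.pi * inner ℝ ξ (moment φ₁)) : ℝ) * Complex.I

theorem leading_eq (p : Params) (φ₁ : Sp n → ℝ) (t : ℝ) :
    leading p φ₁ t = 𝓕⁻ (leadingSymbol p φ₁ t) := by
  ext x
  rw [show leadingSymbol p φ₁ t = fun ξ => radialMultiplier n (waveProfile p t) ξ * (mean φ₁ : ℝ)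
    from rfl, fourierInv_mul_const_apply, ← radialFourierInv_eq]
  rfl

theorem memLp_leadingSymbol (p : Params) (φ₁ : Sp n → ℝ) {t : ℝ} (ht : 0 < t) :
    Integrable (leadingSymbol p φ₁ t) ∧ MemLp (leadingSymbol p φ₁ t) 2 volume := by
  have h := (gaussianDecay_waveProfile p ht).memLp (n := n)
  exact ⟨h.1.mul_const _, h.2.mul_const _⟩

theorem GaussianDecay.memLp_inner_mul {m : ℝ → ℝ} (hm : GaussianDecay m) (w : Sp n) :
    Integrable (fun ξ : Sp n => 2 * Real.pi * Complex.I * (inner ℝ ξ w : ℝ) * radialMultiplier n m ξ) ∧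
    MemLp (fun ξ : Sp n => 2 * Real.pi * Complex.I * (inner ℝ ξ w : ℝ) * radialMultiplier n m ξ)
      2 volume := by
  have h := (hm.id_mul.const_mul ‖w‖).memLp (n := n)
  have hmeas : AEStronglyMeasurable
      (fun ξ : Sp n => 2 * Real.pi * Complex.I * (inner ℝ ξ w : ℝ) * radialMultiplier n m ξ) volume := by
    refine AEStronglyMeasurable.mul ?_ hm.memLp.1.aestronglyMeasurable
    exact Continuous.aestronglyMeasurable (by fun_prop)
  have hbd : ∀ ξ : Sp n, ‖2 * Real.pi * Complex.I * (inner ℝ ξ w : ℝ) * radialMultiplier n m ξ‖ ≤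
      ‖radialMultiplier n (fun r => ‖w‖ * (r * m r)) ξ‖ := by
    intro ξ
    simp only [radialMultiplier, Complex.norm_real, norm_mul, Complex.norm_I, Complex.norm_two,
      Real.norm_eq_abs, abs_of_pos Real.pi_pos, abs_norm, abs_two]
    have := abs_real_inner_le_norm ξ w
    calc _ = 2 * Real.pi * |inner ℝ ξ w| * |m (2 * Real.pi * ‖ξ‖)| := by ring
      _ ≤ 2 * Real.pi * (‖ξ‖ * ‖w‖) * |m (2 * Real.pi * ‖ξ‖)| := by gcongr
      _ = _ := by ring
  exact ⟨h.1.mono hmeas (ae_of_all _ hbd), h.2.mono hmeas (ae_of_all _ hbd)⟩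

/-- The thermal mean enters as `(D/s²)(αp s² P_{T₀} + (γ-1) P_{φ₁})`; since `s² = γ c₀²`, this
splits into the coefficients of `𝓖₃` and `𝓖₂`. The symbol `r²` of `-Δ` turns `𝓗₀` into the `Γ₁` term
of `symbolProfile`, and the gradient contributes the imaginary dipole. -/
theorem leading_add_second_eq (p : Params) (φ₀ φ₁ T₀ : Sp n → ℝ) {t : ℝ} (ht : 0 < t) :
    Integrable (fullSymbol p φ₀ φ₁ T₀ t) ∧ MemLp (fullSymbol p φ₀ φ₁ T₀ t) 2 volume ∧
    (fun x => leading p φ₁ t x + second p φ₀ φ₁ T₀ t x) = 𝓕⁻ (fullSymbol p φ₀ φ₁ T₀ t) := by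
  have hw := gaussianDecay_waveProfile p ht
  have hc := gaussianDecay_cosProfile p ht
  have hk := gaussianDecay_heatProfile p ht
  have hd := hc.id_mul.id_mul
  have hd' : GaussianDecay fun r => r ^ 2 * cosProfile p t r := by
    simpa only [← mul_assoc, ← sq] using hd
  have hγ : p.speed ^ 2 = p.γ * p.c₀ ^ 2 := p.speed_sq
  have hs := p.speed_pos
  have i1 := (hw.memLp (n := n))
  have i2 := hw.memLp_inner_mul (moment φ₁)
  have i3 := (hc.memLp (n := n))
  have i4 := (hd'.memLp (n := n))
  have i5 := (hk.memLp (n := n))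
  have hsym : fullSymbol p φ₀ φ₁ T₀ t = fun ξ =>
      radialMultiplier n (waveProfile p t) ξ * (mean φ₁ : ℝ)
      + ((2 * Real.pi * Complex.I * (inner ℝ ξ (moment φ₁) : ℝ) * radialMultiplier n (waveProfile p t) ξ) * (-1 : ℂ)
      + (radialMultiplier n (cosProfile p t) ξ * (mean φ₀ : ℝ)
      + (radialMultiplier n (fun r => r ^ 2 * cosProfile p t r) ξ * ((p.Γ₁ / p.speed * t * mean φ₁ : ℝ))
      + radialMultiplier n (heatProfile p t) ξ * ((p.αp * p.Dth * mean T₀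
        + (p.γ - 1) * p.Dth / (p.γ * p.c₀ ^ 2) * mean φ₁ : ℝ))))) := by
    ext ξ
    have hs' : (p.speed : ℂ) ≠ 0 := by exact_mod_cast hs.ne'
    simp only [fullSymbol, symbolProfile, radialMultiplier, waveProfile, cosProfile, heatProfile, ← hγ]
    push_cast
    field_simp
    ring
  have j1 := i1.1.mul_const ((mean φ₁ : ℝ) : ℂ)
  have j2 := i2.1.mul_const (-1 : ℂ)
  have j3 := i3.1.mul_const ((mean φ₀ : ℝ) : ℂ)
  have j4 := i4.1.mul_const ((p.Γ₁ / p.speed * t * mean φ₁ : ℝ) : ℂ)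
  have j5 := i5.1.mul_const ((p.αp * p.Dth * mean T₀
        + (p.γ - 1) * p.Dth / (p.γ * p.c₀ ^ 2) * mean φ₁ : ℝ) : ℂ)
  refine ⟨?_, ?_, ?_⟩
  · rw [hsym]; exact j1.add (j2.add (j3.add (j4.add j5)))
  · rw [hsym]
    exact (i1.2.mul_const _).add ((i2.2.mul_const _).add ((i3.2.mul_const _).add
      ((i4.2.mul_const _).add (i5.2.mul_const _))))
  · have hh (a : ℝ) (x : Sp n) : radialFourierInv n (fun r => a * heatProfile p t r) x =
        𝓕⁻ (radialMultiplier n (heatProfile p t)) x * a := by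
      rw [radialFourierInv_eq, ← fourierInv_mul_const_apply]
      refine congrFun (congrArg _ (funext fun ξ => ?_)) x
      simp [radialMultiplier, mul_comm]
    have e0 : (G₀ p t : Sp n → ℂ) = radialFourierInv n (waveProfile p t) := rfl
    have e1 : (G₁ p t : Sp n → ℂ) = radialFourierInv n (cosProfile p t) := rfl
    have e2 (x : Sp n) : G₂ p t x = _ := hh ((p.γ - 1) * p.Dth / (p.γ * p.c₀ ^ 2)) x
    have e3 (x : Sp n) : G₃ p t x = _ := hh (p.αp * p.Dth) x
    ext x
    have k4 := j4.fun_add j5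
    have k3 := j3.fun_add k4
    have k2 := j2.fun_add k3
    rw [hsym, fourierInv_add_apply j1 k2, fourierInv_add_apply j2 k3, fourierInv_add_apply j3 k4,
      fourierInv_add_apply j4 j5]
    simp_rw [fourierInv_mul_const_apply]
    rw [leading, second, H₀, e2, e3, e0, e1, fderiv_radialFourierInv hw,
      laplacian_radialFourierInv hc]
    simp_rw [radialFourierInv_eq]
    push_cast
    ring

/-! ### `L²` size of Gaussians and of the dipole -/

theorem eLpNorm_two_eq_sqrt {α E : Type*} [MeasurableSpace α] [NormedAddCommGroup E]
    {μ : Measure α} {f : α → E} (hf : MemLp f 2 μ) :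
    eLpNorm f 2 μ = ENNReal.ofReal √(∫ x, ‖f x‖ ^ 2 ∂μ) := by
  rw [hf.eLpNorm_eq_integral_rpow_norm (by norm_num) (by norm_num), Real.sqrt_eq_rpow]
  norm_num

theorem sqrt_inv_sqrt_pow {t : ℝ} (ht : 0 < t) (n : ℕ) :
    √((√t)⁻¹ ^ n) = t ^ (-(n : ℝ) / 4) := by
  rw [Real.sqrt_eq_rpow, Real.sqrt_eq_rpow, ← Real.rpow_neg ht.le, ← Real.rpow_natCast,
    ← Real.rpow_mul ht.le, ← Real.rpow_mul ht.le]
  congr 1; ring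

theorem eLpNorm_gaussian {k t : ℝ} (hk : 0 < k) (ht : 0 < t) :
    eLpNorm (fun ξ : Sp n => Real.exp (-(k * (2 * Real.pi * ‖ξ‖) ^ 2 * t))) 2 volume =
      ENNReal.ofReal ((8 * Real.pi * k) ^ (-(n : ℝ) / 4) * t ^ (-(n : ℝ) / 4)) := by
  have hsq (ξ : Sp n) : ‖Real.exp (-(k * (2 * Real.pi * ‖ξ‖) ^ 2 * t))‖ ^ 2 =
      Real.exp (-(8 * Real.pi ^ 2 * k * t) * ‖ξ‖ ^ 2) := by
    rw [Real.norm_of_nonneg (Real.exp_pos _).le, ← Real.exp_nat_mul]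
    congr 1; push_cast; ring
  have hc : 0 < 8 * Real.pi ^ 2 * k * t := by positivity
  have hmem : MemLp (fun ξ : Sp n => Real.exp (-(k * (2 * Real.pi * ‖ξ‖) ^ 2 * t))) 2 volume := by
    refine (memLp_two_iff_integrable_sq_norm (Continuous.aestronglyMeasurable (by fun_prop))).2 ?_
    simp_rw [hsq, neg_mul]
    exact integrable_exp_neg_mul_sq_norm hc
  rw [eLpNorm_two_eq_sqrt hmem]
  simp_rw [hsq]
  rw [GaussianFourier.integral_rexp_neg_mul_sq_norm hc, finrank_euclideanSpace_fin,
    Real.sqrt_eq_rpow, ← Real.rpow_mul (by positivity), ← Real.mul_rpow (by positivity) ht.le]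
  congr 1
  rw [neg_div, Real.rpow_neg (by positivity), ← Real.inv_rpow (by positivity)]
  congr 1
  · field_simp
  · ring

/-- A reflection carries any vector to any other of the same length, so the quadratic form `w ↦ ∫
⟪ξ, w⟫² h` is a multiple of `‖w‖²`; summation over an orthonormal basis finds the factor. -/
theorem integral_inner_sq_mul_radial (h : ℝ → ℝ)
    (hint : ∀ w : Sp n, Integrable fun ξ : Sp n => inner ℝ ξ w ^ 2 * h ‖ξ‖) (w : Sp n) :
    n * ∫ ξ : Sp n, inner ℝ ξ w ^ 2 * h ‖ξ‖ = ‖w‖ ^ 2 * ∫ ξ : Sp n, ‖ξ‖ ^ 2 * h ‖ξ‖ := by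
  set F : Sp n → ℝ := fun w => ∫ ξ : Sp n, inner ℝ ξ w ^ 2 * h ‖ξ‖ with hF
  have hrot {u v : Sp n} (huv : ‖u‖ = ‖v‖) : F u = F v := by
    set R := (ℝ ∙ (u - v))ᗮ.reflection
    have hR : R u = v := Submodule.reflection_sub huv
    have h1 := R.measurePreserving.integral_comp' (f := R.toMeasurableEquiv)
      (fun ξ : Sp n => inner ℝ ξ v ^ 2 * h ‖ξ‖)
    simp only [hF]
    rw [← h1]
    refine integral_congr_ae (ae_of_all _ fun ξ => ?_)
    change _ = inner ℝ (R ξ) v ^ 2 * h ‖R ξ‖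
    rw [← hR, R.inner_map_map, R.norm_map]
  have hscale (a : ℝ) (u : Sp n) : F (a • u) = a ^ 2 * F u := by
    simp only [hF]
    rw [← integral_const_mul]
    simp_rw [inner_smul_right, mul_pow, mul_assoc]
  set b := EuclideanSpace.basisFun (Fin n) ℝ
  have hb (i : Fin n) : F w = ‖w‖ ^ 2 * F (b i) := by
    rw [← hscale]
    refine hrot ?_
    simp [norm_smul, b.norm_eq_one]
  have hsum : ∫ ξ : Sp n, ‖ξ‖ ^ 2 * h ‖ξ‖ = ∑ i, F (b i) := by
    simp only [hF]
    rw [← integral_finsetSum _ fun i _ => hint (b i)]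
    simp_rw [← Finset.sum_mul, b.sum_sq_inner_left]
  rw [hsum, Finset.mul_sum, ← Finset.sum_congr rfl fun i _ => hb i]
  simp [hF]

/-- The integral differs from `τ/2` by at most `1/a`, which is at most `τ/4`. -/
theorem quarter_le_integral_sin_sq {a τ : ℝ} (ha : 0 < a) (haτ : 4 ≤ a * τ) :
    τ / 4 ≤ ∫ y in τ..2 * τ, Real.sin (a * y) ^ 2 := by
  rw [intervalIntegral.integral_comp_mul_left (fun x => Real.sin x ^ 2) ha.ne', integral_sin_sq,
    smul_eq_mul, inv_mul_eq_div, le_div_iff₀ ha]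
  have hb (x : ℝ) : |Real.sin x * Real.cos x| ≤ 1 := by
    rw [abs_mul]
    exact mul_le_one₀ (Real.abs_sin_le_one x) (abs_nonneg _) (Real.abs_cos_le_one x)
  have h1 := (abs_le.1 (hb (a * τ))).1
  have h2 := (abs_le.1 (hb (a * (2 * τ)))).2
  nlinarith

/-- In polar coordinates it is enough to keep the shell `t^(-1/2) < |ξ| ≤ 2 t^(-1/2)`. There the
Gaussian is at least `E`, the volume is of order `t^(-n/2)`, and the sine, with argument of order
`√t`, has a square of mean at least `1/4`. -/
theorem exists_le_integral_sin_sq (hn : 1 ≤ n) {s Γ : ℝ} (hs : 0 < s) (hΓ : 0 < Γ) :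
    ∃ c t₀ : ℝ, 0 < c ∧ 0 < t₀ ∧ ∀ t ≥ t₀, c * (√t)⁻¹ ^ n ≤
      ∫ ξ : Sp n, Real.sin (2 * Real.pi * s * t * ‖ξ‖) ^ 2 *
        Real.exp (-(2 * Γ * t * (2 * Real.pi * ‖ξ‖) ^ 2)) := by
  have : Nonempty (Fin n) := ⟨⟨0, hn⟩⟩
  set V := (volume : Measure (Sp n)).real (Metric.ball 0 1)
  have hV : 0 < V := ENNReal.toReal_pos (Metric.measure_ball_pos _ _ one_pos).ne'
    measure_ball_lt_top.ne
  set E := Real.exp (-(32 * Real.pi ^ 2 * Γ))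
  have hn0 : (0 : ℝ) < n := by exact_mod_cast hn
  -- The threshold says `2π s √t ≥ 4`, the hypothesis of `quarter_le_integral_sin_sq` at `τ =
  -- t^(-1/2)`.
  refine ⟨n * V * (E / 4), (2 / (Real.pi * s)) ^ 2, by positivity, by positivity, fun t ht => ?_⟩
  have ht0 : 0 < t := lt_of_lt_of_le (by positivity) ht
  have hst : 2 / (Real.pi * s) ≤ √t := by
    rw [← Real.sqrt_sq (show 0 ≤ 2 / (Real.pi * s) by positivity)]; exact Real.sqrt_le_sqrt ht
  have hst0 : 0 < √t := Real.sqrt_pos.2 ht0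
  set τ := (√t)⁻¹ with hτ
  have hτ0 : 0 < τ := inv_pos.2 hst0
  have htτ : t * τ ^ 2 = 1 := by
    rw [hτ, inv_pow, Real.sq_sqrt ht0.le]; field_simp
  set f : ℝ → ℝ := fun y => Real.sin (2 * Real.pi * s * t * y) ^ 2 *
        Real.exp (-(2 * Γ * t * (2 * Real.pi * y) ^ 2)) with hf
  have hcont : Continuous f := by fun_prop
  have hfint : Integrable fun ξ : Sp n => f ‖ξ‖ := by
    refine (integrable_exp_neg_mul_sq_norm (n := n) (c := 2 * Γ * t * (2 * Real.pi) ^ 2)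
      (by positivity)).mono' (Continuous.aestronglyMeasurable (by fun_prop))
      (ae_of_all _ fun ξ => ?_)
    rw [Real.norm_of_nonneg (by positivity)]
    simp only [hf]
    rw [mul_pow, ← mul_assoc]
    exact mul_le_of_le_one_left (Real.exp_pos _).le (Real.sin_sq_le_one _)
  have hpolar := integral_fun_norm_addHaar (volume : Measure (Sp n)) f
  have hion := (integrable_fun_norm_addHaar (volume : Measure (Sp n))).1 hfint
  rw [finrank_euclideanSpace_fin] at hpolar hion
  change _ ≤ ∫ ξ : Sp n, f ‖ξ‖
  rw [hpolar, nsmul_eq_mul, smul_eq_mul, mul_assoc (n * V : ℝ), mul_assoc (n : ℝ)]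
  refine mul_le_mul_of_nonneg_left (mul_le_mul_of_nonneg_left ?_ hV.le) hn0.le
  have hsub : Ioc τ (2 * τ) ⊆ Ioi 0 := fun y hy => hτ0.trans hy.1
  have hsinτ : 4 ≤ 2 * Real.pi * s * t * τ := by
    have e : 2 * Real.pi * s * t * τ = 2 * (Real.pi * s) * √t := by
      rw [hτ]; nth_rewrite 1 [← Real.mul_self_sqrt ht0.le]; field_simp
    rw [div_le_iff₀ (by positivity)] at hst
    rw [e]; linarith
  calc E / 4 * τ ^ n = τ ^ (n - 1) * E * (τ / 4) := by
        rw [← Nat.sub_add_cancel hn, pow_succ]; simp; ring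
    _ ≤ τ ^ (n - 1) * E * ∫ y in τ..2 * τ, Real.sin (2 * Real.pi * s * t * y) ^ 2 := by
        gcongr
        exact quarter_le_integral_sin_sq (by positivity) hsinτ
    _ = ∫ y in Ioc τ (2 * τ), τ ^ (n - 1) * E * Real.sin (2 * Real.pi * s * t * y) ^ 2 := by
        rw [intervalIntegral.integral_of_le (by linarith), integral_const_mul]
    _ ≤ ∫ y in Ioc τ (2 * τ), y ^ (n - 1) • f y := by
        refine setIntegral_mono_on ?_ (hion.mono_set hsub) measurableSet_Ioc fun y hy => ?_
        · exact (Continuous.integrableOn_Ioc (by fun_prop))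
        · have hy0 : 0 < y := hsub hy
          have h1 : τ ^ (n - 1) ≤ y ^ (n - 1) := by gcongr; exact hy.1.le
          have h2 : E ≤ Real.exp (-(2 * Γ * t * (2 * Real.pi * y) ^ 2)) := by
            refine Real.exp_le_exp.2 (neg_le_neg ?_)
            have : y ^ 2 ≤ 4 * τ ^ 2 := by nlinarith [hy.2]
            calc 2 * Γ * t * (2 * Real.pi * y) ^ 2 = 8 * Real.pi ^ 2 * Γ * t * y ^ 2 := by ring
              _ ≤ 8 * Real.pi ^ 2 * Γ * t * (4 * τ ^ 2) := by gcongr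
              _ = 32 * Real.pi ^ 2 * Γ * (t * τ ^ 2) := by ring
              _ = _ := by rw [htτ, mul_one]
          simp only [hf, smul_eq_mul]
          calc τ ^ (n - 1) * E * Real.sin (2 * Real.pi * s * t * y) ^ 2
              ≤ y ^ (n - 1) * Real.exp (-(2 * Γ * t * (2 * Real.pi * y) ^ 2)) *
                Real.sin (2 * Real.pi * s * t * y) ^ 2 := by gcongr
            _ = _ := by ring
    _ ≤ _ := by
        refine setIntegral_mono_set hion ?_ hsub.eventuallyLE
        refine (ae_restrict_iff' measurableSet_Ioi).2 (ae_of_all _ fun y hy => ?_)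
        have : 0 < y := hy
        simp only [hf, smul_eq_mul, Pi.zero_apply]
        positivity

/-- The part of the Fourier transform of `second` that comes from `-∇G₀ · M`, up to `-I`. -/
noncomputable def dipoleSymbol (p : Params) (w : Sp n) (t : ℝ) (ξ : Sp n) : ℝ :=
  waveProfile p t (2 * Real.pi * ‖ξ‖) * (2 * Real.pi * inner ℝ ξ w)

theorem memLp_dipoleSymbol (p : Params) (w : Sp n) {t : ℝ} (ht : 0 < t) :
    MemLp (dipoleSymbol p w t) 2 volume := by
  have h := ((gaussianDecay_waveProfile p ht).memLp_inner_mul w).2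
  have hc : AEStronglyMeasurable (dipoleSymbol p w t) volume := by
    refine Measurable.aestronglyMeasurable ?_
    refine ((gaussianDecay_waveProfile p ht).1.comp (by fun_prop)).mul (by fun_prop)
  refine h.mono hc (ae_of_all _ fun ξ => le_of_eq ?_)
  simp only [dipoleSymbol, radialMultiplier, norm_mul, Complex.norm_real, Complex.norm_I,
    Complex.norm_two, Real.norm_eq_abs, abs_two]
  ring

/-- The linear factor of the dipole cancels the `1/r` of the wave symbol: after averaging over
directions only `s⁻² sin²` times a Gaussian is left, so the dipole has exactly the order `t^(-n/4)`.
-/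
theorem exists_le_eLpNorm_dipoleSymbol (hn : 1 ≤ n) (p : Params) :
    ∃ c t₀ : ℝ, 0 < c ∧ 0 < t₀ ∧ ∀ t ≥ t₀, ∀ w : Sp n,
      ENNReal.ofReal (c * t ^ (-(n : ℝ) / 4) * ‖w‖) ≤ eLpNorm (dipoleSymbol p w t) 2 volume := by
  have hs := p.speed_pos
  obtain ⟨c, t₀, hc, ht₀, H⟩ := exists_le_integral_sin_sq hn hs p.Γ₀_pos
  have hn0 : (0 : ℝ) < n := by exact_mod_cast hn
  refine ⟨√(c / (p.speed ^ 2 * n)), t₀, by positivity, ht₀, fun t ht w => ?_⟩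
  have ht0 : 0 < t := ht₀.trans_le ht
  rw [eLpNorm_two_eq_sqrt (memLp_dipoleSymbol p w ht0), ← sqrt_inv_sqrt_pow ht0]
  refine ENNReal.ofReal_le_ofReal (Real.le_sqrt_of_sq_le ?_)
  rw [mul_pow, mul_pow, Real.sq_sqrt (by positivity), Real.sq_sqrt (by positivity)]
  set h : ℝ → ℝ := fun ρ => (waveProfile p t (2 * Real.pi * ρ) * (2 * Real.pi)) ^ 2 with hh
  have e (v ξ : Sp n) : ‖dipoleSymbol p v t ξ‖ ^ 2 = inner ℝ ξ v ^ 2 * h ‖ξ‖ := by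
    rw [Real.norm_eq_abs, sq_abs, dipoleSymbol, hh]; ring
  have key := integral_inner_sq_mul_radial h (fun v => by
    simp_rw [← e]; exact (memLp_dipoleSymbol p v ht0).integrable_norm_pow two_ne_zero) w
  have e2 : ∫ ξ : Sp n, ‖ξ‖ ^ 2 * h ‖ξ‖ = (p.speed ^ 2)⁻¹ *
      ∫ ξ : Sp n, Real.sin (2 * Real.pi * p.speed * t * ‖ξ‖) ^ 2 *
        Real.exp (-(2 * p.Γ₀ * t * (2 * Real.pi * ‖ξ‖) ^ 2)) := by
    rw [← integral_const_mul]
    refine integral_congr_ae (ae_of_all _ fun ξ => ?_)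
    have e3 : Real.exp (-(2 * p.Γ₀ * t * (2 * Real.pi * ‖ξ‖) ^ 2)) =
        Real.exp (-p.Γ₀ * (2 * Real.pi * ‖ξ‖) ^ 2 * t) ^ 2 := by
      rw [← Real.exp_nat_mul]; congr 1; push_cast; ring
    have e4 : 2 * Real.pi * p.speed * t * ‖ξ‖ = p.speed * (2 * Real.pi * ‖ξ‖) * t := by ring
    simp only [hh, waveProfile, e3, e4]
    rcases eq_or_ne ‖ξ‖ 0 with h0 | h0
    · simp [h0]
    · have := Real.pi_ne_zero
      field_simp
  simp_rw [e]
  rw [e2] at key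
  have h3 := H t ht
  have h4 : ∫ ξ : Sp n, inner ℝ ξ w ^ 2 * h ‖ξ‖ = ‖w‖ ^ 2 / (p.speed ^ 2 * n) *
      ∫ ξ : Sp n, Real.sin (2 * Real.pi * p.speed * t * ‖ξ‖) ^ 2 *
        Real.exp (-(2 * p.Γ₀ * t * (2 * Real.pi * ‖ξ‖) ^ 2)) := by
    rw [← mul_right_inj' hn0.ne', key]
    generalize (∫ ξ : Sp n, Real.sin (2 * Real.pi * p.speed * t * ‖ξ‖) ^ 2 *
        Real.exp (-(2 * p.Γ₀ * t * (2 * Real.pi * ‖ξ‖) ^ 2))) = J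
    field_simp
  rw [h4]
  calc _ = ‖w‖ ^ 2 / (p.speed ^ 2 * n) * (c * (√t)⁻¹ ^ n) := by ring
    _ ≤ _ := by gcongr

/-! ### Fourier transforms of the data near frequency zero -/

theorem realFourier_apply (f : Sp n → ℝ) (ξ : Sp n) :
    realFourier f ξ = ∫ x, Complex.exp ((-(2 * Real.pi * inner ℝ x ξ) : ℝ) * Complex.I) * (f x : ℂ) := by
  rw [realFourier, Real.fourier_eq']
  simp [smul_eq_mul]

theorem realFourier_zero (f : Sp n → ℝ) : realFourier f 0 = (mean f : ℝ) := by
  rw [realFourier_apply]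
  simp [mean, integral_complex_ofReal]

theorem norm_realFourier_le (f : Sp n → ℝ) (ξ : Sp n) : ‖realFourier f ξ‖ ≤ ∫ x, |f x| := by
  rw [realFourier_apply]
  refine (norm_integral_le_integral_norm _).trans (le_of_eq ?_)
  simp_rw [norm_mul, Complex.norm_exp_ofReal_mul_I, one_mul, Complex.norm_real, Real.norm_eq_abs]

theorem abs_mean_le (f : Sp n → ℝ) : |mean f| ≤ ∫ x, |f x| := by
  simpa [Real.norm_eq_abs, mean] using norm_integral_le_integral_norm f

theorem norm_realFourier_sub_mean_le {f : Sp n → ℝ} (hf : Integrable f)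
    (hxf : Integrable fun x => ‖x‖ * |f x|) (ξ : Sp n) :
    ‖realFourier f ξ - (mean f : ℝ)‖ ≤ 2 * Real.pi * ‖ξ‖ * ∫ x, ‖x‖ * |f x| := by
  have hi (η : Sp n) : Integrable fun x =>
      Complex.exp ((-(2 * Real.pi * inner ℝ x η) : ℝ) * Complex.I) * (f x : ℂ) := by
    refine hf.ofReal.bdd_mul (c := 1) (Continuous.aestronglyMeasurable (by fun_prop))
      (ae_of_all _ fun x => ?_)
    rw [Complex.norm_exp_ofReal_mul_I]
  rw [← realFourier_zero, realFourier_apply, realFourier_apply, ← integral_sub (hi _) (hi _),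
    ← integral_const_mul]
  refine norm_integral_le_of_norm_le (hxf.const_mul _) (ae_of_all _ fun x => ?_)
  rw [← sub_mul, norm_mul, Complex.norm_real, Real.norm_eq_abs, inner_zero_right]
  have h1 := Real.norm_exp_I_mul_ofReal_sub_one_le (x := -(2 * Real.pi * inner ℝ x ξ))
  rw [mul_comm] at h1
  have h2 := abs_real_inner_le_norm x ξ
  rw [Real.norm_eq_abs, abs_neg, abs_mul, abs_of_pos (by positivity : 0 < 2 * Real.pi)] at h1
  calc _ = ‖Complex.exp ((-(2 * Real.pi * inner ℝ x ξ) : ℝ) * Complex.I) - 1‖ * |f x| := by simp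
    _ ≤ 2 * Real.pi * |inner ℝ x ξ| * |f x| := by gcongr
    _ ≤ 2 * Real.pi * (‖x‖ * ‖ξ‖) * |f x| := by gcongr
    _ = _ := by ring

/-- Continuity at zero gives `ε` near the origin; away from it a bounded function is dominated by a
multiple of the modulus. The term in `K` later gains `t^(-1/2)` and is negligible, whatever `K` is.
-/
theorem exists_realFourier_sub_mean_le {f : Sp n → ℝ} (hf : Integrable f) {ε : ℝ} (hε : 0 < ε) :
    ∃ K, 0 ≤ K ∧ ∀ ξ, ‖realFourier f ξ - (mean f : ℝ)‖ ≤ ε + K * (2 * Real.pi * ‖ξ‖) := by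
  obtain ⟨δ, hδ, H⟩ := Metric.continuousAt_iff.1
    ((continuous_realFourier hf).continuousAt (x := 0)) ε hε
  have hI : 0 ≤ ∫ x, |f x| := integral_nonneg fun _ => abs_nonneg _
  have h2p : 1 ≤ 2 * Real.pi := by linarith [Real.pi_gt_three]
  refine ⟨2 * (∫ x, |f x|) / δ, by positivity, fun ξ => ?_⟩
  rcases lt_or_ge ‖ξ‖ δ with h | h
  · have := H (x := ξ) (by simpa using h)
    rw [realFourier_zero, dist_eq_norm] at this
    have : 0 ≤ 2 * (∫ x, |f x|) / δ * (2 * Real.pi * ‖ξ‖) := by positivity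
    linarith
  · calc _ ≤ ‖realFourier f ξ‖ + ‖((mean f : ℝ) : ℂ)‖ := norm_sub_le _ _
      _ ≤ (∫ x, |f x|) + ∫ x, |f x| := by
        refine add_le_add (norm_realFourier_le f ξ) ?_
        rw [Complex.norm_real]; exact abs_mean_le f
      _ = 2 * (∫ x, |f x|) / δ * δ := by field_simp; norm_num
      _ ≤ 2 * (∫ x, |f x|) / δ * (2 * Real.pi * ‖ξ‖) := by
        gcongr; exact h.trans (le_mul_of_one_le_left (norm_nonneg _) h2p)
      _ ≤ _ := by linarith

theorem integrable_smul_self {f : Sp n → ℝ} (hf : Integrable f)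
    (hxf : Integrable fun x => ‖x‖ * |f x|) : Integrable fun x => f x • x := by
  refine hxf.mono' (hf.aestronglyMeasurable.smul aestronglyMeasurable_id) (ae_of_all _ fun x => ?_)
  rw [norm_smul, Real.norm_eq_abs, mul_comm]

theorem hasFDerivAt_realFourier_zero {f : Sp n → ℝ} (hf : Integrable f)
    (hxf : Integrable fun x => ‖x‖ * |f x|) :
    ∃ L : Sp n →L[ℝ] ℂ, HasFDerivAt (realFourier f) L 0 ∧
      ∀ ξ, L ξ = -((2 * Real.pi * inner ℝ ξ (moment f) : ℝ) * Complex.I) := by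
  have hfc : Integrable fun x => (f x : ℂ) := hf.ofReal
  have hxc : Integrable fun x => ‖x‖ * ‖(f x : ℂ)‖ := by simpa using hxf
  refine ⟨_, Real.hasFDerivAt_fourier hfc hxc 0, fun ξ => ?_⟩
  have h2 : Integrable (VectorFourier.fourierSMulRight (innerSL ℝ) fun x => (f x : ℂ)) := by
    refine (hxc.const_mul (2 * Real.pi * ‖innerSL ℝ (E := Sp n)‖)).mono'
      (hfc.aestronglyMeasurable.fourierSMulRight) (ae_of_all _ fun ξ => ?_)
    refine (VectorFourier.norm_fourierSMulRight_le _ _ _).trans (le_of_eq (by ring))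
  rw [Real.fourier_continuousLinearMap_apply h2, Real.fourier_eq]
  have hm : ∫ x, inner ℝ ξ (f x • x) = inner ℝ ξ (moment f) :=
    integral_inner (integrable_smul_self hf hxf) ξ
  rw [← hm, ← integral_const_mul, ← integral_complex_ofReal, ← integral_mul_const, ← integral_neg]
  refine integral_congr_ae (ae_of_all _ fun x => ?_)
  simp only [inner_zero_right, neg_zero, AddChar.map_zero_eq_one, one_smul]
  rw [VectorFourier.fourierSMulRight_apply]
  change -(2 * Real.pi * Complex.I) • ((inner ℝ x ξ : ℝ) • (f x : ℂ)) = _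
  rw [inner_smul_right, real_inner_comm]
  simp
  ring

/-- The same one order higher: the integrable first moment makes the transform differentiable at
zero, with derivative given by the moment. The extra factor `2π‖ξ‖` is there to cancel the `1/r` of
the wave symbol. -/
theorem exists_realFourier_sub_dipole_le {f : Sp n → ℝ} (hf : Integrable f)
    (hxf : Integrable fun x => ‖x‖ * |f x|) {ε : ℝ} (hε : 0 < ε) :
    ∃ K, 0 ≤ K ∧ ∀ ξ, ‖realFourier f ξ - (mean f : ℝ)
        + (2 * Real.pi * inner ℝ ξ (moment f) : ℝ) * Complex.I‖ ≤
      2 * Real.pi * ‖ξ‖ * (ε + K * (2 * Real.pi * ‖ξ‖)) := by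
  obtain ⟨L, hL, hLv⟩ := hasFDerivAt_realFourier_zero hf hxf
  have H := (hasFDerivAt_iff_isLittleO_nhds_zero.1 hL).def hε
  obtain ⟨δ, hδ, H⟩ := Metric.eventually_nhds_iff.1 H
  have hI : 0 ≤ ∫ x, ‖x‖ * |f x| := integral_nonneg fun _ => by positivity
  have h2p : 1 ≤ 2 * Real.pi := by linarith [Real.pi_gt_three]
  refine ⟨((∫ x, ‖x‖ * |f x|) + ‖moment f‖) / δ, by positivity, fun ξ => ?_⟩
  have hle : ‖ξ‖ ≤ 2 * Real.pi * ‖ξ‖ := le_mul_of_one_le_left (norm_nonneg _) h2p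
  rcases lt_or_ge ‖ξ‖ δ with h | h
  · have := H (y := ξ) (by simpa using h)
    rw [zero_add, hLv, realFourier_zero, sub_neg_eq_add] at this
    refine this.trans ?_
    calc ε * ‖ξ‖ ≤ ε * (2 * Real.pi * ‖ξ‖) := by gcongr
      _ = 2 * Real.pi * ‖ξ‖ * (ε + 0) := by ring
      _ ≤ _ := by gcongr; positivity
  · have h3 : ‖((2 * Real.pi * inner ℝ ξ (moment f) : ℝ) : ℂ) * Complex.I‖ ≤
        2 * Real.pi * ‖ξ‖ * ‖moment f‖ := by
      rw [norm_mul, Complex.norm_I, mul_one, Complex.norm_real, Real.norm_eq_abs, abs_mul,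
        abs_of_pos (by positivity : 0 < 2 * Real.pi), mul_assoc (2 * Real.pi)]
      exact mul_le_mul_of_nonneg_left (abs_real_inner_le_norm _ _) (by positivity)
    have h4 := norm_realFourier_sub_mean_le hf hxf ξ
    refine (norm_add_le _ _).trans ((add_le_add h4 h3).trans ?_)
    rw [← mul_add]
    refine mul_le_mul_of_nonneg_left ?_ (by positivity)
    rw [div_mul_eq_mul_div]
    refine le_trans ((le_div_iff₀ hδ).2 ?_) (le_add_of_nonneg_left hε.le)
    have h5 : δ ≤ 2 * Real.pi * ‖ξ‖ := h.trans hle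
    have h6 := add_nonneg hI (norm_nonneg (moment f))
    exact mul_le_mul_of_nonneg_left h5 h6

theorem eLpNorm_realFourier {f : Sp n → ℝ} (hf : Integrable f) (hf2 : MemLp f 2 volume) :
    eLpNorm (realFourier f) 2 volume = eLpNorm f 2 volume := by
  have h1 : Integrable fun x => (f x : ℂ) := hf.ofReal
  have h2 : MemLp (fun x => (f x : ℂ)) 2 volume := hf2.ofReal
  rw [realFourier, eLpNorm_fourier_toLp h1 h2]
  exact eLpNorm_congr_norm_ae (ae_of_all _ fun x => by simp)

theorem eLpNorm_one_eq {f : Sp n → ℝ} (hf : Integrable f) :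
    eLpNorm f 1 volume = ENNReal.ofReal (∫ x, |f x|) := by
  rw [eLpNorm_one_eq_lintegral_enorm, ← ofReal_integral_norm_eq_lintegral_enorm hf]
  rfl

theorem integrable_norm_mul_of_normL11 {f : Sp n → ℝ} (hf : Integrable f) (h : normL11 f < ⊤) :
    Integrable (fun x => ‖x‖ * |f x|) := by
  have hmeas : AEStronglyMeasurable (fun x => (1 + ‖x‖) * |f x|) volume :=
    (Continuous.aestronglyMeasurable (by fun_prop)).mul hf.aestronglyMeasurable.norm
  have hi : Integrable fun x => (1 + ‖x‖) * |f x| := by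
    refine ⟨hmeas, ?_⟩
    rw [hasFiniteIntegral_iff_ofReal (ae_of_all _ fun x => by positivity)]
    exact h
  refine (hi.sub hf.abs).congr (ae_of_all _ fun x => ?_)
  simp only [Pi.sub_apply]; ring

theorem normL11_eq {f : Sp n → ℝ} (hf : Integrable f) (hxf : Integrable fun x => ‖x‖ * |f x|) :
    normL11 f = ENNReal.ofReal ((∫ x, |f x|) + ∫ x, ‖x‖ * |f x|) := by
  rw [normL11, ← integral_add hf.abs hxf, ofReal_integral_eq_lintegral_ofReal (hf.abs.fun_add hxf)
    (ae_of_all _ fun x => by simp only [Pi.zero_apply]; positivity)]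
  refine lintegral_congr fun x => ?_
  congr 1; ring

/-- A factor `r` in front of a Gaussian is worth `t^(-1/2)` at the price of half of the exponent. -/
theorem mul_exp_neg_sq_mul_le {k r t : ℝ} (hk : 0 < k) (ht : 0 < t) :
    r * Real.exp (-(k * r ^ 2 * t)) ≤ (√t)⁻¹ * (1 + 2 / k) * Real.exp (-(k / 2 * r ^ 2 * t)) := by
  have hst : 0 < √t := Real.sqrt_pos.2 ht
  have h1 := mul_exp_neg_le (c := k / 2) (x := r ^ 2 * t) (by positivity)
  have h2 : Real.exp (-(k / 2 * (r ^ 2 * t))) ≤ 1 := by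
    rw [Real.exp_le_one_iff]; simp; positivity
  have h3 : √t * r ≤ 1 + r ^ 2 * t := by
    nlinarith [sq_nonneg (√t * r - 1), Real.sq_sqrt ht.le]
  have h4 : Real.exp (-(k * r ^ 2 * t)) =
      Real.exp (-(k / 2 * (r ^ 2 * t))) * Real.exp (-(k / 2 * r ^ 2 * t)) := by
    rw [← Real.exp_add]; ring_nf
  rw [h4, ← mul_assoc]
  refine mul_le_mul_of_nonneg_right ?_ (Real.exp_pos _).le
  rw [inv_mul_eq_div, le_div_iff₀ hst]
  calc _ = √t * r * Real.exp (-(k / 2 * (r ^ 2 * t))) := by ring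
    _ ≤ (1 + r ^ 2 * t) * Real.exp (-(k / 2 * (r ^ 2 * t))) := by gcongr
    _ = Real.exp (-(k / 2 * (r ^ 2 * t))) + r ^ 2 * t * Real.exp (-(k / 2 * (r ^ 2 * t))) := by ring
    _ ≤ 1 + 1 / (k / 2) := add_le_add h2 h1
    _ = _ := by field_simp

theorem symbolProfile_sub (s D Γ Γ₁ r t : ℝ) (f₀ f₁ z₀ g₀ g₁ w₀ : ℂ) :
    symbolProfile s D Γ Γ₁ r t f₀ f₁ z₀ - symbolProfile s D Γ Γ₁ r t g₀ g₁ w₀ =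
      symbolProfile s D Γ Γ₁ r t (f₀ - g₀) (f₁ - g₁) (z₀ - w₀) := by
  unfold symbolProfile; ring

/-! ### Error bounds at each frequency -/

/-- The `L¹` part of the data norm. -/
noncomputable def massNorm (φ₀ φ₁ T₀ : Sp n → ℝ) : ℝ :=
  (∫ x, |φ₀ x|) + ((∫ x, |φ₁ x|) + ∫ x, ‖x‖ * |φ₁ x|) + ∫ x, |T₀ x|

/-- The `L²` part of the data norm. -/
noncomputable def energyNorm (φ₀ φ₁ T₀ : Sp n → ℝ) : ENNReal :=
  eLpNorm φ₀ 2 volume + eLpNorm φ₁ 2 volume + eLpNorm T₀ 2 volume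

/-- The size of the Fourier transform of the data. -/
noncomputable def fourierSize (φ₀ φ₁ T₀ : Sp n → ℝ) (ξ : Sp n) : ℝ :=
  ‖realFourier φ₀ ξ‖ + ‖realFourier φ₁ ξ‖ + ‖realFourier T₀ ξ‖

theorem dataNorm_eq {φ₀ φ₁ T₀ : Sp n → ℝ} (h₀ : Integrable φ₀) (h₁ : Integrable φ₁)
    (hx : Integrable fun x => ‖x‖ * |φ₁ x|) (hT : Integrable T₀) :
    dataNorm φ₀ φ₁ T₀ = ENNReal.ofReal (massNorm φ₀ φ₁ T₀) + energyNorm φ₀ φ₁ T₀ := by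
  have p0 : 0 ≤ ∫ x, |φ₀ x| := integral_nonneg fun _ => abs_nonneg _
  have p1 : 0 ≤ ∫ x, |φ₁ x| := integral_nonneg fun _ => abs_nonneg _
  have p2 : 0 ≤ ∫ x, ‖x‖ * |φ₁ x| := integral_nonneg fun _ => by positivity
  have p3 : 0 ≤ ∫ x, |T₀ x| := integral_nonneg fun _ => abs_nonneg _
  rw [dataNorm, normL2L1, normL2L1, eLpNorm_one_eq h₀, eLpNorm_one_eq hT, normL11_eq h₁ hx,
    massNorm, ENNReal.ofReal_add (by positivity) p3, ENNReal.ofReal_add p0 (by positivity),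
    energyNorm]
  ring

theorem massNorm_nonneg (φ₀ φ₁ T₀ : Sp n → ℝ) : 0 ≤ massNorm φ₀ φ₁ T₀ := by
  have p0 : 0 ≤ ∫ x, |φ₀ x| := integral_nonneg fun _ => abs_nonneg _
  have p1 : 0 ≤ ∫ x, |φ₁ x| := integral_nonneg fun _ => abs_nonneg _
  have p2 : 0 ≤ ∫ x, ‖x‖ * |φ₁ x| := integral_nonneg fun _ => by positivity
  have p3 : 0 ≤ ∫ x, |T₀ x| := integral_nonneg fun _ => abs_nonneg _
  unfold massNorm; positivity

theorem fourierSize_le (φ₀ φ₁ T₀ : Sp n → ℝ) (ξ : Sp n) :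
    fourierSize φ₀ φ₁ T₀ ξ ≤ massNorm φ₀ φ₁ T₀ := by
  have p2 : 0 ≤ ∫ x, ‖x‖ * |φ₁ x| := integral_nonneg fun _ => by positivity
  have h0 := norm_realFourier_le φ₀ ξ
  have h1 := norm_realFourier_le φ₁ ξ
  have h2 := norm_realFourier_le T₀ ξ
  unfold fourierSize massNorm; linarith

theorem eLpNorm_fourierSize_le {φ₀ φ₁ T₀ : Sp n → ℝ} (h₀ : Integrable φ₀) (h₁ : Integrable φ₁)
    (hT : Integrable T₀) (k₀ : MemLp φ₀ 2 volume) (k₁ : MemLp φ₁ 2 volume)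
    (kT : MemLp T₀ 2 volume) :
    eLpNorm (fourierSize φ₀ φ₁ T₀) 2 volume ≤ energyNorm φ₀ φ₁ T₀ := by
  have m {f : Sp n → ℝ} (hf : Integrable f) :
      AEStronglyMeasurable (fun ξ => ‖realFourier f ξ‖) volume :=
    (continuous_realFourier hf).norm.aestronglyMeasurable
  refine (eLpNorm_add_le ((m h₀).add (m h₁)) (m hT) (by norm_num)).trans ?_
  refine (add_le_add_left (eLpNorm_add_le (m h₀) (m h₁) (by norm_num)) _).trans ?_
  simp_rw [eLpNorm_norm]
  rw [eLpNorm_realFourier h₀ k₀, eLpNorm_realFourier h₁ k₁, eLpNorm_realFourier hT kT, energyNorm]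

/-- The `L²` norm of a frequency function under a Gaussian bound at low frequencies. -/
theorem eLpNorm_le_of_gaussian_bound {φ₀ φ₁ T₀ : Sp n → ℝ} (h₀ : Integrable φ₀)
    (h₁ : Integrable φ₁) (hT : Integrable T₀) (k₀ : MemLp φ₀ 2 volume) (k₁ : MemLp φ₁ 2 volume)
    (kT : MemLp T₀ 2 volume) {κ t a b : ℝ} (hκ : 0 < κ) (ht : 0 < t) (ha : 0 ≤ a) (hb : 0 ≤ b)
    {F : Sp n → ℂ} (hF : ∀ᵐ ξ, ‖F ξ‖ ≤ a * Real.exp (-(κ * (2 * Real.pi * ‖ξ‖) ^ 2 * t))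
      + b * fourierSize φ₀ φ₁ T₀ ξ) :
    eLpNorm F 2 volume ≤
      ENNReal.ofReal (a * ((8 * Real.pi * κ) ^ (-(n : ℝ) / 4) * t ^ (-(n : ℝ) / 4)))
        + ENNReal.ofReal b * energyNorm φ₀ φ₁ T₀ := by
  have m1 : AEStronglyMeasurable
      (a • fun ξ : Sp n => Real.exp (-(κ * (2 * Real.pi * ‖ξ‖) ^ 2 * t))) volume :=
    Continuous.aestronglyMeasurable (by fun_prop)
  have m2 : AEStronglyMeasurable (b • fourierSize φ₀ φ₁ T₀) volume := by
    have := continuous_realFourier h₀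
    have := continuous_realFourier h₁
    have := continuous_realFourier hT
    have : Continuous (fourierSize φ₀ φ₁ T₀) := by unfold fourierSize; fun_prop
    exact (this.const_smul b).aestronglyMeasurable
  refine (eLpNorm_mono_ae_real hF).trans ((eLpNorm_add_le m1 m2 (by norm_num)).trans ?_)
  rw [eLpNorm_const_smul, eLpNorm_const_smul, eLpNorm_gaussian hκ ht, Real.enorm_of_nonneg ha,
    Real.enorm_of_nonneg hb, ← ENNReal.ofReal_mul ha]
  gcongr
  exact eLpNorm_fourierSize_le h₀ h₁ hT k₀ k₁ kT

theorem exists_modeState_sub_symbolProfile_le (p : Params) :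
    ∃ k C : ℝ, 0 < k ∧ 0 < C ∧ ∀ (φ₀ φ₁ T₀ : Sp n → ℝ) (ξ : Sp n), ξ ≠ 0 → ∀ t ≥ 0,
      ‖(modeState p φ₀ φ₁ T₀ t ξ).1 - symbolProfile p.speed p.Dth p.Γ₀ p.Γ₁ (2 * Real.pi * ‖ξ‖) t
        (initState p φ₀ φ₁ T₀ ξ).1 (initState p φ₀ φ₁ T₀ ξ).2.1 (initState p φ₀ φ₁ T₀ ξ).2.2‖ ≤
      C * (2 * Real.pi * ‖ξ‖ * Real.exp (-(k * (2 * Real.pi * ‖ξ‖) ^ 2 * t)) + Real.exp (-(k * t)))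
        * (‖(initState p φ₀ φ₁ T₀ ξ).1‖ + ‖(initState p φ₀ φ₁ T₀ ξ).2.1‖
          + ‖(initState p φ₀ φ₁ T₀ ξ).2.2‖) := by
  have hs := p.speed_pos
  have h2 := p.β_gt
  have hb : 0 < (1 + p.β) * p.ν₀ := mul_pos (by linarith) p.ν₀_pos
  have hm : 0 < p.γ - 1 := by linarith [p.γ_gt]
  obtain ⟨k, C, hk, hC, H⟩ := IsModeSolution.sub_symbolProfile_le hs hb hm p.Dth_pos
    (Γ := p.Γ₀) (Γ₁ := p.Γ₁) (by rw [Params.Γ₀]; ring) (by rw [Params.Γ₁]; field_simp; ring)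
  refine ⟨k, C, hk, hC, fun φ₀ φ₁ T₀ ξ hξ t ht => ?_⟩
  have h := H (2 * Real.pi * ‖ξ‖) (by positivity) _ _ _
    (isModeSolution_modeFlow p.speed ((1 + p.β) * p.ν₀) (p.γ - 1) p.Dth ((2 * Real.pi * ‖ξ‖) ^ 2)
      (initState p φ₀ φ₁ T₀ ξ)) t ht
  simp only [modeFlow_zero] at h
  exact h

theorem norm_state_le (p : Params) (f₀ f₁ θ : ℂ) :
    ‖f₀‖ + ‖f₁‖ + ‖(p.αp * p.speed ^ 2 : ℝ) * θ + (p.γ - 1 : ℝ) * f₁‖ ≤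
      (p.γ + p.αp * p.speed ^ 2) * (‖f₀‖ + ‖f₁‖ + ‖θ‖) := by
  have hγ := p.γ_gt
  have hα : 0 < p.αp * p.speed ^ 2 := mul_pos p.αp_pos (pow_pos p.speed_pos 2)
  have h := norm_add_le (((p.αp * p.speed ^ 2 : ℝ) : ℂ) * θ) (((p.γ - 1 : ℝ) : ℂ) * f₁)
  rw [norm_mul, norm_mul, Complex.norm_real, Complex.norm_real, Real.norm_of_nonneg hα.le,
    Real.norm_of_nonneg (by linarith)] at h
  nlinarith [norm_nonneg f₀, norm_nonneg f₁, norm_nonneg θ, mul_nonneg hα.le (norm_nonneg f₀),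
    mul_nonneg hα.le (norm_nonneg f₁), mul_nonneg (sub_nonneg.2 hγ.le) (norm_nonneg f₀),
    mul_nonneg (sub_nonneg.2 hγ.le) (norm_nonneg θ)]

theorem norm_wave_mul_le (p : Params) {r t B : ℝ} (hr : 0 < r) {z : ℂ} (hz : ‖z‖ ≤ r * B) :
    ‖(waveProfile p t r : ℂ) * z‖ ≤ 1 / p.speed * B * Real.exp (-(p.Γ₀ * r ^ 2 * t)) := by
  have hs := p.speed_pos
  rw [norm_mul, Complex.norm_real, Real.norm_eq_abs]
  calc _ ≤ 1 / (p.speed * r) * Real.exp (-(p.Γ₀ * r ^ 2 * t)) * (r * B) :=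
        mul_le_mul (abs_wave_le hs hr) hz (norm_nonneg _) (by positivity)
    _ = _ := by field_simp

/-- Three errors add up: mode against profile, profile against its wave part, and the transform of
`φ₁` against its mean. In the last one the first moment compensates `1/r`. The condition `t ≥ 1`
only serves to drop a factor `t^(-1/2)`. The Gaussian part uses `L¹` norms of the data; the
exponentially small part keeps the transforms themselves, to be measured in `L²`. -/
theorem exists_modeState_sub_leadingSymbol_le (p : Params) :
    ∃ κ C : ℝ, 0 < κ ∧ 0 < C ∧ ∀ φ₀ φ₁ T₀ : Sp n → ℝ, Integrable φ₁ →
      Integrable (fun x => ‖x‖ * |φ₁ x|) → ∀ ξ : Sp n, ξ ≠ 0 → ∀ t ≥ 1,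
      ‖(modeState p φ₀ φ₁ T₀ t ξ).1 - leadingSymbol p φ₁ t ξ‖ ≤
        C * massNorm φ₀ φ₁ T₀ * Real.exp (-(κ * (2 * Real.pi * ‖ξ‖) ^ 2 * t))
          + C * Real.exp (-(κ * t)) * fourierSize φ₀ φ₁ T₀ ξ := by
  have hs := p.speed_pos
  have hD := p.Dth_pos
  have hΓ := p.Γ₀_pos
  obtain ⟨k, C₁, hk, hC₁, H₁⟩ := exists_modeState_sub_symbolProfile_le (n := n) p
  obtain ⟨C₂, hC₂, H₂⟩ := symbolProfile_sub_wave_le p.Γ₁ hs hD hΓ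
  set k₂ := min (p.Γ₀ / 2) p.Dth
  have hk₂ : 0 < k₂ := by positivity
  set κ := min (k / 2) k₂
  have hκ : 0 < κ := by positivity
  have hκk : κ ≤ k / 2 := min_le_left _ _
  have hκ₂ : κ ≤ k₂ := min_le_right _ _
  have hκΓ : κ ≤ p.Γ₀ := hκ₂.trans ((min_le_left _ _).trans (by linarith))
  set B := p.γ + p.αp * p.speed ^ 2
  have hB : 0 < B := by
    have := mul_pos p.αp_pos (pow_pos hs 2); have := p.γ_gt
    simp only [B]; linarith
  refine ⟨κ, (C₁ * (1 + 2 / k) + C₂) * B + 1 / p.speed + C₁ * B, hκ, by positivity, ?_⟩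
  intro φ₀ φ₁ T₀ h₁ hx ξ hξ t ht
  have ht0 : 0 < t := one_pos.trans_le ht
  have hr : 0 < 2 * Real.pi * ‖ξ‖ := by positivity
  have a1 := H₁ φ₀ φ₁ T₀ ξ hξ t ht0.le
  have a2 := H₂ (2 * Real.pi * ‖ξ‖) t ht0.le (initState p φ₀ φ₁ T₀ ξ).1
    (initState p φ₀ φ₁ T₀ ξ).2.1 (initState p φ₀ φ₁ T₀ ξ).2.2
  have a3 := norm_wave_mul_le p (t := t) hr (norm_realFourier_sub_mean_le h₁ hx ξ)
  have a4 : ‖(initState p φ₀ φ₁ T₀ ξ).1‖ + ‖(initState p φ₀ φ₁ T₀ ξ).2.1‖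
      + ‖(initState p φ₀ φ₁ T₀ ξ).2.2‖ ≤ B * fourierSize φ₀ φ₁ T₀ ξ :=
    norm_state_le p (realFourier φ₀ ξ) (realFourier φ₁ ξ) (realFourier T₀ ξ)
  have a5 := mul_exp_neg_sq_mul_le (r := 2 * Real.pi * ‖ξ‖) hk ht0
  set r := 2 * Real.pi * ‖ξ‖
  set x := initState p φ₀ φ₁ T₀ ξ
  set N := ‖x.1‖ + ‖x.2.1‖ + ‖x.2.2‖
  have hN : 0 ≤ N := by positivity
  set F := fourierSize φ₀ φ₁ T₀ ξ
  have hF : 0 ≤ F := by simp only [F, fourierSize]; positivity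
  have hFS : F ≤ massNorm φ₀ φ₁ T₀ := fourierSize_le φ₀ φ₁ T₀ ξ
  set S := massNorm φ₀ φ₁ T₀
  set m₁ := ∫ x, ‖x‖ * |φ₁ x| with hm₁
  have hm₁S : m₁ ≤ S := by
    have p0 : 0 ≤ ∫ x, |φ₀ x| := integral_nonneg fun _ => abs_nonneg _
    have p1 : 0 ≤ ∫ x, |φ₁ x| := integral_nonneg fun _ => abs_nonneg _
    have p3 : 0 ≤ ∫ x, |T₀ x| := integral_nonneg fun _ => abs_nonneg _
    simp only [S, massNorm]; linarith
  have hS : 0 ≤ S := hF.trans hFS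
  set g := Real.exp (-(κ * r ^ 2 * t))
  have g0 : 0 < g := Real.exp_pos _
  have g1 : Real.exp (-(k / 2 * r ^ 2 * t)) ≤ g := by simp only [g]; gcongr
  have g2 : Real.exp (-(k₂ * r ^ 2 * t)) ≤ g := by simp only [g]; gcongr
  have g3 : Real.exp (-(p.Γ₀ * r ^ 2 * t)) ≤ g := by simp only [g]; gcongr
  have g4 : Real.exp (-(k * t)) ≤ Real.exp (-(κ * t)) := by
    gcongr; linarith
  have hst : (√t)⁻¹ ≤ 1 := inv_le_one_of_one_le₀ (Real.one_le_sqrt.2 ht)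
  have b1 : r * Real.exp (-(k * r ^ 2 * t)) ≤ (1 + 2 / k) * g := by
    refine a5.trans ?_
    calc _ ≤ 1 * (1 + 2 / k) * g := by gcongr
      _ = _ := by ring
  have split : (modeState p φ₀ φ₁ T₀ t ξ).1 - leadingSymbol p φ₁ t ξ =
      ((modeState p φ₀ φ₁ T₀ t ξ).1 - symbolProfile p.speed p.Dth p.Γ₀ p.Γ₁ r t x.1 x.2.1 x.2.2)
      + (symbolProfile p.speed p.Dth p.Γ₀ p.Γ₁ r t x.1 x.2.1 x.2.2 - (waveProfile p t r : ℂ) * x.2.1)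
      + (waveProfile p t r : ℂ) * (realFourier φ₁ ξ - (mean φ₁ : ℝ)) := by
    have : x.2.1 = realFourier φ₁ ξ := rfl
    rw [this, leadingSymbol, radialMultiplier]; ring
  rw [split]
  refine (norm_add₃_le).trans ((add_le_add (add_le_add a1 a2) a3).trans ?_)
  calc _ ≤ C₁ * ((1 + 2 / k) * g + Real.exp (-(κ * t))) * (B * F) + C₂ * g * (B * S)
          + 1 / p.speed * S * g := by
        gcongr
        exact a4.trans (by gcongr)
    _ = C₁ * (1 + 2 / k) * g * B * F + C₁ * B * Real.exp (-(κ * t)) * F + C₂ * g * B * S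
          + 1 / p.speed * S * g := by ring
    _ ≤ C₁ * (1 + 2 / k) * g * B * S + C₁ * B * Real.exp (-(κ * t)) * F + C₂ * g * B * S
          + 1 / p.speed * S * g := by gcongr
    _ ≤ (C₁ * (1 + 2 / k) * g * B * S + C₁ * B * Real.exp (-(κ * t)) * F + C₂ * g * B * S
          + 1 / p.speed * S * g) + (C₁ * B * S * g
          + ((C₁ * (1 + 2 / k) + C₂) * B + 1 / p.speed) * Real.exp (-(κ * t)) * F) :=
        le_add_of_nonneg_right (by positivity)
    _ = _ := by ring

/-- As `symbolProfile` is linear in the data, subtracting the means reduces everything to the small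
differences at frequency zero; the singular wave part is compared with the first-order Taylor
polynomial instead. Each remaining term carries `ε`, `t^(-1/2)` or `exp(-κt)`. -/
theorem exists_modeState_sub_fullSymbol_le (p : Params) :
    ∃ κ C : ℝ, 0 < κ ∧ 0 < C ∧ ∀ φ₀ φ₁ T₀ : Sp n → ℝ, Integrable φ₀ → Integrable φ₁ →
      Integrable (fun x => ‖x‖ * |φ₁ x|) → Integrable T₀ → ∀ ε > 0, ∃ K, 0 ≤ K ∧
      ∀ ξ : Sp n, ξ ≠ 0 → ∀ t > 0,
      ‖(modeState p φ₀ φ₁ T₀ t ξ).1 - fullSymbol p φ₀ φ₁ T₀ t ξ‖ ≤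
        (C * ε + K * (√t)⁻¹) * Real.exp (-(κ * (2 * Real.pi * ‖ξ‖) ^ 2 * t))
          + C * Real.exp (-(κ * t)) * fourierSize φ₀ φ₁ T₀ ξ := by
  have hs := p.speed_pos
  have hD := p.Dth_pos
  have hΓ := p.Γ₀_pos
  obtain ⟨k, C₁, hk, hC₁, H₁⟩ := exists_modeState_sub_symbolProfile_le (n := n) p
  obtain ⟨C₂, hC₂, H₂⟩ := symbolProfile_sub_wave_le p.Γ₁ hs hD hΓ
  set k₂ := min (p.Γ₀ / 2) p.Dth
  have hk₂ : 0 < k₂ := by positivity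
  set κ := min (k / 2) (k₂ / 2)
  have hκ : 0 < κ := by positivity
  have hκk : κ ≤ k / 2 := min_le_left _ _
  have hκ₂ : κ ≤ k₂ / 2 := min_le_right _ _
  have hk₂Γ : k₂ ≤ p.Γ₀ := (min_le_left _ _).trans (by linarith)
  set B := p.γ + p.αp * p.speed ^ 2
  have hB : 0 < B := by
    have := mul_pos p.αp_pos (pow_pos hs 2); have := p.γ_gt
    simp only [B]; linarith
  refine ⟨κ, (3 * B * C₂ + 1 / p.speed) + C₁ * B, hκ, by positivity, ?_⟩
  intro φ₀ φ₁ T₀ h₀ h₁ hx hT ε hε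
  obtain ⟨K₀, hK₀, e₀⟩ := exists_realFourier_sub_mean_le h₀ hε
  obtain ⟨K₁, hK₁, e₁⟩ := exists_realFourier_sub_mean_le h₁ hε
  obtain ⟨K₂, hK₂, e₂⟩ := exists_realFourier_sub_mean_le hT hε
  obtain ⟨K₃, hK₃, e₃⟩ := exists_realFourier_sub_dipole_le h₁ hx hε
  set K := K₀ + K₁ + K₂ + K₃ with hK
  have hK0 : 0 ≤ K := by positivity
  set S := massNorm φ₀ φ₁ T₀
  have hS : 0 ≤ S := massNorm_nonneg _ _ _
  refine ⟨C₁ * (1 + 2 / k) * B * S + (3 * B * C₂ + 1 / p.speed) * K * (1 + 2 / k₂), by positivity,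
    fun ξ hξ t ht0 => ?_⟩
  have hr : 0 < 2 * Real.pi * ‖ξ‖ := by positivity
  have a1 := H₁ φ₀ φ₁ T₀ ξ hξ t ht0.le
  have a2 := H₂ (2 * Real.pi * ‖ξ‖) t ht0.le (realFourier φ₀ ξ - (mean φ₀ : ℝ))
    (realFourier φ₁ ξ - (mean φ₁ : ℝ)) ((p.αp * p.speed ^ 2 : ℝ) * (realFourier T₀ ξ - (mean T₀ : ℝ))
      + (p.γ - 1 : ℝ) * (realFourier φ₁ ξ - (mean φ₁ : ℝ)))
  have a3 := norm_wave_mul_le p (t := t) hr (e₃ ξ)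
  have a4 : ‖(initState p φ₀ φ₁ T₀ ξ).1‖ + ‖(initState p φ₀ φ₁ T₀ ξ).2.1‖
      + ‖(initState p φ₀ φ₁ T₀ ξ).2.2‖ ≤ B * fourierSize φ₀ φ₁ T₀ ξ :=
    norm_state_le p (realFourier φ₀ ξ) (realFourier φ₁ ξ) (realFourier T₀ ξ)
  have a5 := mul_exp_neg_sq_mul_le (r := 2 * Real.pi * ‖ξ‖) hk ht0
  have a6 := mul_exp_neg_sq_mul_le (r := 2 * Real.pi * ‖ξ‖) hk₂ ht0
  have a7 := norm_state_le p (realFourier φ₀ ξ - (mean φ₀ : ℝ))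
    (realFourier φ₁ ξ - (mean φ₁ : ℝ)) (realFourier T₀ ξ - (mean T₀ : ℝ))
  have e0 := e₀ ξ
  have e1 := e₁ ξ
  have e2 := e₂ ξ
  set r := 2 * Real.pi * ‖ξ‖ with hrdef
  set x := initState p φ₀ φ₁ T₀ ξ
  have hx0 : x.1 = realFourier φ₀ ξ := rfl
  have hx1 : x.2.1 = realFourier φ₁ ξ := rfl
  have hx2 : x.2.2 = (p.αp * p.speed ^ 2 : ℝ) * realFourier T₀ ξ
    + (p.γ - 1 : ℝ) * realFourier φ₁ ξ := rfl
  have split : (modeState p φ₀ φ₁ T₀ t ξ).1 - fullSymbol p φ₀ φ₁ T₀ t ξ =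
      ((modeState p φ₀ φ₁ T₀ t ξ).1 - symbolProfile p.speed p.Dth p.Γ₀ p.Γ₁ r t x.1 x.2.1 x.2.2)
      + (symbolProfile p.speed p.Dth p.Γ₀ p.Γ₁ r t (realFourier φ₀ ξ - (mean φ₀ : ℝ))
        (realFourier φ₁ ξ - (mean φ₁ : ℝ)) ((p.αp * p.speed ^ 2 : ℝ) *
          (realFourier T₀ ξ - (mean T₀ : ℝ)) + (p.γ - 1 : ℝ) * (realFourier φ₁ ξ - (mean φ₁ : ℝ)))
        - (waveProfile p t r : ℂ) * (realFourier φ₁ ξ - (mean φ₁ : ℝ)))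
      + (waveProfile p t r : ℂ) * (realFourier φ₁ ξ - (mean φ₁ : ℝ)
        + (2 * Real.pi * inner ℝ ξ (moment φ₁) : ℝ) * Complex.I) := by
    have hz : ((p.αp * p.speed ^ 2 : ℝ) : ℂ) * (realFourier T₀ ξ - (mean T₀ : ℝ))
        + (p.γ - 1 : ℝ) * (realFourier φ₁ ξ - (mean φ₁ : ℝ)) =
        x.2.2 - ((p.αp * p.speed ^ 2 * mean T₀ + (p.γ - 1) * mean φ₁ : ℝ) : ℂ) := by
      rw [hx2]; push_cast; ring
    rw [hz, ← hx0, ← hx1, ← symbolProfile_sub, fullSymbol, ← hrdef]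
    push_cast
    ring
  rw [split]
  refine (norm_add₃_le).trans ((add_le_add (add_le_add a1 a2) a3).trans ?_)
  set N := ‖x.1‖ + ‖x.2.1‖ + ‖x.2.2‖
  have hN : 0 ≤ N := by positivity
  have hFS : fourierSize φ₀ φ₁ T₀ ξ ≤ S := fourierSize_le φ₀ φ₁ T₀ ξ
  set F := fourierSize φ₀ φ₁ T₀ ξ
  have hF : 0 ≤ F := by simp only [F, fourierSize]; positivity
  set g := Real.exp (-(κ * r ^ 2 * t))
  have g0 : 0 < g := Real.exp_pos _
  have g1 : Real.exp (-(k / 2 * r ^ 2 * t)) ≤ g := by simp only [g]; gcongr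
  have g2 : Real.exp (-(k₂ / 2 * r ^ 2 * t)) ≤ g := by simp only [g]; gcongr
  have g3 : Real.exp (-(k₂ * r ^ 2 * t)) ≤ g := by simp only [g]; gcongr; linarith
  have g4 : Real.exp (-(k * t)) ≤ Real.exp (-(κ * t)) := by
    gcongr; linarith
  have g5 : Real.exp (-(p.Γ₀ * r ^ 2 * t)) ≤ Real.exp (-(k₂ * r ^ 2 * t)) := by gcongr
  have hst : 0 < (√t)⁻¹ := inv_pos.2 (Real.sqrt_pos.2 ht0)
  have b1 : r * Real.exp (-(k * r ^ 2 * t)) ≤ (√t)⁻¹ * (1 + 2 / k) * g :=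
    a5.trans (by gcongr)
  have b2 : r * Real.exp (-(k₂ * r ^ 2 * t)) ≤ (√t)⁻¹ * (1 + 2 / k₂) * g :=
    a6.trans (by gcongr)
  have b3 : ‖realFourier φ₀ ξ - (mean φ₀ : ℝ)‖ + ‖realFourier φ₁ ξ - (mean φ₁ : ℝ)‖
      + ‖realFourier T₀ ξ - (mean T₀ : ℝ)‖ ≤ 3 * (ε + K * r) := by
    have : 0 ≤ K₀ * r := by positivity
    have : 0 ≤ K₁ * r := by positivity
    have : 0 ≤ K₂ * r := by positivity
    have : 0 ≤ K₃ * r := by positivity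
    have : K * r = K₀ * r + K₁ * r + K₂ * r + K₃ * r := by rw [hK]; ring
    linarith
  have b4 : ε + K₃ * r ≤ ε + K * r := by
    have : K₃ ≤ K := by rw [hK]; linarith
    gcongr
  calc _ ≤ C₁ * ((√t)⁻¹ * (1 + 2 / k) * g + Real.exp (-(κ * t))) * (B * F)
          + C₂ * Real.exp (-(k₂ * r ^ 2 * t)) * (B * (3 * (ε + K * r)))
          + 1 / p.speed * (ε + K * r) * Real.exp (-(k₂ * r ^ 2 * t)) := by
        gcongr
        exact a7.trans (by gcongr)
    _ = C₁ * (√t)⁻¹ * (1 + 2 / k) * g * B * F + C₁ * B * Real.exp (-(κ * t)) * F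
          + (3 * B * C₂ + 1 / p.speed) * (ε * Real.exp (-(k₂ * r ^ 2 * t))
            + K * (r * Real.exp (-(k₂ * r ^ 2 * t)))) := by ring
    _ ≤ C₁ * (√t)⁻¹ * (1 + 2 / k) * g * B * S + C₁ * B * Real.exp (-(κ * t)) * F
          + (3 * B * C₂ + 1 / p.speed) * (ε * g + K * ((√t)⁻¹ * (1 + 2 / k₂) * g)) := by
        gcongr
    _ ≤ (C₁ * (√t)⁻¹ * (1 + 2 / k) * g * B * S + C₁ * B * Real.exp (-(κ * t)) * F
          + (3 * B * C₂ + 1 / p.speed) * (ε * g + K * ((√t)⁻¹ * (1 + 2 / k₂) * g)))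
          + (C₁ * B * ε * g + (3 * B * C₂ + 1 / p.speed) * Real.exp (-(κ * t)) * F) :=
        le_add_of_nonneg_right (by positivity)
    _ = _ := by ring

/-! ### Return to physical space and the decay rates -/

theorem eLpNorm_lp_sub_fourierInv (f : Lp ℝ 2 (volume : Measure (Sp n))) {m v : Sp n → ℂ}
    (hf : fourierLp f =ᵐ[volume] v) (hm : Integrable m) (hm2 : MemLp m 2 volume) :
    eLpNorm (fun x => (f x : ℂ) - 𝓕⁻ m x) 2 volume = eLpNorm (fun ξ => v ξ - m ξ) 2 volume := by
  have h1 : eLpNorm (fun x => (f x : ℂ) - 𝓕⁻ m x) 2 volume =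
      eLpNorm (fun x => (Complex.ofRealCLM.compLpL 2 volume f : Lp ℂ 2 (volume : Measure (Sp n))) x
        - 𝓕⁻ m x) 2 volume := by
    refine eLpNorm_congr_ae ?_
    filter_upwards [Complex.ofRealCLM.coeFn_compLpL (p := 2) f] with x hx
    rw [hx]; rfl
  rw [h1, eLpNorm_sub_fourierInv _ hm hm2]
  refine eLpNorm_congr_ae ?_
  filter_upwards [hf] with ξ hξ
  rw [← hξ]; rfl

variable {p : Params} {φ₀ φ₁ T₀ : Sp n → ℝ} {φ T : ℝ → Lp ℝ 2 (volume : Measure (Sp n))}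

theorem IsWeakSolution.err_eq (h : IsWeakSolution p φ₀ φ₁ T₀ φ T) (h₀ : Integrable φ₀)
    (h₁ : Integrable φ₁) (hT : Integrable T₀) {t : ℝ} (ht : 0 < t) :
    err p φ₁ φ t = eLpNorm (fun ξ => (modeState p φ₀ φ₁ T₀ t ξ).1 - leadingSymbol p φ₁ t ξ)
      2 volume := by
  rw [err, leading_eq]
  have hm := memLp_leadingSymbol p φ₁ ht
  exact eLpNorm_lp_sub_fourierInv _ (h.fourierLp_ae_eq h₀ h₁ hT ht.le) hm.1 hm.2

theorem IsWeakSolution.err₂_eq (h : IsWeakSolution p φ₀ φ₁ T₀ φ T) (h₀ : Integrable φ₀)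
    (h₁ : Integrable φ₁) (hT : Integrable T₀) {t : ℝ} (ht : 0 < t) :
    err₂ p φ₀ φ₁ T₀ φ t =
      eLpNorm (fun ξ => (modeState p φ₀ φ₁ T₀ t ξ).1 - fullSymbol p φ₀ φ₁ T₀ t ξ) 2 volume := by
  obtain ⟨h1, h2, h3⟩ := leading_add_second_eq p φ₀ φ₁ T₀ ht
  rw [← eLpNorm_lp_sub_fourierInv _ (h.fourierLp_ae_eq h₀ h₁ hT ht.le) h1 h2, ← h3, err₂]
  simp_rw [sub_sub]

/-- The means are real and the radial symbols are real, so the dipole is, up to sign, the whole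
imaginary part of the second profile's symbol. The other terms cannot cancel it at any frequency. -/
theorem abs_dipoleSymbol_le (p : Params) (φ₀ φ₁ T₀ : Sp n → ℝ) (t : ℝ) (ξ : Sp n) :
    ‖dipoleSymbol p (moment φ₁) t ξ‖ ≤ ‖fullSymbol p φ₀ φ₁ T₀ t ξ - leadingSymbol p φ₁ t ξ‖ := by
  have h : dipoleSymbol p (moment φ₁) t ξ =
      -(fullSymbol p φ₀ φ₁ T₀ t ξ - leadingSymbol p φ₁ t ξ).im := by
    simp only [fullSymbol, leadingSymbol, symbolProfile, radialMultiplier, dipoleSymbol,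
      Complex.sub_im, Complex.add_im, Complex.im_ofReal_mul,
      Complex.ofReal_im, Complex.I_im]
    ring
  rw [h, norm_neg, Real.norm_eq_abs]
  exact Complex.abs_im_le_norm _

theorem IsWeakSolution.eLpNorm_dipoleSymbol_le (h : IsWeakSolution p φ₀ φ₁ T₀ φ T)
    (h₀ : Integrable φ₀) (h₁ : Integrable φ₁) (hT : Integrable T₀) {t : ℝ} (ht : 0 < t) :
    eLpNorm (dipoleSymbol p (moment φ₁) t) 2 volume ≤ err p φ₁ φ t + err₂ p φ₀ φ₁ T₀ φ t := by
  rw [h.err_eq h₀ h₁ hT ht, h.err₂_eq h₀ h₁ hT ht]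
  have hv : AEStronglyMeasurable (fun ξ => (modeState p φ₀ φ₁ T₀ t ξ).1) volume :=
    (Lp.aestronglyMeasurable _).congr (h.fourierLp_ae_eq h₀ h₁ hT ht.le)
  have hl := (memLp_leadingSymbol p φ₁ ht).2.aestronglyMeasurable
  have hf := (leading_add_second_eq p φ₀ φ₁ T₀ ht).1.aestronglyMeasurable
  refine le_trans ?_ (eLpNorm_sub_le (hv.sub hl) (hv.sub hf) (by norm_num))
  refine eLpNorm_mono fun ξ => (abs_dipoleSymbol_le p φ₀ φ₁ T₀ t ξ).trans (le_of_eq ?_)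
  congr 1
  simp only [Pi.sub_apply]
  ring

theorem eventually_exp_neg_mul_le {κ : ℝ} (hκ : 0 < κ) (a : ℝ) {δ : ℝ} (hδ : 0 < δ) :
    ∀ᶠ t : ℝ in atTop, Real.exp (-(κ * t)) ≤ δ * t ^ a := by
  filter_upwards [(isLittleO_exp_neg_mul_rpow_atTop hκ a).def hδ, eventually_gt_atTop 0] with t h ht
  rw [Real.norm_of_nonneg (Real.exp_pos _).le, Real.norm_of_nonneg (by positivity), neg_mul] at h
  exact h

theorem ae_ne_zero (hn : 1 ≤ n) : ∀ᵐ ξ : Sp n, ξ ≠ 0 := by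
  have : Nonempty (Fin n) := ⟨⟨0, hn⟩⟩
  exact Measure.ae_ne volume 0

/-- Weak solutions with the decay hypotheses on the data. -/
structure IsDecayingSolution (p : Params) (φ₀ φ₁ T₀ : Sp n → ℝ)
    (φ T : ℝ → Lp ℝ 2 (volume : Measure (Sp n))) : Prop where
  sol : IsWeakSolution p φ₀ φ₁ T₀ φ T
  int₀ : Integrable φ₀
  int₁ : Integrable φ₁
  intT : Integrable T₀
  mul₁ : Integrable fun x => ‖x‖ * |φ₁ x|
  sq₀ : MemLp φ₀ 2 volume
  sq₁ : MemLp φ₁ 2 volume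
  sqT : MemLp T₀ 2 volume

theorem exists_err_le (hn : 1 ≤ n) (p : Params) :
    ∃ C t₀ : ℝ, 0 < C ∧ 0 < t₀ ∧ ∀ (φ₀ φ₁ T₀ : Sp n → ℝ) φ T,
      IsDecayingSolution p φ₀ φ₁ T₀ φ T → ∀ t ≥ t₀,
      err p φ₁ φ t ≤ ENNReal.ofReal (C * t ^ (-(n : ℝ) / 4)) * dataNorm φ₀ φ₁ T₀ := by
  obtain ⟨κ, C, hκ, hC, H⟩ := exists_modeState_sub_leadingSymbol_le (n := n) p
  obtain ⟨t₁, ht₁⟩ := eventually_atTop.1 (eventually_exp_neg_mul_le hκ (-(n : ℝ) / 4) one_pos)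
  set c₀ := (8 * Real.pi * κ) ^ (-(n : ℝ) / 4)
  have hc₀ : 0 < c₀ := by positivity
  refine ⟨C * c₀ + C, max 1 t₁, by positivity, by positivity, fun φ₀ φ₁ T₀ φ T h t ht => ?_⟩
  have ht1 : 1 ≤ t := (le_max_left _ _).trans ht
  have ht0 : 0 < t := one_pos.trans_le ht1
  have hS := massNorm_nonneg φ₀ φ₁ T₀
  have key := eLpNorm_le_of_gaussian_bound h.int₀ h.int₁ h.intT h.sq₀ h.sq₁ h.sqT hκ ht0
    (mul_nonneg hC.le hS) (mul_nonneg hC.le (Real.exp_pos (-(κ * t))).le)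
    (F := fun ξ => (modeState p φ₀ φ₁ T₀ t ξ).1 - leadingSymbol p φ₁ t ξ)
    ((ae_ne_zero hn).mono fun ξ hξ => H φ₀ φ₁ T₀ h.int₁ h.mul₁ ξ hξ t ht1)
  rw [h.sol.err_eq h.int₀ h.int₁ h.intT ht0, dataNorm_eq h.int₀ h.int₁ h.mul₁ h.intT, mul_add]
  have hE := ht₁ t ((le_max_right _ _).trans ht)
  rw [one_mul] at hE
  have hT : 0 ≤ t ^ (-(n : ℝ) / 4) := by positivity
  refine key.trans (add_le_add ?_ (mul_le_mul_left ?_ _))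
  · rw [← ENNReal.ofReal_mul (by positivity)]
    refine ENNReal.ofReal_le_ofReal ?_
    calc _ = C * c₀ * t ^ (-(n : ℝ) / 4) * massNorm φ₀ φ₁ T₀ := by ring
      _ ≤ _ := by gcongr; linarith
  · refine ENNReal.ofReal_le_ofReal ?_
    calc _ ≤ C * t ^ (-(n : ℝ) / 4) := by gcongr
      _ ≤ _ := by gcongr; linarith [mul_pos hC hc₀]

theorem IsDecayingSolution.energyNorm_ne_top (h : IsDecayingSolution p φ₀ φ₁ T₀ φ T) :
    energyNorm φ₀ φ₁ T₀ ≠ ⊤ := by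
  simp only [energyNorm, ne_eq, ENNReal.add_eq_top, h.sq₀.2.ne, h.sq₁.2.ne, h.sqT.2.ne, or_self,
    not_false_eq_true]

theorem IsDecayingSolution.eventually_err₂_le (hn : 1 ≤ n)
    (h : IsDecayingSolution p φ₀ φ₁ T₀ φ T) {ε : ℝ} (hε : 0 < ε) :
    ∀ᶠ t : ℝ in atTop, err₂ p φ₀ φ₁ T₀ φ t ≤ ENNReal.ofReal (ε * t ^ (-(n : ℝ) / 4)) := by
  obtain ⟨κ, C, hκ, hC, H⟩ := exists_modeState_sub_fullSymbol_le (n := n) p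
  set c₀ := (8 * Real.pi * κ) ^ (-(n : ℝ) / 4)
  have hc₀ : 0 < c₀ := by positivity
  -- The given `ε` is shared in three: the Taylor error of the data, the `t^(-1/2)` term and the
  -- exponentially small term. In the last share `C * e + 1` avoids a division by zero when `e = 0`.
  obtain ⟨K, hK, H⟩ := H φ₀ φ₁ T₀ h.int₀ h.int₁ h.mul₁ h.intT (ε / (3 * C * c₀)) (by positivity)
  set e := (energyNorm φ₀ φ₁ T₀).toReal
  have he0 : 0 ≤ e := ENNReal.toReal_nonneg
  have hKt : ∀ᶠ t : ℝ in atTop, K * (√t)⁻¹ < ε / (3 * c₀) := by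
    have h1 : Tendsto (fun t : ℝ => K * (√t)⁻¹) atTop (𝓝 (K * 0)) :=
      (tendsto_inv_atTop_zero.comp Real.tendsto_sqrt_atTop).const_mul K
    rw [mul_zero] at h1
    exact h1.eventually_lt_const (by positivity)
  filter_upwards [hKt, eventually_gt_atTop 0, eventually_exp_neg_mul_le hκ (-(n : ℝ) / 4)
    (δ := ε / (3 * (C * e + 1))) (by positivity)] with t h1 ht0 h2
  have hst : 0 ≤ (√t)⁻¹ := by positivity
  have key := eLpNorm_le_of_gaussian_bound h.int₀ h.int₁ h.intT h.sq₀ h.sq₁ h.sqT hκ ht0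
    (a := C * (ε / (3 * C * c₀)) + K * (√t)⁻¹) (b := C * Real.exp (-(κ * t)))
    (by positivity) (by positivity)
    (F := fun ξ => (modeState p φ₀ φ₁ T₀ t ξ).1 - fullSymbol p φ₀ φ₁ T₀ t ξ)
    ((ae_ne_zero hn).mono fun ξ hξ => H ξ hξ t ht0)
  rw [h.sol.err₂_eq h.int₀ h.int₁ h.intT ht0]
  have hT : 0 ≤ t ^ (-(n : ℝ) / 4) := by positivity
  refine key.trans ?_
  rw [← ENNReal.ofReal_toReal h.energyNorm_ne_top, ← ENNReal.ofReal_mul (by positivity),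
    ← ENNReal.ofReal_add (by positivity) (by positivity)]
  refine ENNReal.ofReal_le_ofReal ?_
  calc _ ≤ (C * (ε / (3 * C * c₀)) + ε / (3 * c₀)) * (c₀ * t ^ (-(n : ℝ) / 4))
        + C * (ε / (3 * (C * e + 1)) * t ^ (-(n : ℝ) / 4)) * e := by gcongr
    _ = (2 * ε / 3 + ε / 3 * (C * e / (C * e + 1))) * t ^ (-(n : ℝ) / 4) := by
        field_simp; ring
    _ ≤ (2 * ε / 3 + ε / 3 * 1) * t ^ (-(n : ℝ) / 4) := by
        gcongr
        exact div_le_one_of_le₀ (by linarith) (by positivity)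
    _ = _ := by ring

end Thermoviscous

theorem theorem2p3 (n : ℕ) (hn : 1 ≤ n) (p : Params) :
    ∃ c C t₀ : ℝ, 0 < c ∧ 0 < C ∧ 0 < t₀ ∧
      ∀ φ₀ φ₁ T₀ : Sp n → ℝ,
        MemLp φ₀ 2 volume → MemLp φ₀ 1 volume →
        MemLp φ₁ 2 volume → MemLp φ₁ 1 volume → normL11 φ₁ < ⊤ →
        MemLp T₀ 2 volume → MemLp T₀ 1 volume →
      ∀ φ T : ℝ → Lp ℝ 2 (volume : Measure (Sp n)), IsWeakSolution p φ₀ φ₁ T₀ φ T →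
        -- upper bound
        (∀ t ≥ t₀, err p φ₁ φ t ≤
          ENNReal.ofReal (C * t ^ (-(n : ℝ) / 4)) * dataNorm φ₀ φ₁ T₀) ∧
        -- lower bound
        (moment φ₁ ≠ 0 → ∃ t₁ : ℝ, ∀ t ≥ t₁,
          ENNReal.ofReal (c * t ^ (-(n : ℝ) / 4) * ‖moment φ₁‖) ≤ err p φ₁ φ t) ∧
        -- optimal two-sided rate
        (moment φ₁ ≠ 0 → ∃ a A t₂ : ℝ, 0 < a ∧ 0 < A ∧ ∀ t ≥ t₂,
          ENNReal.ofReal (a * t ^ (-(n : ℝ) / 4)) ≤ err p φ₁ φ t ∧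
          err p φ₁ φ t ≤ ENNReal.ofReal (A * t ^ (-(n : ℝ) / 4))) ∧
        -- refined estimate with rate `o(t^(-n/4))`
        (∀ ε > 0, ∃ t₃ : ℝ, ∀ t ≥ t₃,
          err₂ p φ₀ φ₁ T₀ φ t ≤ ENNReal.ofReal (ε * t ^ (-(n : ℝ) / 4))) := by
  obtain ⟨C, t₀, hC, ht₀, hup⟩ := exists_err_le hn p
  obtain ⟨c, τ, hc, hτ, hlow⟩ := exists_le_eLpNorm_dipoleSymbol hn p
  refine ⟨c / 2, C, t₀, by positivity, hC, ht₀, fun φ₀ φ₁ T₀ h₀2 h₀1 h₁2 h₁1 hL hT2 hT1 φ T hsol => ?_⟩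
  have i₀ := memLp_one_iff_integrable.1 h₀1
  have i₁ := memLp_one_iff_integrable.1 h₁1
  have iT := memLp_one_iff_integrable.1 hT1
  have hx := integrable_norm_mul_of_normL11 i₁ hL
  have h : IsDecayingSolution p φ₀ φ₁ T₀ φ T := ⟨hsol, i₀, i₁, iT, hx, h₀2, h₁2, hT2⟩
  have lower (hM : moment φ₁ ≠ 0) : ∃ t₁ : ℝ, ∀ t ≥ t₁,
      ENNReal.ofReal (c / 2 * t ^ (-(n : ℝ) / 4) * ‖moment φ₁‖) ≤ err p φ₁ φ t := by
    have hM' : 0 < ‖moment φ₁‖ := norm_pos_iff.2 hM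
    -- The dipole has norm at least `c t^(-n/4) ‖M‖` and at most `err + err₂`. Eventually `err₂` is
    -- below half of that lower bound, so `err` carries the other half; hence the constant `c / 2`.
    obtain ⟨t₃, ht₃⟩ := eventually_atTop.1
      (h.eventually_err₂_le hn (ε := c / 2 * ‖moment φ₁‖) (by positivity))
    refine ⟨max τ t₃, fun t ht => ?_⟩
    have ht0 : 0 < t := hτ.trans_le ((le_max_left _ _).trans ht)
    have h1 := hlow t ((le_max_left _ _).trans ht) (moment φ₁)
    have h2 := hsol.eLpNorm_dipoleSymbol_le i₀ i₁ iT ht0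
    have h3 := ht₃ t ((le_max_right _ _).trans ht)
    have h4 : ENNReal.ofReal (c * t ^ (-(n : ℝ) / 4) * ‖moment φ₁‖) =
        ENNReal.ofReal (c / 2 * t ^ (-(n : ℝ) / 4) * ‖moment φ₁‖) +
        ENNReal.ofReal (c / 2 * ‖moment φ₁‖ * t ^ (-(n : ℝ) / 4)) := by
      rw [← ENNReal.ofReal_add (by positivity) (by positivity)]
      congr 1; ring
    rw [h4] at h1
    exact (ENNReal.add_le_add_iff_right ENNReal.ofReal_ne_top).1
      (h1.trans (h2.trans (add_le_add_right h3 _)))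
  refine ⟨hup φ₀ φ₁ T₀ φ T h, lower, fun hM => ?_, fun ε hε =>
    eventually_atTop.1 (h.eventually_err₂_le hn hε)⟩
  have hM' : 0 < ‖moment φ₁‖ := norm_pos_iff.2 hM
  obtain ⟨t₁, ht₁⟩ := lower hM
  have hdata : dataNorm φ₀ φ₁ T₀ ≠ ⊤ := by
    rw [dataNorm_eq i₀ i₁ hx iT]
    exact ENNReal.add_ne_top.2 ⟨ENNReal.ofReal_ne_top, h.energyNorm_ne_top⟩
  set d := (dataNorm φ₀ φ₁ T₀).toReal
  have hd : 0 ≤ d := ENNReal.toReal_nonneg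
  -- The `+ 1` makes the upper constant positive without a lower bound on the data norm.
  refine ⟨c / 2 * ‖moment φ₁‖, C * (d + 1), max t₀ t₁, by positivity, by positivity,
    fun t ht => ⟨?_, ?_⟩⟩
  · refine le_trans (le_of_eq ?_) (ht₁ t ((le_max_right _ _).trans ht))
    congr 1; ring
  · have ht0 : 0 < t := ht₀.trans_le ((le_max_left _ _).trans ht)
    refine (hup φ₀ φ₁ T₀ φ T h t ((le_max_left _ _).trans ht)).trans ?_
    rw [← ENNReal.ofReal_toReal hdata, ← ENNReal.ofReal_mul (by positivity)]
    refine ENNReal.ofReal_le_ofReal ?_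
    have : 0 ≤ C * t ^ (-(n : ℝ) / 4) := by positivity
    change C * t ^ (-(n : ℝ) / 4) * d ≤ _
    nlinarith
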